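/- Let $n\ge 2$ and let $\Omega\subseteq\mathbf R^n$ be a bounded domain (nonempty, open, connected) with Lipschitz boundary; let $\sigma$ be the $(n-1)$-dimensional Hausdorff measure and $n(x)$ the outer unit normal, defined $\sigma$-a.e. on $\partial\Omega$. Let $\mathbf A(x)=(a_{i,j}(x))_{i,j}$, $x\in\overline\Omega$, be symmetric matrices whose entries extend to $C^1$ functions on a neighbourhood of $\overline\Omega$ and for which there are constants $c_{\mathbf A},C_{\mathbf A}>0$ with $c_{\mathbf A}\|\xi\|^2\le \xi^T\mathbf A(x)\xi\le C_{\mathbf A}\|\xi\|^2$ for all $x\in\overline\Omega$, $\xi\in\mathbf R^n$. Put $Pu=\sum_{i,j}a_{i,j}\,\partial^2u/\partial x_i\partial x_j$, $\|y\|_{\mathbf A}=\sqrt{y^T\mathbf A y}$, $(\operatorname{div}\mathbf A)_i=\sum_j\partial a_{i,j}/\partial x_j$ and $d_{\mathbf A}=\|\operatorname{div}\mathbf A\|_{L^\infty(\Omega)}^2\,c_{\mathbf A}^{-1}$. Let $0<B\le\infty$, let $h:(0,B)\to(0,\infty)$ be continuous, and let $H'=h$ and $\widetilde H'=H$ on $(0,B)$;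 put $\mathcal G_H=H^2/h$. Let $I$ be the largest of the intervals $(0,B)$, $[0,B)$, $(0,B]$, $[0,B]$ (the last two are allowed only if $B<\infty$) to which $\widetilde H$ extends continuously; the extension is again denoted by $\widetilde H$. Let $u\in W^{2,1}_{\rm loc}(\Omega)$ satisfy $u(x)\in I$ for a.e. $x\in\Omega$, $\widetilde H(u)\in W^{2,1}(\Omega)$ and $Pu\,H(u)\,\chi_{\{u\in(0,B)\}}\in L^1(\Omega)$. Write $\Omega'=\Omega\cap\{u\in(0,B)\}$. Then $$\nabla(\widetilde H(u))=H(u)\,\nabla u\;\chi_{\{u\in(0,B)\}}\quad\text{a.e. in }\Omega,$$ and the following hold. 1. (Identity) $$\int_{\Omega'}\|\nabla u\|_{\mathbf A}^2\,h(u)\,dx=-\int_{\Omega'}Pu\,H(u)\,dx-\int_{\Omega'}\operatorname{div}\mathbf A\cdot\nabla u\,H(u)\,dx+\Theta,\qquad \Theta:=\int_{\partial\Omega}n(x)^T\mathbf A(x)\,\nabla(\widetilde H(u))\,d\sigma(x),$$ and all four integrands are integrable over their domains. Here the value of each component $w$ of $\nabla(\widetilde H(u))$ at $x\in\partial\Omega$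 is its trace $w(x)=\limsup_{r\to0_+}\frac1{|\Omega\cap B(x,r)|}\int_{\Omega\cap B(x,r)}w(y)\,dy$. 2. (Inequalities) If $\operatorname{div}\mathbf A\equiv0$ in $\Omega$, then $$\int_{\Omega'}\|\nabla u\|_{\mathbf A}^2\,h(u)\,dx\le\int_{\Omega'}|Pu|\,|H(u)|\,dx+\Theta;$$ otherwise $$\int_{\Omega'}\|\nabla u\|_{\mathbf A}^2\,h(u)\,dx\le2\int_{\Omega'}|Pu|\,|H(u)|\,dx+2\Theta+d_{\mathbf A}\int_{\Omega'}\mathcal G_H(u)\,dx,$$ where the last integral may be $+\infty$ (the inequality is then understood in the extended reals). -/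

import Mathlib

open MeasureTheory Filter Topology Set
open scoped ENNReal NNReal ContDiff Matrix

noncomputable section

/-- Euclidean space `ℝⁿ`. -/
abbrev Eu (n : ℕ) : Type := EuclideanSpace ℝ (Fin n)

/-! ### Lipschitz domains, surface measure, outer normal -/

/-- Bounded domain (nonempty, open, connected) with Lipschitz boundary: near every boundary point,
in a suitable Cartesian coordinate system `y ↦ T y = (y', yₙ) ∈ ℝⁿ⁻¹ × ℝ`, the set `Ω` is the
region `yₙ < f y'` below the graph of a Lipschitz function `f`. -/
structure IsLipschitzDomain {n : ℕ} (Ω : Set (Eu n)) : Prop where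
  isOpen : IsOpen Ω
  isConnected : IsConnected Ω
  isBounded : Bornology.IsBounded Ω
  lipschitz_boundary : ∀ x ∈ frontier Ω,
    ∃ U : Set (Eu n), IsOpen U ∧ x ∈ U ∧
    ∃ T : Eu n ≃ₗᵢ[ℝ] WithLp 2 (Eu (n - 1) × ℝ),
    ∃ (f : Eu (n - 1) → ℝ) (K : ℝ≥0), LipschitzWith K f ∧
      ∀ y ∈ U, y ∈ Ω ↔ (T y).snd < f (T y).fst

/-- The `(n-1)`-dimensional Hausdorff measure `σ` on `ℝⁿ`, normalised to agree with Lebesgue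
measure on hyperplanes. -/
def surfaceMeasure (n : ℕ) : Measure (Eu n) := μHE[n - 1]

/-- `ν` is the outer unit normal to `∂Ω` at `x`: to first order at `x`, the set `Ω` is the
half-space `{y | ⟪y - x, ν⟫ < 0}`. Such a `ν` is unique; for a Lipschitz graph it exists
exactly at the points of differentiability. -/
def IsOuterNormal {n : ℕ} (Ω : Set (Eu n)) (x ν : Eu n) : Prop :=
  ‖ν‖ = 1 ∧ ∀ ε > 0, ∀ᶠ y in 𝓝 x,
    (y ∈ Ω → inner ℝ (y - x) ν ≤ ε * ‖y - x‖) ∧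
    (y ∉ Ω → -(ε * ‖y - x‖) ≤ inner ℝ (y - x) ν)

open Classical in
/-- The outer unit normal field `n(x)` (set to `0` at points where there is no normal). -/
def outerNormal {n : ℕ} (Ω : Set (Eu n)) (x : Eu n) : Eu n :=
  if h : ∃ ν, IsOuterNormal Ω x ν then h.choose else 0

/-! ### Weak derivatives and Sobolev spaces -/

/-- `g` is the `i`-th weak partial derivative of `w` on the open set `Ω`. -/
structure HasWeakPartial {n : ℕ} (Ω : Set (Eu n)) (i : Fin n) (w g : Eu n → ℝ) : Prop where
  locallyIntegrable : LocallyIntegrableOn w Ω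
  locallyIntegrable_partial : LocallyIntegrableOn g Ω
  integral_eq : ∀ φ : Eu n → ℝ, ContDiff ℝ ∞ φ → HasCompactSupport φ → tsupport φ ⊆ Ω →
    ∫ x in Ω, w x * fderiv ℝ φ x (EuclideanSpace.single i 1) = -∫ x in Ω, g x * φ x

/-- The Sobolev space `W^{m,1}(Ω)`. -/
def MemW1 {n : ℕ} (Ω : Set (Eu n)) : ℕ → (Eu n → ℝ) → Prop
  | 0, w => IntegrableOn w Ω
  | m + 1, w => IntegrableOn w Ω ∧ ∀ i, ∃ g, HasWeakPartial Ω i w g ∧ MemW1 Ω m g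

/-- The local Sobolev space `W^{m,1}_loc(Ω)`. -/
def MemW1loc {n : ℕ} (Ω : Set (Eu n)) : ℕ → (Eu n → ℝ) → Prop
  | 0, w => LocallyIntegrableOn w Ω
  | m + 1, w => LocallyIntegrableOn w Ω ∧ ∀ i, ∃ g, HasWeakPartial Ω i w g ∧ MemW1loc Ω m g

open Classical in
/-- The `i`-th weak partial derivative on `Ω` (unique almost everywhere in `Ω`; `0` if there is
none). -/
def weakPartial {n : ℕ} (Ω : Set (Eu n)) (i : Fin n) (w : Eu n → ℝ) : Eu n → ℝ :=
  if h : ∃ g, HasWeakPartial Ω i w g then h.choose else 0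

/-- The weak gradient on `Ω`. -/
def weakGrad {n : ℕ} (Ω : Set (Eu n)) (w : Eu n → ℝ) (x : Eu n) : Eu n :=
  WithLp.toLp 2 fun i => weakPartial Ω i w x

/-- The pointwise value at `x ∈ closure Ω` of a Sobolev function: the upper limit, as `r → 0+`, of
its averages over `Ω ∩ B(x, r)`. On `∂Ω` this is the trace. -/
def pointValue {n : ℕ} (Ω : Set (Eu n)) (w : Eu n → ℝ) (x : Eu n) : ℝ :=
  (limsup (fun r : ℝ => ((⨍ y in Ω ∩ Metric.ball x r, w y : ℝ) : EReal)) (𝓝[>] 0)).toReal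

/-- The trace of `∇ w` on `∂Ω`, taken componentwise. -/
def gradTrace {n : ℕ} (Ω : Set (Eu n)) (w : Eu n → ℝ) (x : Eu n) : Eu n :=
  WithLp.toLp 2 fun i => pointValue Ω (weakPartial Ω i w) x

/-! ### The elliptic operator -/

/-- `yᵀ M z`. -/
def matForm {n : ℕ} (M : Matrix (Fin n) (Fin n) ℝ) (y z : Eu n) : ℝ :=
  y.ofLp ⬝ᵥ (M *ᵥ z.ofLp)

/-- The norm `‖y‖_M = √(yᵀ M y)`. -/
def matNorm {n : ℕ} (M : Matrix (Fin n) (Fin n) ℝ) (y : Eu n) : ℝ :=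
  √(matForm M y y)

/-- Uniform ellipticity with constants `c`, `C` and `C¹` regularity up to the boundary. -/
structure IsUniformlyElliptic {n : ℕ} (Ω : Set (Eu n)) (A : Eu n → Matrix (Fin n) (Fin n) ℝ)
    (c C : ℝ) : Prop where
  symm : ∀ x ∈ closure Ω, (A x).IsSymm
  contDiff : ∀ i j, ∃ (U : Set (Eu n)) (a : Eu n → ℝ), IsOpen U ∧ closure Ω ⊆ U ∧
    ContDiffOn ℝ 1 a U ∧ ∀ x ∈ closure Ω, a x = A x i j
  c_pos : 0 < c
  C_pos : 0 < C
  lower : ∀ x ∈ closure Ω, ∀ ξ : Eu n, c * ‖ξ‖ ^ 2 ≤ matForm (A x) ξ ξ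
  upper : ∀ x ∈ closure Ω, ∀ ξ : Eu n, matForm (A x) ξ ξ ≤ C * ‖ξ‖ ^ 2

/-- `P u = ∑ aᵢⱼ ∂²u/∂xᵢ∂xⱼ`, with weak derivatives. -/
def ellipticOp {n : ℕ} (Ω : Set (Eu n)) (A : Eu n → Matrix (Fin n) (Fin n) ℝ)
    (u : Eu n → ℝ) (x : Eu n) : ℝ :=
  ∑ i, ∑ j, A x i j * weakPartial Ω i (weakPartial Ω j u) x

/-- `div A`, the vector field whose `i`-th entry is the divergence of the `i`-th row of `A`. -/
def matDiv {n : ℕ} (A : Eu n → Matrix (Fin n) (Fin n) ℝ) (x : Eu n) : Eu n :=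
  WithLp.toLp 2 fun i => ∑ j, fderiv ℝ (fun y => A y i j) x (EuclideanSpace.single j 1)

/-- `d_A = ‖div A‖²_{L^∞(Ω)} / c`. -/
def dConst {n : ℕ} (Ω : Set (Eu n)) (A : Eu n → Matrix (Fin n) (Fin n) ℝ) (c : ℝ) : ℝ≥0∞ :=
  eLpNorm (matDiv A) ∞ (volume.restrict Ω) ^ 2 / ENNReal.ofReal c

/-! ### The weight and its antiderivatives -/

/-- The interval `(0, B) ⊆ ℝ`, where `B ≤ ∞`. -/
def openInt (B : EReal) : Set ℝ := {s : ℝ | 0 < s ∧ (s : EReal) < B}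

/-- `J` is one of `(0,B)`, `[0,B)`, `(0,B]`, `[0,B]`, the last two only when `B < ∞`. -/
def IsEndpointExtension (B : EReal) (J : Set ℝ) : Prop :=
  J = openInt B ∨ J = {s : ℝ | 0 ≤ s ∧ (s : EReal) < B} ∨
  (B < ⊤ ∧ (J = {s : ℝ | 0 < s ∧ (s : EReal) ≤ B} ∨ J = {s : ℝ | 0 ≤ s ∧ (s : EReal) ≤ B}))

/-- `h` is a continuous positive weight on `(0,B)`, `H' = h` and `Ht' = H` on `(0,B)`. -/
structure IsWeight (B : EReal) (h H Ht : ℝ → ℝ) : Prop where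
  B_pos : 0 < B
  continuousOn : ContinuousOn h (openInt B)
  pos : ∀ s ∈ openInt B, 0 < h s
  deriv_H : ∀ s ∈ openInt B, HasDerivAt H (h s) s
  deriv_Ht : ∀ s ∈ openInt B, HasDerivAt Ht (H s) s

/-- `I` is the largest interval among `(0,B)`, `[0,B)`, `(0,B]`, `[0,B]` to which `Ht`
extends continuously from `(0,B)`, and the values of `Ht` on `I` are those of this extension. -/
structure IsMaximalInterval (B : EReal) (Ht : ℝ → ℝ) (I : Set ℝ) : Prop where
  isEndpointExtension : IsEndpointExtension B I
  continuousOn : ContinuousOn Ht I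
  maximal : ∀ J, IsEndpointExtension B J →
    (∃ F : ℝ → ℝ, ContinuousOn F J ∧ EqOn F Ht (openInt B)) → J ⊆ I

/-- `𝒢_H = H² / h`. -/
def GTransform (h H : ℝ → ℝ) (s : ℝ) : ℝ := H s ^ 2 / h s

/-- `Ω ∩ {u ∈ (0,B)}`. -/
def interiorSet {n : ℕ} (Ω : Set (Eu n)) (B : EReal) (u : Eu n → ℝ) : Set (Eu n) :=
  Ω ∩ {x | u x ∈ openInt B}

/-- The integrand `n(x)ᵀ A(x) ∇w(x)` on `∂Ω`. -/
def conormal {n : ℕ} (Ω : Set (Eu n)) (A : Eu n → Matrix (Fin n) (Fin n) ℝ)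
    (w : Eu n → ℝ) (x : Eu n) : ℝ :=
  matForm (A x) (outerNormal Ω x) (gradTrace Ω w x)

/-- `Θ = ∫_{∂Ω} n(x)ᵀ A(x) ∇w dσ(x)`. -/
def boundaryTerm {n : ℕ} (Ω : Set (Eu n)) (A : Eu n → Matrix (Fin n) (Fin n) ℝ)
    (w : Eu n → ℝ) : ℝ :=
  ∫ x in frontier Ω, conormal Ω A w x ∂(surfaceMeasure n)

end

/-! Put `v = Ht ∘ u`. The theorem is the divergence theorem for the field `A ∇v`, read back in terms
of `u`. On `{u ∈ (0,B)}` the chain rule gives `∂ⱼv = H(u) ∂ⱼu` and `∂ᵢ∂ⱼv = h(u) ∂ᵢu ∂ⱼu + H(u)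
∂ᵢ∂ⱼu`. Off this set `u` is an endpoint of `(0,B)`, so `v` takes at most two values there; a weak
derivative vanishes a.e. on each level set, hence `∇v = 0` there, and by the same principle applied
to `∂ⱼv` also `∂ᵢ∂ⱼv = 0`. Thus `Pv` is the sum of `‖∇u‖²_A h(u)` and `Pu H(u)`, both cut off to `{u
∈ (0,B)}`, while `div A · ∇v` is the cut-off of `(div A · ∇u) H(u)`. Inserted into `Θ = ∫ Pv + ∫ div
A · ∇v` (`IsUniformlyElliptic.boundaryTerm_eq`) this is the identity, and the energy density is
integrable as a difference of integrable functions. The first inequality is then immediate. The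
second follows from Young's inequality `|div A · ∇u H| ≤ ½ ‖∇u‖²_A h + ½ d_A H²/h`, whose energy
half is absorbed on the left.

The chain rule is `HasWeakDir.ae_eq_fderiv_of_mem`. Since `u` and `v` are both known to be weakly
differentiable, it suffices to localise in the values of `u`: for a cutoff `β`, the functions `β(u)
v` and `β(u) Ht(u)` coincide, both are compositions with compactly supported `C¹` functions, and
weak derivatives are unique.

The divergence theorem rests on Gauss–Green for `W^{1,1}` functions with traces given by averages
(`gaussGreen`). In a boundary chart `(y, s) ↦ T⁻¹(y, f y - s)`, a function cut off near the boundary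
is, on a.e. vertical line, the integral over `(s, ∞)` of its derivative along the chart's vertical
direction; its value at `s = 0` is the trace. Lebesgue differentiation identifies this value with
the limit of averages over `Ω ∩ B(x, r)`, and testing against functions of the depth `s` that step
from `0` to `1` near the graph produces the boundary integral (`exists_chart_trace`). The area
formula for Lipschitz graphs turns `dy` into surface measure: its factor `√(1 + |∇f|²)` is the
normalising factor of the normal. A partition of unity glues the charts. -/

noncomputable section

/-! ### The area formula for Lipschitz graphs -/

/-- The graph parametrisation `y ↦ (y, f y)`. -/
def graphMap {d : ℕ} (f : Eu d → ℝ) (y : Eu d) : WithLp 2 (Eu d × ℝ) := WithLp.toLp 2 (y, f y)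

/-- The graph parametrisation of a linear functional, as a linear map. -/
def graphLin {d : ℕ} (l : Eu d →L[ℝ] ℝ) : Eu d →L[ℝ] WithLp 2 (Eu d × ℝ) :=
  ((WithLp.prodContinuousLinearEquiv 2 ℝ (Eu d) ℝ).symm : (Eu d × ℝ) →L[ℝ] _) ∘L
    ((ContinuousLinearMap.id ℝ (Eu d)).prod l)

@[simp] lemma graphLin_apply {d : ℕ} (l : Eu d →L[ℝ] ℝ) (y : Eu d) :
    graphLin l y = WithLp.toLp 2 (y, l y) := rfl

lemma norm_toLp_prod_sq {d : ℕ} (y : Eu d) (s : ℝ) :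
    ‖(WithLp.toLp 2 (y, s) : WithLp 2 (Eu d × ℝ))‖ ^ 2 = ‖y‖ ^ 2 + s ^ 2 := by
  rw [WithLp.prod_norm_sq_eq_of_L2]
  simp

lemma norm_fst_le_withLp {d : ℕ} (p : WithLp 2 (Eu d × ℝ)) : ‖p.fst‖ ≤ ‖p‖ := by
  have := WithLp.prod_norm_sq_eq_of_L2 p
  exact abs_le_of_sq_le_sq' (by nlinarith [sq_nonneg ‖p.snd‖]) (norm_nonneg _) |>.2

lemma abs_snd_le_withLp {d : ℕ} (p : WithLp 2 (Eu d × ℝ)) : |p.snd| ≤ ‖p‖ := by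
  have := WithLp.prod_norm_sq_eq_of_L2 p
  rw [← Real.norm_eq_abs]
  exact abs_le_of_sq_le_sq' (by nlinarith [sq_nonneg ‖p.fst‖]) (norm_nonneg _) |>.2

lemma norm_withLp_le_add {d : ℕ} (p : WithLp 2 (Eu d × ℝ)) : ‖p‖ ≤ ‖p.fst‖ + |p.snd| := by
  have := WithLp.prod_norm_sq_eq_of_L2 p
  rw [Real.norm_eq_abs] at this
  refine abs_le_of_sq_le_sq' ?_ (by positivity) |>.2
  nlinarith [mul_nonneg (norm_nonneg p.fst) (abs_nonneg p.snd)]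

/-- The Gram matrix of the images of an orthonormal basis is the identity plus the rank-one matrix
`(l bᵢ)(l bⱼ)`, so the matrix determinant lemma gives `1 + ‖l‖²`. -/
lemma normDet_graphLin {d : ℕ} (l : Eu d →L[ℝ] ℝ) :
    (graphLin l : Eu d →ₗ[ℝ] WithLp 2 (Eu d × ℝ)).normDet = √(1 + ‖l‖ ^ 2) := by
  set b := EuclideanSpace.basisFun (Fin d) ℝ
  have h := LinearMap.normDet_sq_eq_det_gram (graphLin l : Eu d →ₗ[ℝ] WithLp 2 (Eu d × ℝ)) b
  have hg : Matrix.gram ℝ (fun i => (graphLin l : Eu d →ₗ[ℝ] WithLp 2 (Eu d × ℝ)) (b i))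
      = 1 + Matrix.replicateCol Unit (fun i => l (b i)) *
          Matrix.replicateRow Unit (fun i => l (b i)) := by
    ext i j
    simp only [Matrix.gram_apply, ContinuousLinearMap.coe_coe, graphLin_apply,
      WithLp.prod_inner_apply, Matrix.add_apply, Matrix.mul_apply, Finset.univ_unique,
      Finset.sum_singleton, Matrix.replicateCol_apply, Matrix.replicateRow_apply]
    rw [orthonormal_iff_ite.1 b.orthonormal i j, Matrix.one_apply]
    simp [mul_comm]
  have hn : ‖l‖ ^ 2 = ∑ i, l (b i) * l (b i) := by
    set v := (InnerProductSpace.toDual ℝ (Eu d)).symm l with hv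
    have h1 : ‖l‖ = ‖v‖ := by rw [hv]; exact ((InnerProductSpace.toDual ℝ (Eu d)).symm.norm_map l).symm
    have h2 : ∀ i, l (b i) = v i := by
      intro i
      rw [← InnerProductSpace.toDual_symm_apply (𝕜 := ℝ) (x := b i) (y := l), ← hv]
      simp [b, EuclideanSpace.inner_single_right]
    rw [h1, EuclideanSpace.norm_sq_eq]
    simp [h2, sq]
  rw [hg] at h
  rw [Matrix.det_one_add_replicateCol_mul_replicateRow] at h
  rw [← Real.sqrt_sq (LinearMap.normDet_nonneg _)]
  congr 1
  have h' : (graphLin l : Eu d →ₗ[ℝ] WithLp 2 (Eu d × ℝ)).normDet ^ 2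
    = 1 + (fun i => l (b i)) ⬝ᵥ (fun i => l (b i)) := by simpa using h
  rw [h', hn, dotProduct]

lemma euclideanHausdorffMeasure_image_le {X Y : Type*} [EMetricSpace X] [MeasurableSpace X]
    [BorelSpace X] [EMetricSpace Y] [MeasurableSpace Y] [BorelSpace Y] {K : ℝ≥0} {f : X → Y}
    {s : Set X} (h : LipschitzOnWith K f s) (d : ℕ) :
    μHE[d] (f '' s) ≤ (K : ℝ≥0∞) ^ d * μHE[d] s := by
  have := h.hausdorffMeasure_image_le (d := d) (by positivity)
  rw [Measure.euclideanHausdorffMeasure_def, Measure.euclideanHausdorffMeasure_def,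
    Measure.smul_apply, Measure.smul_apply, Measure.nnreal_smul_coe_apply,
    Measure.nnreal_smul_coe_apply, mul_left_comm]
  gcongr
  simpa using this

lemma euclideanHausdorffMeasure_image_graphLin {d : ℕ} (l : Eu d →L[ℝ] ℝ) (s : Set (Eu d)) :
    μHE[d] (graphLin l '' s) = ENNReal.ofReal √(1 + ‖l‖ ^ 2) * volume s := by
  have := LinearMap.euclideanHausdorffMeasure_image_eq_normDet_mul_volume
    (graphLin l : Eu d →ₗ[ℝ] WithLp 2 (Eu d × ℝ)) s
  rw [normDet_graphLin] at this
  simpa using this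

lemma norm_le_norm_graphLin {d : ℕ} (l : Eu d →L[ℝ] ℝ) (y : Eu d) : ‖y‖ ≤ ‖graphLin l y‖ :=
  norm_fst_le_withLp (graphLin l y)

/-- The graph is compared with its linear model, whose measure is known exactly. Since `graphLin l`
does not shrink distances, an error `ε ‖x - y‖` is also at most `ε ‖graphLin l (x - y)‖`, and the
passage from the model to the graph is `(1 + ε)`-Lipschitz. -/
lemma euclideanHausdorffMeasure_image_graphMap_le {d : ℕ} {f : Eu d → ℝ} {l : Eu d →L[ℝ] ℝ}
    {s : Set (Eu d)} {ε : ℝ≥0} (h : ApproximatesLinearOn (graphMap f) (graphLin l) s ε) :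
    μHE[d] (graphMap f '' s) ≤
      ((1 + ε : ℝ≥0) : ℝ≥0∞) ^ d * (ENNReal.ofReal √(1 + ‖l‖ ^ 2) * volume s) := by
  rw [← euclideanHausdorffMeasure_image_graphLin]
  have hL : LipschitzOnWith (1 + ε) (fun p : WithLp 2 (Eu d × ℝ) => graphMap f p.fst)
      (graphLin l '' s) := by
    apply LipschitzOnWith.of_dist_le_mul
    rintro _ ⟨x, hx, rfl⟩ _ ⟨y, hy, rfl⟩
    have h1 := h x hx y hy
    have h2 := norm_le_norm_graphLin l (x - y)
    rw [dist_eq_norm, dist_eq_norm, ← map_sub]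
    change ‖graphMap f x - graphMap f y‖ ≤ _
    have h3 := norm_sub_norm_le (graphMap f x - graphMap f y) (graphLin l (x - y))
    push_cast
    nlinarith [ε.2, mul_le_mul_of_nonneg_left h2 ε.2]
  have := euclideanHausdorffMeasure_image_le hL d
  rw [image_image] at this
  exact this

/-- The same comparison backwards: the map from the graph to its linear model is `(1 -
ε)⁻¹`-Lipschitz. -/
lemma le_euclideanHausdorffMeasure_image_graphMap {d : ℕ} {f : Eu d → ℝ} {l : Eu d →L[ℝ] ℝ}
    {s : Set (Eu d)} {ε : ℝ≥0} (hε : ε < 1)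
    (h : ApproximatesLinearOn (graphMap f) (graphLin l) s ε) :
    ENNReal.ofReal √(1 + ‖l‖ ^ 2) * volume s ≤
      (((1 - ε)⁻¹ : ℝ≥0) : ℝ≥0∞) ^ d * μHE[d] (graphMap f '' s) := by
  rw [← euclideanHausdorffMeasure_image_graphLin]
  have hL : LipschitzOnWith (1 - ε)⁻¹ (fun p : WithLp 2 (Eu d × ℝ) => graphLin l p.fst)
      (graphMap f '' s) := by
    apply LipschitzOnWith.of_dist_le_mul
    rintro _ ⟨x, hx, rfl⟩ _ ⟨y, hy, rfl⟩
    have h1 := h x hx y hy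
    have h2 := norm_le_norm_graphLin l (x - y)
    rw [dist_eq_norm, dist_eq_norm]
    change ‖graphLin l x - graphLin l y‖ ≤ _
    rw [← map_sub]
    have h3 := norm_sub_norm_le (graphLin l (x - y)) (graphMap f x - graphMap f y)
    rw [norm_sub_rev (graphLin l (x - y))] at h3
    have hε' : (ε : ℝ) < 1 := by exact_mod_cast hε
    rw [NNReal.coe_inv, NNReal.coe_sub hε.le, NNReal.coe_one, inv_mul_eq_div,
      le_div_iff₀ (by linarith)]
    nlinarith [ε.2, mul_le_mul_of_nonneg_left h2 ε.2]
  have := euclideanHausdorffMeasure_image_le hL d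
  rw [image_image] at this
  exact this

/-- Turns additive closeness of two derivatives into multiplicative closeness of the surface
elements. -/
lemma sqrt_one_add_sq_le {a b ε : ℝ} (ha : 0 ≤ a) (hb : 0 ≤ b) (hε : 0 ≤ ε) (h : a ≤ b + ε) :
    √(1 + a ^ 2) ≤ (1 + ε) * √(1 + b ^ 2) := by
  rw [Real.sqrt_le_left (by positivity), mul_pow, Real.sq_sqrt (by positivity)]
  nlinarith [sq_nonneg (b - 1), mul_nonneg hε hb, mul_nonneg hε (sq_nonneg b),
    mul_nonneg hε (sq_nonneg (b-1)), sq_nonneg (ε * b), pow_le_pow_left₀ ha h 2]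

/-- Disjointifying the cover writes both measures as countable sums, so the area formula need only
be checked on pieces where the graph is almost linear. -/
lemma measure_le_mul_of_cover {α ι : Type*} [MeasurableSpace α] [Countable ι] {μ ν : Measure α}
    {c : ℝ≥0∞} {Q : ι → Set α} (hQ : ∀ i, MeasurableSet (Q i)) (hcov : ⋃ i, Q i = univ)
    (h : ∀ i, ∀ E, MeasurableSet E → E ⊆ Q i → μ E ≤ c * ν E) {s : Set α}
    (hs : MeasurableSet s) : μ s ≤ c * ν s := by
  rcases isEmpty_or_nonempty ι with hι | hι
  · have : s = ∅ := by
      apply eq_empty_of_subset_empty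
      rw [iUnion_of_empty] at hcov
      rw [hcov]; exact subset_univ _
    simp [this]
  obtain ⟨e, he⟩ := exists_surjective_nat ι
  set R : ℕ → Set α := disjointed (fun k => Q (e k))
  have hR : ∀ k, MeasurableSet (R k) := MeasurableSet.disjointed fun k => hQ _
  have hRu : ⋃ k, R k = univ := by
    rw [iUnion_disjointed, he.iUnion_comp]; exact hcov
  have hd : Pairwise (Function.onFun Disjoint R) := disjoint_disjointed _
  have key : ∀ m : Measure α, m s = ∑' k, m (s ∩ R k) := by
    intro m
    rw [← measure_iUnion (fun i j hij => (hd hij).mono inter_subset_right inter_subset_right)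
      (fun k => hs.inter (hR k)), ← inter_iUnion, hRu, inter_univ]
  rw [key μ, key ν, ← ENNReal.tsum_mul_left]
  exact ENNReal.tsum_le_tsum fun k => h (e k) _ (hs.inter (hR k))
    (inter_subset_right.trans (disjointed_subset _ _))

lemma continuous_graphMap {d : ℕ} {f : Eu d → ℝ} (hf : Continuous f) : Continuous (graphMap f) :=
  (WithLp.prod_continuous_toLp 2 _ _).comp (continuous_id.prodMk hf)

lemma measurableEmbedding_graphMap {d : ℕ} {f : Eu d → ℝ} (hf : Continuous f) :
    MeasurableEmbedding (graphMap f) :=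
  (continuous_graphMap hf).measurableEmbedding fun _ _ h => congrArg (fun p => p.fst) h

lemma lipschitzWith_graphMap {d : ℕ} {f : Eu d → ℝ} {K : ℝ≥0} (hf : LipschitzWith K f) :
    LipschitzWith (1 + K) (graphMap f) := by
  apply LipschitzWith.of_dist_le_mul
  intro x y
  have h1 := norm_withLp_le_add (graphMap f x - graphMap f y)
  have h2 := hf.dist_le_mul x y
  rw [dist_eq_norm, dist_eq_norm] at *
  refine h1.trans ?_
  change ‖x - y‖ + |f x - f y| ≤ _
  rw [Real.norm_eq_abs] at h2
  push_cast
  linarith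

/-- The surface element of the graph of `f`. -/
def graphJac {d : ℕ} (f : Eu d → ℝ) (y : Eu d) : ℝ := √(1 + ‖fderiv ℝ f y‖ ^ 2)

lemma measurable_graphJac {d : ℕ} (f : Eu d → ℝ) : Measurable (graphJac f) := by
  unfold graphJac
  have := measurable_fderiv ℝ f
  fun_prop

lemma one_le_graphJac {d : ℕ} (f : Eu d → ℝ) (y : Eu d) : 1 ≤ graphJac f y := by
  unfold graphJac
  rw [Real.one_le_sqrt]
  nlinarith [sq_nonneg ‖fderiv ℝ f y‖]

/-- Up to a set that is negligible for both measures (Rademacher, and Lipschitz images of null sets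
are null), the domain splits into countably many pieces on which `graphMap f` is `ε`-close to one
linear map and `graphJac f` varies by a factor of at most `1 + 2 ε`. On each piece the two measures
are compared through that linear map. -/
lemma graphJac_comparison {d : ℕ} {f : Eu d → ℝ} {K : ℝ≥0} (hf : LipschitzWith K f) {ε : ℝ≥0}
    (hε0 : 0 < ε) (hε : ε < 1) {s : Set (Eu d)} (hs : MeasurableSet s) :
    (μHE[d]).comap (graphMap f) s ≤ (((1 + ε) ^ d * (1 + 2 * ε) : ℝ≥0) : ℝ≥0∞) *
      volume.withDensity (fun y => ENNReal.ofReal (graphJac f y)) s ∧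
    volume.withDensity (fun y => ENNReal.ofReal (graphJac f y)) s ≤
      (((1 - ε)⁻¹ ^ d * (1 + 2 * ε) : ℝ≥0) : ℝ≥0∞) * (μHE[d]).comap (graphMap f) s := by
  have hemb := measurableEmbedding_graphMap hf.continuous
  set D : Set (Eu d) := {y | DifferentiableAt ℝ f y} with hD
  have hDm : MeasurableSet D := measurableSet_of_differentiableAt ℝ f
  have hD0 : volume Dᶜ = 0 := hf.ae_differentiableAt
  have hDc0 : (μHE[d]).comap (graphMap f) Dᶜ = 0 := by
    rw [hemb.comap_apply]
    have := euclideanHausdorffMeasure_image_le (lipschitzWith_graphMap hf).lipschitzOnWith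
      (s := Dᶜ) d
    rw [EuclideanSpace.euclideanHausdorffMeasure_eq_volume, hD0, mul_zero] at this
    exact le_antisymm this bot_le
  have hDc0' : volume.withDensity (fun y => ENNReal.ofReal (graphJac f y)) Dᶜ = 0 :=
    withDensity_absolutelyContinuous _ _ hD0
  obtain ⟨q, hq⟩ := TopologicalSpace.exists_dense_seq (Eu d →L[ℝ] ℝ)
  -- On `P k` any two derivatives differ by less than `2 ε`, which is where the factor `1 + 2 ε`
  -- comes from; density of `q` makes the `P k` cover `D`.
  set P : ℕ → Set (Eu d) := fun k => D ∩ {y | ‖fderiv ℝ f y - q k‖ < ε} with hP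
  have hPm : ∀ k, MeasurableSet (P k) := by
    intro k
    refine hDm.inter ?_
    have := measurable_fderiv ℝ f
    exact measurableSet_lt (by fun_prop) measurable_const
  have hder : ∀ k, ∀ x ∈ P k, HasFDerivWithinAt (graphMap f) (graphLin (fderiv ℝ f x)) (P k) x := by
    intro k x hx
    have h1 : HasFDerivAt f (fderiv ℝ f x) x := hx.1.hasFDerivAt
    have h2 := (hasFDerivAt_id x).prodMk h1
    exact (((WithLp.prodContinuousLinearEquiv 2 ℝ (Eu d) ℝ).symm.hasFDerivAt).comp x
      h2).hasFDerivWithinAt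
  choose t A ht1 htm htc happ hA using fun k =>
    exists_partition_approximatesLinearOn_of_hasFDerivWithinAt (graphMap f) (P k)
      (fun x => graphLin (fderiv ℝ f x)) (hder k) (fun _ => ε) (fun _ => hε0.ne')
  let Q : Option (ℕ × ℕ) → Set (Eu d) := fun o => o.elim Dᶜ fun p => P p.1 ∩ t p.1 p.2
  have hQm : ∀ i, MeasurableSet (Q i) := by
    rintro (_ | ⟨k, j⟩)
    · exact hDm.compl
    · exact (hPm k).inter (htm k j)
  have hQc : ⋃ i, Q i = univ := by
    refine eq_univ_of_forall fun y => ?_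
    by_cases hy : y ∈ D
    · obtain ⟨k, hk⟩ : ∃ k, y ∈ P k := by
        obtain ⟨k, hk⟩ := hq.exists_dist_lt (fderiv ℝ f y) (NNReal.coe_pos.2 hε0)
        exact ⟨k, hy, by rwa [dist_eq_norm] at hk⟩
      obtain ⟨j, hj⟩ := mem_iUnion.1 (htc k hk)
      exact mem_iUnion.2 ⟨some (k, j), hk, hj⟩
    · exact mem_iUnion.2 ⟨none, hy⟩
  have hclose : ∀ k, ∀ x ∈ P k, ∀ y ∈ P k,
      graphJac f x ≤ (1 + 2 * ε) * graphJac f y := by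
    intro k x hx y hy
    refine sqrt_one_add_sq_le (norm_nonneg _) (norm_nonneg _) (by positivity) ?_
    have h1 : ‖fderiv ℝ f x - q k‖ < ε := hx.2
    have h2 : ‖fderiv ℝ f y - q k‖ < ε := hy.2
    have h3 : fderiv ℝ f x = fderiv ℝ f y + ((fderiv ℝ f x - q k) - (fderiv ℝ f y - q k)) := by abel
    have h4 := norm_add_le (fderiv ℝ f y) ((fderiv ℝ f x - q k) - (fderiv ℝ f y - q k))
    rw [← h3] at h4
    have h5 := norm_sub_le (fderiv ℝ f x - q k) (fderiv ℝ f y - q k)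
    linarith
  constructor
  · refine measure_le_mul_of_cover hQm hQc ?_ hs
    rintro (_ | ⟨k, j⟩) E hE hEQ
    · rw [measure_mono_null hEQ hDc0]; exact bot_le
    · rcases E.eq_empty_or_nonempty with rfl | ⟨z, hz⟩
      · simp
      obtain ⟨y, hy, hAy⟩ := hA k ⟨z, (hEQ hz).1⟩ j
      have ha := (happ k j).mono_set hEQ
      rw [hAy] at ha
      rw [hemb.comap_apply, withDensity_apply _ hE]
      refine (euclideanHausdorffMeasure_image_graphMap_le ha).trans ?_
      rw [ENNReal.coe_mul, mul_assoc, ENNReal.coe_pow]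
      refine mul_le_mul_right ?_ _
      rw [← setLIntegral_const, ← lintegral_const_mul _ (by
        have := measurable_graphJac f; fun_prop)]
      refine setLIntegral_mono' hE fun x hx => ?_
      rw [← ENNReal.ofReal_coe_nnreal, ← ENNReal.ofReal_mul (by positivity)]
      refine ENNReal.ofReal_le_ofReal ?_
      simpa [graphJac] using hclose k y hy x (hEQ hx).1
  · refine measure_le_mul_of_cover hQm hQc ?_ hs
    rintro (_ | ⟨k, j⟩) E hE hEQ
    · rw [measure_mono_null hEQ hDc0']; exact bot_le
    · rcases E.eq_empty_or_nonempty with rfl | ⟨z, hz⟩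
      · simp
      obtain ⟨y, hy, hAy⟩ := hA k ⟨z, (hEQ hz).1⟩ j
      have ha := (happ k j).mono_set hEQ
      rw [hAy] at ha
      rw [hemb.comap_apply, withDensity_apply _ hE]
      rw [mul_comm ((1 - ε)⁻¹ ^ d), ENNReal.coe_mul, mul_assoc, ENNReal.coe_pow]
      refine le_trans ?_ (mul_le_mul_right
        (le_euclideanHausdorffMeasure_image_graphMap hε ha) _)
      rw [← setLIntegral_const, ← lintegral_const_mul _ (by fun_prop)]
      refine setLIntegral_mono' hE fun x hx => ?_
      rw [← ENNReal.ofReal_coe_nnreal, ← ENNReal.ofReal_mul (by positivity)]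
      refine ENNReal.ofReal_le_ofReal ?_
      simpa [graphJac] using hclose k x (hEQ hx).1 y hy

/-- The area formula for the graph of a Lipschitz function. -/
theorem comap_graphMap_euclideanHausdorffMeasure {d : ℕ} {f : Eu d → ℝ} {K : ℝ≥0}
    (hf : LipschitzWith K f) :
    (μHE[d]).comap (graphMap f) =
      volume.withDensity (fun y => ENNReal.ofReal (graphJac f y)) := by
  -- Both comparison constants are continuous in `ε` and equal `1` at `ε = 0`, so they disappear in
  -- the limit.
  have hlim : ∀ (F : ℝ≥0 → ℝ≥0) (x y : ℝ≥0∞), ContinuousAt F 0 → F 0 = 1 →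
      (∀ ε : ℝ≥0, 0 < ε → ε < 1 → y ≤ (F ε : ℝ≥0∞) * x) → y ≤ x := by
    intro F x y hF hF0 hle
    have h1 : Tendsto (fun ε : ℝ≥0 => (F ε : ℝ≥0∞) * x) (𝓝[>] 0) (𝓝 (1 * x)) := by
      refine ENNReal.Tendsto.mul_const ?_ (Or.inl one_ne_zero)
      have : Tendsto F (𝓝[>] 0) (𝓝 1) := by
        have := hF.tendsto; rw [hF0] at this
        exact this.mono_left nhdsWithin_le_nhds
      rw [← ENNReal.coe_one]
      exact ENNReal.tendsto_coe.2 this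
    rw [one_mul] at h1
    refine ge_of_tendsto h1 ?_
    filter_upwards [Ioo_mem_nhdsGT (zero_lt_one (α := ℝ≥0))] with ε hε
    exact hle ε hε.1 hε.2
  ext s hs
  apply le_antisymm
  · refine hlim (fun ε => (1 + ε) ^ d * (1 + 2 * ε)) _ _ (by fun_prop) (by simp) ?_
    exact fun ε h0 h1 => (graphJac_comparison hf h0 h1 hs).1
  · refine hlim (fun ε => (1 - ε)⁻¹ ^ d * (1 + 2 * ε)) _ _ ?_ (by simp) ?_
    · have h1 : ContinuousAt (fun ε : ℝ≥0 => 1 - ε) 0 := by fun_prop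
      have h2 : ContinuousAt (fun ε : ℝ≥0 => (1 - ε)⁻¹) 0 := h1.inv₀ (by simp)
      fun_prop
    · exact fun ε h0 h1 => (graphJac_comparison hf h0 h1 hs).2

end

noncomputable section

/-! ### Mollification -/

/-- The bump function around `0` used for mollification at scale `1 / (k + 1)`. -/
def mollBump (n k : ℕ) : ContDiffBump (0 : Eu n) where
  rIn := 1 / (2 * (k + 1))
  rOut := 1 / (k + 1)
  rIn_pos := by positivity
  rIn_lt_rOut := by
    rw [one_div_lt_one_div (by positivity) (by positivity)]
    have : (0 : ℝ) ≤ k := k.cast_nonneg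
    linarith

/-- The mollification of `f` at scale `1 / (k + 1)`. -/
def moll {n : ℕ} {V : Type*} [NormedAddCommGroup V] [NormedSpace ℝ V] (k : ℕ) (f : Eu n → V) :
    Eu n → V :=
  convolution ((mollBump n k).normed volume) f (ContinuousLinearMap.lsmul ℝ ℝ) volume

lemma tendsto_rOut_mollBump (n : ℕ) : Tendsto (fun k => (mollBump n k).rOut) atTop (𝓝 0) :=
  tendsto_one_div_add_atTop_nhds_zero_nat

lemma rOut_mollBump_le_one (n k : ℕ) : (mollBump n k).rOut ≤ 1 := by
  change (1 : ℝ) / (k + 1) ≤ 1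
  rw [div_le_one (by positivity)]
  simp

section moll

variable {n : ℕ} {V : Type*} [NormedAddCommGroup V] [NormedSpace ℝ V]

lemma moll_apply (k : ℕ) (f : Eu n → V) (x : Eu n) :
    moll k f x = ∫ t, (mollBump n k).normed volume t • f (x - t) := rfl

lemma moll_apply_swap (k : ℕ) (f : Eu n → V) (x : Eu n) :
    moll k f x = ∫ t, (mollBump n k).normed volume (x - t) • f t := by
  unfold moll
  rw [convolution_eq_swap]
  rfl

lemma contDiff_moll (k : ℕ) {f : Eu n → V} (hf : LocallyIntegrable f) :
    ContDiff ℝ ∞ (moll k f) :=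
  ((mollBump n k).hasCompactSupport_normed).contDiff_convolution_left _
    ((mollBump n k).contDiff_normed) hf

lemma fderiv_moll_apply [CompleteSpace V] (k : ℕ) {f : Eu n → V} (hf : LocallyIntegrable f)
    (x e : Eu n) :
    fderiv ℝ (moll k f) x e =
      ∫ t, fderiv ℝ ((mollBump n k).normed volume) (x - t) e • f t := by
  have h := ((mollBump n k).hasCompactSupport_normed (μ := volume)).hasFDerivAt_convolution_left
    (ContinuousLinearMap.lsmul ℝ ℝ) (((mollBump n k).contDiff_normed)) hf x
  unfold moll
  rw [h.fderiv, convolution_eq_swap, ContinuousLinearMap.integral_apply]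
  · rfl
  · have hc : HasCompactSupport (fderiv ℝ ((mollBump n k).normed (volume : Measure (Eu n)))) :=
      ((mollBump n k).hasCompactSupport_normed).fderiv ℝ
    have h1 : ConvolutionExists (fderiv ℝ ((mollBump n k).normed volume)) f
        ((ContinuousLinearMap.lsmul ℝ ℝ).precompL (Eu n)) volume :=
      hc.convolutionExists_left _
        (((mollBump n k).contDiff_normed (n := 1)).continuous_fderiv one_ne_zero) hf
    exact (h1 x).integrable_swap

lemma integrable_moll (k : ℕ) {f : Eu n → V} (hf : Integrable f) : Integrable (moll k f) :=
  (((mollBump n k).integrable_normed)).integrable_convolution _ hf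

lemma norm_moll_le (k : ℕ) (f : Eu n → V) (x : Eu n) :
    ‖moll k f x‖ ≤ moll k (fun y => ‖f y‖) x := by
  rw [moll_apply, moll_apply]
  refine (norm_integral_le_integral_norm _).trans (le_of_eq ?_)
  congr 1
  ext t
  rw [norm_smul, Real.norm_of_nonneg ((mollBump n k).nonneg_normed t), smul_eq_mul]

lemma integral_norm_moll_le (k : ℕ) {f : Eu n → V} (hf : Integrable f) :
    ∫ x, ‖moll k f x‖ ≤ ∫ x, ‖f x‖ := by
  refine (integral_mono (integrable_moll k hf).norm (integrable_moll k hf.norm)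
    (norm_moll_le k f)).trans (le_of_eq ?_)
  unfold moll
  rw [integral_convolution _ ((mollBump n k).integrable_normed) hf.norm,
    (mollBump n k).integral_normed]
  simp

lemma moll_sub (k : ℕ) {f g : Eu n → V} (hf : LocallyIntegrable f) (hg : LocallyIntegrable g)
    (x : Eu n) : moll k (fun y => f y - g y) x = moll k f x - moll k g x := by
  have hc := (mollBump n k).hasCompactSupport_normed (μ := (volume : Measure (Eu n)))
  have hcont := (mollBump n k).continuous_normed (μ := (volume : Measure (Eu n)))
  have h1 := (hc.convolutionExists_left (ContinuousLinearMap.lsmul ℝ ℝ) hcont hf x)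
  have h2 := (hc.convolutionExists_left (ContinuousLinearMap.lsmul ℝ ℝ) hcont hg x)
  have h := integral_sub h1 h2
  simp only [ContinuousLinearMap.lsmul_apply] at h
  rw [moll_apply, moll_apply, moll_apply, ← h]
  simp [smul_sub]

lemma ae_tendsto_moll [CompleteSpace V] {f : Eu n → V} (hf : LocallyIntegrable f) :
    ∀ᵐ x, Tendsto (fun k => moll k f x) atTop (𝓝 (f x)) := by
  refine ContDiffBump.ae_convolution_tendsto_right_of_locallyIntegrable (K := 2)
    (tendsto_rOut_mollBump n) (Eventually.of_forall fun k => ?_) hf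
  -- The inner and outer radii keep the fixed ratio `2`, so Lebesgue differentiation applies to the
  -- shrinking bumps.
  change (1 : ℝ) / (k + 1) ≤ 2 * (1 / (2 * (k + 1)))
  apply le_of_eq
  field_simp

lemma norm_moll_le_of_bound [CompleteSpace V] (k : ℕ) {f : Eu n → V} {C : ℝ} (hC : ∀ x, ‖f x‖ ≤ C)
    (x : Eu n) : ‖moll k f x‖ ≤ C := by
  rw [moll_apply]
  refine (norm_integral_le_of_norm_le (g := fun t => C * (mollBump n k).normed volume t)
    (((mollBump n k).integrable_normed).const_mul C) (ae_of_all _ fun t => ?_)).trans ?_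
  · rw [norm_smul, Real.norm_of_nonneg ((mollBump n k).nonneg_normed t), mul_comm]
    exact mul_le_mul_of_nonneg_right (hC _) ((mollBump n k).nonneg_normed t)
  · rw [integral_const_mul, (mollBump n k).integral_normed, mul_one]

lemma moll_eq_zero (k : ℕ) {f : Eu n → V} {x : Eu n}
    (h : ∀ y ∈ Metric.ball x (mollBump n k).rOut, f y = 0) : moll k f x = 0 := by
  rw [moll_apply_swap]
  refine integral_eq_zero_of_ae (ae_of_all _ fun t => ?_)
  by_cases ht : t ∈ Metric.ball x (mollBump n k).rOut
  · simp [h t ht]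
  · have : (mollBump n k).normed volume (x - t) = 0 := by
      rw [← Function.notMem_support, (mollBump n k).support_normed_eq]
      simpa [dist_eq_norm, norm_sub_rev] using ht
    simp [this]

lemma tendsto_integral_norm_moll_sub_of_continuous [CompleteSpace V] {g : Eu n → V}
    (hg : Continuous g) (hc : HasCompactSupport g) :
    Tendsto (fun k => ∫ x, ‖moll k g x - g x‖) atTop (𝓝 0) := by
  obtain ⟨C, hC⟩ := hc.exists_bound_of_continuous hg
  have hC0 : 0 ≤ C := (norm_nonneg _).trans (hC 0)
  -- All mollification radii are at most `1`, so one compact set carries every mollification and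
  -- supplies the dominating function.
  set S := Metric.cthickening 1 (tsupport g)
  have hS : IsCompact S := hc.isCompact.cthickening
  have key : Tendsto (fun k => ∫ x, ‖moll k g x - g x‖) atTop (𝓝 (∫ _ : Eu n, (0 : ℝ))) := by
    refine tendsto_integral_of_dominated_convergence (S.indicator fun _ => C + C) ?_ ?_ ?_ ?_
    · intro k
      exact ((contDiff_moll k hg.locallyIntegrable).continuous.sub hg).norm.aestronglyMeasurable
    · rw [integrable_indicator_iff hS.measurableSet]
      exact integrableOn_const hS.measure_lt_top.ne
    · intro k
      refine ae_of_all _ fun x => ?_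
      by_cases hx : x ∈ S
      · rw [indicator_of_mem hx, norm_norm]
        exact (norm_sub_le _ _).trans (add_le_add (norm_moll_le_of_bound k hC x) (hC x))
      · rw [indicator_of_notMem hx]
        have hx' : ∀ y ∈ Metric.ball x (mollBump n k).rOut, g y = 0 := by
          intro y hy
          by_contra hne
          apply hx
          refine Metric.mem_cthickening_of_dist_le x y 1 _ (subset_tsupport _ hne) ?_
          rw [dist_comm]
          exact (Metric.mem_ball.1 hy).le.trans (rOut_mollBump_le_one n k)
        rw [moll_eq_zero k hx', hx' x (Metric.mem_ball_self (mollBump n k).rOut_pos)]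
        simp
    · refine ae_of_all _ fun x => ?_
      have := ContDiffBump.convolution_tendsto_right_of_continuous (μ := volume)
        (tendsto_rOut_mollBump n) hg x
      have h2 := (this.sub_const (g x)).norm
      simpa [moll] using h2
  simpa using key

/-- Mollifications of an integrable function converge in `L¹`. -/
lemma tendsto_integral_norm_moll_sub [CompleteSpace V] {f : Eu n → V} (hf : Integrable f) :
    Tendsto (fun k => ∫ x, ‖moll k f x - f x‖) atTop (𝓝 0) := by
  rw [Metric.tendsto_atTop]
  intro ε hε
  obtain ⟨g, hgc, hfg, hg, hgi⟩ :=
    hf.exists_hasCompactSupport_integral_sub_le (ε := ε / 3) (by positivity)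
  obtain ⟨N, hN⟩ := (Metric.tendsto_atTop.1
    (tendsto_integral_norm_moll_sub_of_continuous hg hgc)) (ε / 3) (by positivity)
  refine ⟨N, fun k hk => ?_⟩
  have h1 := hN k hk
  rw [Real.dist_0_eq_abs, abs_of_nonneg (integral_nonneg fun x => norm_nonneg _)] at h1 ⊢
  have hsub := hf.sub hgi
  have h2 : ∫ x, ‖moll k (fun y => f y - g y) x‖ ≤ ε / 3 := (integral_norm_moll_le k hsub).trans hfg
  -- Three-term splitting through a continuous approximation `g`; mollification does not increase
  -- the `L¹` norm, so its action on `f - g` costs no more than `f - g` itself.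
  have h3 : ∫ x, ‖moll k f x - f x‖ ≤ ∫ x, (‖moll k (fun y => f y - g y) x‖ +
      ‖moll k g x - g x‖ + ‖f x - g x‖) := by
    refine integral_mono ((integrable_moll k hf).sub hf).norm
      (((integrable_moll k hsub).norm.add ((integrable_moll k hgi).sub hgi).norm).add hsub.norm) ?_
    intro x
    have : moll k f x - f x = moll k (fun y => f y - g y) x + (moll k g x - g x) - (f x - g x) := by
      rw [moll_sub k hf.locallyIntegrable hgi.locallyIntegrable]; abel
    simp only [this]
    exact (norm_sub_le _ _).trans (add_le_add_left (norm_add_le _ _) _)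
  rw [integral_add, integral_add] at h3
  · linarith
  · exact (integrable_moll k hsub).norm
  · exact ((integrable_moll k hgi).sub hgi).norm
  · exact (integrable_moll k hsub).norm.add ((integrable_moll k hgi).sub hgi).norm
  · exact hsub.norm

end moll

end

noncomputable section

/-! ### Weak directional derivatives of vector-valued functions -/

/-- `G` is the weak derivative of `w` in the direction `e` on `Ω`. -/
structure HasWeakDir {n : ℕ} {V : Type*} [NormedAddCommGroup V] [NormedSpace ℝ V]
    (Ω : Set (Eu n)) (e : Eu n) (w G : Eu n → V) : Prop where
  locallyIntegrable : LocallyIntegrableOn w Ω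
  locallyIntegrable_deriv : LocallyIntegrableOn G Ω
  integral_eq : ∀ φ : Eu n → ℝ, ContDiff ℝ ∞ φ → HasCompactSupport φ → tsupport φ ⊆ Ω →
    ∫ x in Ω, fderiv ℝ φ x e • w x = -∫ x in Ω, φ x • G x

lemma HasWeakPartial.hasWeakDir {n : ℕ} {Ω : Set (Eu n)} {i : Fin n} {w g : Eu n → ℝ}
    (h : HasWeakPartial Ω i w g) : HasWeakDir Ω (EuclideanSpace.single i 1) w g := by
  refine ⟨h.1, h.2, fun φ h1 h2 h3 => ?_⟩
  have := h.3 φ h1 h2 h3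
  simpa only [smul_eq_mul, mul_comm] using this

lemma HasWeakDir.hasWeakPartial {n : ℕ} {Ω : Set (Eu n)} {i : Fin n} {w g : Eu n → ℝ}
    (h : HasWeakDir Ω (EuclideanSpace.single i 1) w g) : HasWeakPartial Ω i w g := by
  refine ⟨h.1, h.2, fun φ h1 h2 h3 => ?_⟩
  have := h.3 φ h1 h2 h3
  simpa only [smul_eq_mul, mul_comm] using this

section

variable {n : ℕ} {V : Type*} [NormedAddCommGroup V] [NormedSpace ℝ V] {Ω : Set (Eu n)} {e : Eu n}

lemma LocallyIntegrableOn.integrable_smul_of_tsupport_subset {w : Eu n → V}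
    (hw : LocallyIntegrableOn w Ω) {φ : Eu n → ℝ} (hφ : Continuous φ) (hc : HasCompactSupport φ)
    (hs : tsupport φ ⊆ Ω) : Integrable (fun x => φ x • w x) := by
  have h1 : IntegrableOn w (tsupport φ) := hw.integrableOn_compact_subset hs hc.isCompact
  have h2 : IntegrableOn (fun x => φ x • w x) (tsupport φ) :=
    h1.continuousOn_smul hφ.continuousOn hc.isCompact
  refine (integrableOn_iff_integrable_of_support_subset ?_).1 h2
  intro x hx
  by_contra hne
  exact hx (by simp [image_eq_zero_of_notMem_tsupport hne])

lemma setIntegral_smul_eq_integral_of_tsupport_subset {w : Eu n → V} {φ : Eu n → ℝ}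
    (hs : tsupport φ ⊆ Ω) : ∫ x in Ω, φ x • w x = ∫ x, φ x • w x := by
  refine setIntegral_eq_integral_of_forall_compl_eq_zero fun x hx => ?_
  simp [image_eq_zero_of_notMem_tsupport fun h => hx (hs h)]

lemma hasCompactSupport_fderiv_apply {φ : Eu n → ℝ} (h : HasCompactSupport φ) (e : Eu n) :
    HasCompactSupport (fun x => fderiv ℝ φ x e) :=
  h.mono' ((subset_tsupport _).trans (tsupport_fderiv_apply_subset ℝ e))

lemma HasWeakDir.integral_eq' {w G : Eu n → V} (h : HasWeakDir Ω e w G) {φ : Eu n → ℝ}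
    (h1 : ContDiff ℝ ∞ φ) (h2 : HasCompactSupport φ) (h3 : tsupport φ ⊆ Ω) :
    ∫ x, fderiv ℝ φ x e • w x = -∫ x, φ x • G x := by
  rw [← setIntegral_smul_eq_integral_of_tsupport_subset h3,
    ← setIntegral_smul_eq_integral_of_tsupport_subset
      ((tsupport_fderiv_apply_subset ℝ e).trans h3)]
  exact h.3 φ h1 h2 h3

lemma continuous_fderiv_apply_of_contDiff {φ : Eu n → ℝ} (h1 : ContDiff ℝ ∞ φ) (e : Eu n) :
    Continuous (fun x => fderiv ℝ φ x e) :=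
  (h1.continuous_fderiv (by simp)).clm_apply continuous_const

/-- Weak derivatives are unique almost everywhere. -/
lemma HasWeakDir.ae_eq [CompleteSpace V] (hΩ : IsOpen Ω) {w w' G G' : Eu n → V}
    (h : HasWeakDir Ω e w G)
    (h' : HasWeakDir Ω e w' G') (hw : ∀ᵐ x ∂(volume.restrict Ω), w x = w' x) :
    ∀ᵐ x ∂(volume.restrict Ω), G x = G' x := by
  have := hΩ.ae_eq_zero_of_integral_contDiff_smul_eq_zero (μ := volume) (f := fun x => G x - G' x)
    (h.2.sub h'.2) ?_
  · rw [ae_restrict_iff' hΩ.measurableSet]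
    filter_upwards [this] with x hx hxΩ
    exact sub_eq_zero.1 (hx hxΩ)
  · intro φ h1 h2 h3
    simp only [smul_sub]
    rw [integral_sub (LocallyIntegrableOn.integrable_smul_of_tsupport_subset h.2 h1.continuous h2 h3)
      (LocallyIntegrableOn.integrable_smul_of_tsupport_subset h'.2 h1.continuous h2 h3),
      ← neg_inj, neg_sub', ← h.integral_eq' h1 h2 h3, sub_neg_eq_add, ← neg_neg (∫ x, φ x • G' x),
      ← h'.integral_eq' h1 h2 h3, neg_zero, ← sub_eq_add_neg, sub_eq_zero,
      ← setIntegral_smul_eq_integral_of_tsupport_subset ((tsupport_fderiv_apply_subset ℝ e).trans h3),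
      ← setIntegral_smul_eq_integral_of_tsupport_subset ((tsupport_fderiv_apply_subset ℝ e).trans h3)]
    refine integral_congr_ae ?_
    filter_upwards [hw] with x hx
    rw [hx]

lemma HasWeakDir.congr_ae {w w' G G' : Eu n → V} (h : HasWeakDir Ω e w G)
    (hw : ∀ᵐ x ∂(volume.restrict Ω), w x = w' x) (hG : ∀ᵐ x ∂(volume.restrict Ω), G x = G' x) :
    HasWeakDir Ω e w' G' := by
  have aux : ∀ {f g : Eu n → V}, (∀ᵐ x ∂(volume.restrict Ω), f x = g x) →
      LocallyIntegrableOn f Ω → LocallyIntegrableOn g Ω := by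
    intro f g hfg hf x hx
    obtain ⟨s, hs, hsi⟩ := hf x hx
    refine ⟨s ∩ Ω, inter_mem hs self_mem_nhdsWithin, ?_⟩
    exact (hsi.mono_set inter_subset_left).congr_fun_ae
      (ae_restrict_of_ae_restrict_of_subset inter_subset_right hfg)
  refine ⟨aux hw h.1, aux hG h.2, fun φ h1 h2 h3 => ?_⟩
  have e1 : ∫ x in Ω, fderiv ℝ φ x e • w x = ∫ x in Ω, fderiv ℝ φ x e • w' x :=
    integral_congr_ae (hw.mono fun x hx => by simp only [hx])
  have e2 : ∫ x in Ω, φ x • G x = ∫ x in Ω, φ x • G' x :=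
    integral_congr_ae (hG.mono fun x hx => by simp only [hx])
  rw [← e1, ← e2]
  exact h.3 φ h1 h2 h3

/-- Vector values are needed for the pair `(u, ∂ⱼu)`: the product `H(u) ∂ⱼu` is one function of this
pair, so a single chain rule yields the second derivatives. -/
lemma HasWeakDir.prodMk [CompleteSpace V] {V' : Type*} [NormedAddCommGroup V'] [NormedSpace ℝ V']
    [CompleteSpace V'] {w G : Eu n → V} {w' G' : Eu n → V'}
    (h : HasWeakDir Ω e w G) (h' : HasWeakDir Ω e w' G') :
    HasWeakDir Ω e (fun x => (w x, w' x)) (fun x => (G x, G' x)) := by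
  have aux : ∀ {f : Eu n → V} {g : Eu n → V'}, LocallyIntegrableOn f Ω → LocallyIntegrableOn g Ω →
      LocallyIntegrableOn (fun x => (f x, g x)) Ω := by
    intro f g hf hg x hx
    obtain ⟨s, hs, hsi⟩ := hf x hx
    obtain ⟨t, ht, hti⟩ := hg x hx
    exact ⟨s ∩ t, inter_mem hs ht, (hsi.mono_set inter_subset_left).prodMk
      (hti.mono_set inter_subset_right)⟩
  refine ⟨aux h.1 h'.1, aux h.2 h'.2, fun φ h1 h2 h3 => ?_⟩
  have h3' := (tsupport_fderiv_apply_subset ℝ e).trans h3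
  rw [setIntegral_smul_eq_integral_of_tsupport_subset h3,
    setIntegral_smul_eq_integral_of_tsupport_subset h3']
  simp only [Prod.smul_mk]
  have hc := continuous_fderiv_apply_of_contDiff h1 e
  have hk := hasCompactSupport_fderiv_apply h2 e
  rw [integral_pair (LocallyIntegrableOn.integrable_smul_of_tsupport_subset h.1 hc hk h3')
      (LocallyIntegrableOn.integrable_smul_of_tsupport_subset h'.1 hc hk h3'),
    integral_pair (LocallyIntegrableOn.integrable_smul_of_tsupport_subset h.2 h1.continuous h2 h3)
      (LocallyIntegrableOn.integrable_smul_of_tsupport_subset h'.2 h1.continuous h2 h3),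
    h.integral_eq' h1 h2 h3, h'.integral_eq' h1 h2 h3]
  rfl

/-- On a set at positive distance from the complement of `S`, the derivative of a mollification is
the mollification of the weak derivative. -/
lemma HasWeakDir.fderiv_moll [CompleteSpace V] {w G : Eu n → V} (h : HasWeakDir Ω e w G)
    {S : Set (Eu n)} (hS : IsCompact S) (hSΩ : S ⊆ Ω) {k : ℕ} {x : Eu n}
    (hx : Metric.closedBall x (mollBump n k).rOut ⊆ S) :
    fderiv ℝ (moll k (S.indicator w)) x e = moll k (S.indicator G) x := by
  have hiw : Integrable (S.indicator w) :=
    (h.1.integrableOn_compact_subset hSΩ hS).integrable_indicator hS.measurableSet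
  rw [fderiv_moll_apply k hiw.locallyIntegrable, moll_apply_swap]
  set ρ := (mollBump n k).normed (volume : Measure (Eu n)) with hρ
  -- The mollifier centred at `x` is itself an admissible test function; reflecting its argument
  -- produces the sign that cancels the one in the definition of the weak derivative.
  set φ : Eu n → ℝ := fun y => ρ (x - y) with hφ
  have hρs : ContDiff ℝ ∞ ρ := (mollBump n k).contDiff_normed
  have hφs : ContDiff ℝ ∞ φ := hρs.comp (contDiff_const.sub contDiff_id)
  have hsup : tsupport φ ⊆ Metric.closedBall x (mollBump n k).rOut := by
    refine closure_minimal ?_ Metric.isClosed_closedBall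
    intro y hy
    have : x - y ∈ Function.support ρ := hy
    rw [hρ, (mollBump n k).support_normed_eq] at this
    rw [Metric.mem_closedBall, dist_comm, dist_eq_norm]
    simpa using (Metric.mem_ball.1 this).le
  have hcs : HasCompactSupport φ :=
    HasCompactSupport.of_support_subset_isCompact (isCompact_closedBall x _)
      ((subset_tsupport _).trans hsup)
  have hd : ∀ y, fderiv ℝ φ y e = -fderiv ℝ ρ (x - y) e := by
    intro y
    have h1 : HasFDerivAt ρ (fderiv ℝ ρ (x - y)) (x - y) :=
      (hρs.differentiable (by simp) _).hasFDerivAt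
    have h2 : HasFDerivAt (fun y => x - y) (-(ContinuousLinearMap.id ℝ (Eu n))) y :=
      (hasFDerivAt_id y).const_sub x
    have h3 := h1.comp y h2
    have h4 : fderiv ℝ φ y = _ := h3.fderiv
    rw [h4]
    simp
  have e1 : ∀ (ψ : Eu n → ℝ) (f : Eu n → V), tsupport ψ ⊆ tsupport φ →
      ∫ y, ψ y • S.indicator f y = ∫ y, ψ y • f y := by
    intro ψ f hψ
    congr 1
    ext y
    by_cases hy : y ∈ S
    · rw [indicator_of_mem hy]
    · rw [image_eq_zero_of_notMem_tsupport fun h' => hy (hx (hsup (hψ h')))]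
      simp
  have h5 := h.integral_eq' hφs hcs ((hsup.trans hx).trans hSΩ)
  rw [← e1 _ w (tsupport_fderiv_apply_subset ℝ e), ← e1 φ G subset_rfl] at h5
  rw [← neg_inj, ← h5, ← integral_neg]
  congr 1
  ext y
  rw [hd, neg_smul]

end

end

/-! ### Composition of weakly differentiable maps with `C¹` functions. -/

noncomputable section

lemma LocallyIntegrableOn.mono_of_restrict {n : ℕ} {Ω : Set (Eu n)} {E F : Type*}
    [NormedAddCommGroup E] [NormedAddCommGroup F] {f : Eu n → E} {g : Eu n → F}
    (hf : LocallyIntegrableOn f Ω) (hg : AEStronglyMeasurable g (volume.restrict Ω))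
    (h : ∀ᵐ x ∂(volume.restrict Ω), ‖g x‖ ≤ ‖f x‖) : LocallyIntegrableOn g Ω := by
  intro x hx
  obtain ⟨t, ht, hti⟩ := hf x hx
  refine ⟨t ∩ Ω, inter_mem ht self_mem_nhdsWithin, ?_⟩
  exact Integrable.mono (hti.mono_set inter_subset_left) (hg.mono_measure
    (Measure.restrict_mono inter_subset_right le_rfl))
    (ae_restrict_of_ae_restrict_of_subset inter_subset_right h)

section

variable {n : ℕ} {V : Type*} [NormedAddCommGroup V] [NormedSpace ℝ V]
  {Ω : Set (Eu n)} {e : Eu n}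

lemma continuous_fderiv_apply_pair {Φ : V → ℝ} (hΦ : ContDiff ℝ 1 Φ) :
    Continuous (fun p : V × V => fderiv ℝ Φ p.1 p.2) :=
  ((hΦ.continuous_fderiv one_ne_zero).comp continuous_fst).clm_apply continuous_snd

/-- The identity is classical for mollifications of `w`, taken near the support of `φ`. In the limit
the left side converges by dominated convergence, `Φ` being bounded; on the right `Φ'` is bounded
and the mollified derivatives converge in `L¹`. -/
lemma HasWeakDir.integral_comp_eq [CompleteSpace V] {w G : Eu n → V} (hΩ : IsOpen Ω) (h : HasWeakDir Ω e w G)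
    {Φ : V → ℝ} (hΦ : ContDiff ℝ 1 Φ) {C M : ℝ} (hC : ∀ v, ‖Φ v‖ ≤ C)
    (hM : ∀ v, ‖fderiv ℝ Φ v‖ ≤ M) {φ : Eu n → ℝ}
    (h1 : ContDiff ℝ ∞ φ) (h2 : HasCompactSupport φ) (h3 : tsupport φ ⊆ Ω) :
    ∫ x, fderiv ℝ φ x e * Φ (w x) = -∫ x, φ x * fderiv ℝ Φ (w x) (G x) := by
  obtain ⟨δ, hδ, hδΩ⟩ := h2.isCompact.exists_cthickening_subset_open hΩ h3
  set S := Metric.cthickening δ (tsupport φ) with hSdef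
  have hS : IsCompact S := h2.isCompact.cthickening
  have hKS : tsupport φ ⊆ S := Metric.self_subset_cthickening _
  have hiw : Integrable (S.indicator w) :=
    (h.1.integrableOn_compact_subset hδΩ hS).integrable_indicator hS.measurableSet
  have hiG : Integrable (S.indicator G) :=
    (h.2.integrableOn_compact_subset hδΩ hS).integrable_indicator hS.measurableSet
  have hwc := fun k => contDiff_moll k hiw.locallyIntegrable
  have hGc := fun k => contDiff_moll k hiG.locallyIntegrable
  have hdc := continuous_fderiv_apply_of_contDiff h1 e
  have hdk := hasCompactSupport_fderiv_apply h2 e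
  have hM0 : 0 ≤ M := (norm_nonneg _).trans (hM 0)
  obtain ⟨N, hN⟩ := h2.exists_bound_of_continuous h1.continuous
  have hN0 : 0 ≤ N := (norm_nonneg _).trans (hN 0)
  have key : ∀ᶠ k in atTop, ∫ x, fderiv ℝ φ x e * Φ (moll k (S.indicator w) x) =
      -∫ x, φ x * fderiv ℝ Φ (moll k (S.indicator w) x) (moll k (S.indicator G) x) := by
    filter_upwards [(tendsto_rOut_mollBump n).eventually_le_const hδ] with k hk
    set W := moll k (S.indicator w) with hW
    have hWd : ContDiff ℝ 1 W := (hwc k).of_le (by simp)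
    have hf : ContDiff ℝ 1 (fun x => Φ (W x)) := hΦ.comp hWd
    have hfd : ∀ x, fderiv ℝ (fun x => Φ (W x)) x e = fderiv ℝ Φ (W x) (fderiv ℝ W x e) := by
      intro x
      have := ((hΦ.differentiable one_ne_zero (W x)).hasFDerivAt.comp x
        (hWd.differentiable one_ne_zero x).hasFDerivAt).fderiv
      have h' : fderiv ℝ (fun x => Φ (W x)) x = _ := this
      rw [h']; rfl
    have hfdc : Continuous (fun x => fderiv ℝ (fun x => Φ (W x)) x e) :=
      (hf.continuous_fderiv one_ne_zero).clm_apply continuous_const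
    have := integral_mul_fderiv_eq_neg_fderiv_mul_of_integrable (μ := volume)
      (f := fun x => Φ (W x)) (g := φ) (v := e)
      ((hfdc.mul h1.continuous).integrable_of_hasCompactSupport h2.mul_left)
      ((hf.continuous.mul hdc).integrable_of_hasCompactSupport hdk.mul_left)
      ((hf.continuous.mul h1.continuous).integrable_of_hasCompactSupport h2.mul_left)
      (fun x _ => hf.differentiable one_ne_zero x)
      (fun x _ => h1.differentiable (by simp) x)
    simp only [mul_comm (fderiv ℝ φ _ e), this]
    congr 2
    ext x
    by_cases hx : x ∈ tsupport φ
    · rw [hfd, mul_comm, hW, h.fderiv_moll hS hδΩ]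
      refine (Metric.closedBall_subset_closedBall hk).trans ?_
      exact Metric.closedBall_subset_cthickening hx δ
    · simp [image_eq_zero_of_notMem_tsupport hx]
  have hwt := ae_tendsto_moll hiw.locallyIntegrable
  have L1 : Tendsto (fun k => ∫ x, fderiv ℝ φ x e * Φ (moll k (S.indicator w) x)) atTop
      (𝓝 (∫ x, fderiv ℝ φ x e * Φ (S.indicator w x))) := by
    refine tendsto_integral_of_dominated_convergence (fun x => ‖fderiv ℝ φ x e‖ * C) ?_ ?_ ?_ ?_
    · exact fun k => (hdc.mul (hΦ.continuous.comp (hwc k).continuous)).aestronglyMeasurable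
    · exact ((hdc.norm).integrable_of_hasCompactSupport hdk.norm).mul_const C
    · exact fun k => ae_of_all _ fun x => by
        rw [norm_mul]; exact mul_le_mul_of_nonneg_left (hC _) (norm_nonneg _)
    · filter_upwards [hwt] with x hx
      exact ((hΦ.continuous.tendsto _).comp hx).const_mul _
  have hDm : ∀ k, AEStronglyMeasurable (fun x => φ x *
      fderiv ℝ Φ (moll k (S.indicator w) x) (S.indicator G x)) := fun k =>
    h1.continuous.aestronglyMeasurable.mul
      ((continuous_fderiv_apply_pair hΦ).comp_aestronglyMeasurable
        ((hwc k).continuous.aestronglyMeasurable.prodMk hiG.aestronglyMeasurable))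
  have hbd : ∀ (y : ℝ) (v g : V), ‖y‖ ≤ N → ‖y * fderiv ℝ Φ v g‖ ≤ N * M * ‖g‖ := by
    intro y v g hy
    rw [norm_mul, mul_assoc]
    refine mul_le_mul hy ((fderiv ℝ Φ v).le_opNorm g |>.trans ?_) (norm_nonneg _) hN0
    exact mul_le_mul_of_nonneg_right (hM v) (norm_nonneg _)
  have L2 : Tendsto (fun k => ∫ x, φ x * fderiv ℝ Φ (moll k (S.indicator w) x)
      (S.indicator G x)) atTop
      (𝓝 (∫ x, φ x * fderiv ℝ Φ (S.indicator w x) (S.indicator G x))) := by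
    refine tendsto_integral_of_dominated_convergence (fun x => N * M * ‖S.indicator G x‖) hDm ?_ ?_ ?_
    · exact hiG.norm.const_mul _
    · exact fun k => ae_of_all _ fun x => hbd _ _ _ (hN x)
    · filter_upwards [hwt] with x hx
      refine Tendsto.const_mul _ ?_
      exact ((continuous_fderiv_apply_pair hΦ).tendsto (S.indicator w x, S.indicator G x)).comp
        (hx.prodMk_nhds tendsto_const_nhds)
  -- The derivatives `moll k G` have no common dominating function, so their difference from `G` is
  -- removed first by `L¹` convergence; what remains is `L2`, dominated by a multiple of `‖G‖`.
  have L3 : Tendsto (fun k => ∫ x, φ x * fderiv ℝ Φ (moll k (S.indicator w) x)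
      (moll k (S.indicator G) x - S.indicator G x)) atTop (𝓝 0) := by
    have hz := (tendsto_integral_norm_moll_sub hiG).const_mul (N * M)
    rw [mul_zero] at hz
    refine squeeze_zero_norm (fun k => ?_) hz
    rw [← integral_const_mul]
    refine norm_integral_le_of_norm_le (((integrable_moll k hiG).sub hiG).norm.const_mul _)
      (ae_of_all _ fun x => hbd _ _ _ (hN x))
  have L4 : Tendsto (fun k => ∫ x, φ x * fderiv ℝ Φ (moll k (S.indicator w) x)
      (moll k (S.indicator G) x)) atTop
      (𝓝 (∫ x, φ x * fderiv ℝ Φ (S.indicator w x) (S.indicator G x))) := by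
    have := L3.add L2
    rw [zero_add] at this
    refine this.congr fun k => ?_
    rw [← integral_add]
    · congr 1; ext x; rw [map_sub]; ring
    · refine (((integrable_moll k hiG).sub hiG).norm.const_mul (N * M)).mono' ?_
        (ae_of_all _ fun x => hbd _ _ _ (hN x))
      exact h1.continuous.aestronglyMeasurable.mul
        ((continuous_fderiv_apply_pair hΦ).comp_aestronglyMeasurable
          ((hwc k).continuous.aestronglyMeasurable.prodMk
            ((hGc k).continuous.aestronglyMeasurable.sub hiG.aestronglyMeasurable)))
    · exact (hiG.norm.const_mul (N * M)).mono' (hDm k) (ae_of_all _ fun x => hbd _ _ _ (hN x))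
  have e1 : ∫ x, fderiv ℝ φ x e * Φ (S.indicator w x) = ∫ x, fderiv ℝ φ x e * Φ (w x) := by
    congr 1; ext x
    by_cases hx : x ∈ S
    · rw [indicator_of_mem hx]
    · have : x ∉ tsupport (fun x => fderiv ℝ φ x e) :=
        fun h' => hx (hKS (tsupport_fderiv_apply_subset ℝ e h'))
      rw [image_eq_zero_of_notMem_tsupport this]; simp
  have e2 : ∫ x, φ x * fderiv ℝ Φ (S.indicator w x) (S.indicator G x) =
      ∫ x, φ x * fderiv ℝ Φ (w x) (G x) := by
    congr 1; ext x
    by_cases hx : x ∈ S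
    · rw [indicator_of_mem hx, indicator_of_mem hx]
    · rw [image_eq_zero_of_notMem_tsupport fun h' => hx (hKS h')]; simp
  rw [e1] at L1
  rw [e2] at L4
  exact tendsto_nhds_unique (L1.congr' key) L4.neg

/-- The chain rule for `C¹` functions with compact support. -/
lemma HasWeakDir.comp [CompleteSpace V] {w G : Eu n → V} (hΩ : IsOpen Ω) (h : HasWeakDir Ω e w G)
    {Φ : V → ℝ} (hΦ : ContDiff ℝ 1 Φ) (hc : HasCompactSupport Φ) :
    HasWeakDir Ω e (fun x => Φ (w x)) (fun x => fderiv ℝ Φ (w x) (G x)) := by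
  obtain ⟨C, hC⟩ := hc.exists_bound_of_continuous hΦ.continuous
  obtain ⟨M, hM⟩ := (hc.fderiv ℝ).exists_bound_of_continuous (hΦ.continuous_fderiv one_ne_zero)
  have hwm : AEStronglyMeasurable w (volume.restrict Ω) := h.1.aestronglyMeasurable
  have hGm : AEStronglyMeasurable G (volume.restrict Ω) := h.2.aestronglyMeasurable
  refine ⟨?_, ?_, fun φ h1 h2 h3 => ?_⟩
  · refine LocallyIntegrableOn.mono_of_restrict (f := fun _ => C) ?_
      (hΦ.continuous.comp_aestronglyMeasurable hwm) (ae_of_all _ fun x => ?_)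
    · exact continuous_const.locallyIntegrable.locallyIntegrableOn _
    · exact (hC _).trans (le_abs_self C)
  · refine LocallyIntegrableOn.mono_of_restrict (f := fun x => M • G x) ?_
      ((continuous_fderiv_apply_pair hΦ).comp_aestronglyMeasurable (hwm.prodMk hGm))
      (ae_of_all _ fun x => ?_)
    · exact h.2.smul M
    · rw [norm_smul]
      refine ((fderiv ℝ Φ (w x)).le_opNorm _).trans ?_
      exact mul_le_mul_of_nonneg_right ((hM _).trans (le_abs_self M)) (norm_nonneg _)
  · rw [setIntegral_smul_eq_integral_of_tsupport_subset h3,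
      setIntegral_smul_eq_integral_of_tsupport_subset ((tsupport_fderiv_apply_subset ℝ e).trans h3)]
    exact h.integral_comp_eq hΩ hΦ hC hM h1 h2 h3

end

end

/-! ### Level sets and the local chain rule. -/

noncomputable section

section

variable {n : ℕ} {Ω : Set (Eu n)} {e : Eu n}

/-- A profile whose rescalings `q(N t) / N` tend uniformly to `0` while their slope at `0` stays
`1`; this is what detects a level set. -/
lemma exists_contDiff_hasCompactSupport_deriv_eq_one :
    ∃ q : ℝ → ℝ, ContDiff ℝ 1 q ∧ HasCompactSupport q ∧ deriv q 0 = 1 := by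
  let β : ContDiffBump (0 : ℝ) := ⟨1, 2, one_pos, one_lt_two⟩
  refine ⟨fun s => β s * s, β.contDiff.mul contDiff_id, β.hasCompactSupport.mul_right, ?_⟩
  have : (fun s => β s * s) =ᶠ[𝓝 0] fun s => s := by
    filter_upwards [β.eventuallyEq_one] with s hs
    simp [hs]
  rw [this.deriv_eq]
  simp

/-- The weak derivative vanishes almost everywhere on level sets. -/
lemma HasWeakDir.ae_eq_zero_of_eq_const {u g : Eu n → ℝ} (hΩ : IsOpen Ω)
    (h : HasWeakDir Ω e u g) (c : ℝ) :
    ∀ᵐ x ∂(volume.restrict Ω), u x = c → g x = 0 := by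
  obtain ⟨q, hq, hqc, hq1⟩ := exists_contDiff_hasCompactSupport_deriv_eq_one
  obtain ⟨C, hC⟩ := hqc.exists_bound_of_continuous hq.continuous
  have hdc : Continuous (deriv q) := hq.continuous_deriv le_rfl
  obtain ⟨M, hM⟩ := (hqc.deriv).exists_bound_of_continuous hdc
  have hC0 : 0 ≤ C := (norm_nonneg _).trans (hC 0)
  have hM0 : 0 ≤ M := (norm_nonneg _).trans (hM 0)
  -- `F k` tends uniformly to `0`, whereas its derivatives are uniformly bounded and tend pointwise
  -- to the indicator of `{c}`. The weak identity for `F k ∘ u` therefore says in the limit that `g`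
  -- restricted to `{u = c}` integrates to zero against every test function.
  set F : ℕ → ℝ → ℝ := fun k t => ((k : ℝ) + 1)⁻¹ * q (((k : ℝ) + 1) * (t - c)) with hF
  have hk0 : ∀ k : ℕ, (0 : ℝ) < (k : ℝ) + 1 := fun k => by positivity
  have hFd : ∀ k t, HasDerivAt (F k) (deriv q (((k : ℝ) + 1) * (t - c))) t := by
    intro k t
    have h1 : HasDerivAt q (deriv q (((k : ℝ) + 1) * (t - c))) (((k : ℝ) + 1) * (t - c)) :=
      (hq.differentiable one_ne_zero _).hasDerivAt
    have h2 : HasDerivAt (fun t => ((k : ℝ) + 1) * (t - c)) ((k : ℝ) + 1) t := by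
      simpa using ((hasDerivAt_id t).sub_const c).const_mul ((k : ℝ) + 1)
    have h3 := (h1.comp t h2).const_mul ((k : ℝ) + 1)⁻¹
    rw [mul_comm (deriv q _), inv_mul_cancel_left₀ (hk0 k).ne'] at h3
    exact h3
  have hFs : ∀ k, ContDiff ℝ 1 (F k) := fun k =>
    contDiff_const.mul (hq.comp (contDiff_const.mul (contDiff_id.sub contDiff_const)))
  have hFc : ∀ k, HasCompactSupport (F k) := by
    intro k
    have h1 : HasCompactSupport (fun t => q (((k : ℝ) + 1) * (t - c))) := by
      have := hqc.comp_homeomorph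
        ((Homeomorph.subRight c).trans (Homeomorph.mulLeft₀ ((k : ℝ) + 1) (hk0 k).ne'))
      exact this
    exact h1.mul_left
  have hW := fun k => h.comp hΩ (hFs k) (hFc k)
  have hfd : ∀ k t s, fderiv ℝ (F k) t s = deriv q (((k : ℝ) + 1) * (t - c)) * s := by
    intro k t s
    rw [(hFd k t).hasFDerivAt.fderiv]
    simp [mul_comm]
  have hum : AEStronglyMeasurable u (volume.restrict Ω) := h.1.aestronglyMeasurable
  have hgm : AEStronglyMeasurable g (volume.restrict Ω) := h.2.aestronglyMeasurable
  classical
  set f : Eu n → ℝ := fun x => if u x = c then g x else 0 with hf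
  have hlim : ∀ x, Tendsto (fun k : ℕ => deriv q (((k : ℝ) + 1) * (u x - c)) * g x) atTop
      (𝓝 (f x)) := by
    intro x
    by_cases hx : u x = c
    · simp [hf, hx, hq1]
    · simp only [hf, if_neg hx]
      have hcs : ∀ᶠ k : ℕ in atTop, deriv q (((k : ℝ) + 1) * (u x - c)) = 0 := by
        obtain ⟨R, hR⟩ := hqc.deriv.isCompact.isBounded.exists_norm_le
        have ht : Tendsto (fun k : ℕ => ((k : ℝ) + 1) * |u x - c|) atTop atTop :=
          (tendsto_atTop_add_const_right _ _ tendsto_natCast_atTop_atTop).atTop_mul_const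
            (abs_pos.2 (sub_ne_zero.2 hx))
        filter_upwards [ht.eventually_gt_atTop R] with k hk
        by_contra hne
        have := hR _ (subset_tsupport _ hne)
        rw [norm_mul, Real.norm_of_nonneg (hk0 k).le, Real.norm_eq_abs] at this
        linarith
      refine tendsto_const_nhds.congr' ?_
      filter_upwards [hcs] with k hk
      simp [hk]
  have hDm : ∀ k : ℕ, AEStronglyMeasurable (fun x => deriv q (((k : ℝ) + 1) * (u x - c)) * g x)
      (volume.restrict Ω) := fun k =>
    ((hdc.comp (continuous_const.mul (continuous_id.sub continuous_const))).comp_aestronglyMeasurable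
      hum).mul hgm
  have hfm : AEStronglyMeasurable f (volume.restrict Ω) :=
    aestronglyMeasurable_of_tendsto_ae atTop hDm (ae_of_all _ hlim)
  have hfl : LocallyIntegrableOn f Ω := by
    refine LocallyIntegrableOn.mono_of_restrict h.2 hfm (ae_of_all _ fun x => ?_)
    by_cases hx : u x = c <;> simp [hf, hx]
  have := hΩ.ae_eq_zero_of_integral_contDiff_smul_eq_zero (μ := volume) hfl ?_
  · rw [ae_restrict_iff' hΩ.measurableSet]
    filter_upwards [this] with x hx hxΩ hxc
    simpa [hf, hxc] using hx hxΩ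
  · intro φ h1 h2 h3
    have h3' := (tsupport_fderiv_apply_subset ℝ e (f := φ)).trans h3
    have hdi : Integrable (fun x => fderiv ℝ φ x e) :=
      (continuous_fderiv_apply_of_contDiff h1 e).integrable_of_hasCompactSupport
        (hasCompactSupport_fderiv_apply h2 e)
    have hgi := LocallyIntegrableOn.integrable_smul_of_tsupport_subset h.2 h1.continuous h2 h3
    have A1 : Tendsto (fun k => ∫ x in Ω, fderiv ℝ φ x e • F k (u x)) atTop (𝓝 0) := by
      have hz : Tendsto (fun k : ℕ => (1 / ((k : ℝ) + 1)) * (∫ x in Ω, C * ‖fderiv ℝ φ x e‖))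
          atTop (𝓝 0) := by
        simpa using tendsto_one_div_add_atTop_nhds_zero_nat.mul_const
          (∫ x in Ω, C * ‖fderiv ℝ φ x e‖)
      refine squeeze_zero_norm (fun k => ?_) hz
      rw [← integral_const_mul]
      refine norm_integral_le_of_norm_le ((hdi.norm.const_mul C).const_mul _).integrableOn
        (ae_of_all _ fun x => ?_)
      rw [norm_smul, hF]
      simp only [norm_mul, norm_inv, Real.norm_of_nonneg (hk0 k).le, one_div]
      rw [mul_left_comm, mul_comm C]
      exact mul_le_mul_of_nonneg_left (mul_le_mul_of_nonneg_left (hC _) (norm_nonneg _))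
        (inv_nonneg.2 (hk0 k).le)
    have A2 : Tendsto (fun k => ∫ x in Ω, φ x • fderiv ℝ (F k) (u x) (g x)) atTop
        (𝓝 (∫ x in Ω, φ x • f x)) := by
      simp only [hfd]
      refine tendsto_integral_of_dominated_convergence (fun x => M * ‖φ x • g x‖) ?_ ?_ ?_ ?_
      · exact fun k => h1.continuous.aestronglyMeasurable.smul (hDm k)
      · exact (hgi.norm.const_mul M).integrableOn
      · intro k
        refine ae_of_all _ fun x => ?_
        rw [norm_smul, norm_smul, norm_mul, mul_left_comm]
        exact mul_le_mul_of_nonneg_right (hM _) (by positivity)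
      · exact ae_of_all _ fun x => (hlim x).const_smul _
    have A3 : ∀ k, ∫ x in Ω, fderiv ℝ φ x e • F k (u x) =
        -∫ x in Ω, φ x • fderiv ℝ (F k) (u x) (g x) := fun k => (hW k).3 φ h1 h2 h3
    simp only [A3] at A1
    have := tendsto_nhds_unique A1 A2.neg
    rw [setIntegral_smul_eq_integral_of_tsupport_subset h3] at this
    linarith

variable {V : Type*} [NormedAddCommGroup V] [NormedSpace ℝ V] [FiniteDimensional ℝ V]

/-- For a cutoff `β` supported in `O`, the functions `β(U) z` and `β(U) Φ(U)` agree a.e., and each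
is a compactly supported `C¹` function of a weakly differentiable map. Uniqueness identifies their
derivatives, and on the half ball the cutoffs are locally constant and drop out. -/
lemma HasWeakDir.ae_eq_fderiv_of_mem_ball {U G : Eu n → V} {z gz : Eu n → ℝ}
    (hΩ : IsOpen Ω) (hU : HasWeakDir Ω e U G) (hz : HasWeakDir Ω e z gz)
    {O : Set V} (hO : IsOpen O) {Φ : V → ℝ} (hΦ : ContDiffOn ℝ 1 Φ O)
    (heq : ∀ᵐ x ∂(volume.restrict Ω), U x ∈ O → z x = Φ (U x))
    {p : V} {r : ℝ} (hr : 0 < r) (hp : Metric.closedBall p r ⊆ O) :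
    ∀ᵐ x ∂(volume.restrict Ω), U x ∈ Metric.ball p (r / 2) → gz x = fderiv ℝ Φ (U x) (G x) := by
  have : CompleteSpace V := FiniteDimensional.complete ℝ V
  let β : ContDiffBump p := ⟨r / 2, r, by positivity, by linarith⟩
  have hβs : tsupport β ⊆ O := by
    rw [β.tsupport_eq]; exact hp
  obtain ⟨M, hM⟩ := (isCompact_closedBall p r).exists_bound_of_continuousOn
    (hΦ.continuousOn.mono hp)
  have hM0 : 0 ≤ M := (norm_nonneg _).trans (hM p (Metric.mem_closedBall_self hr.le))
  -- Truncating `z` makes the function of the pair `(U, z)` compactly supported. As `|Φ| ≤ M` on the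
  -- ball, the radius `M + 1` leaves `τ = 1` on a whole neighbourhood of the relevant values of `z`.
  let τ : ContDiffBump (0 : ℝ) := ⟨M + 1, M + 2, by positivity, by linarith⟩
  have h2s : ContDiff ℝ 1 (fun v => β v * Φ v) := by
    refine contDiff_iff_contDiffAt.2 fun v => ?_
    by_cases hv : v ∈ O
    · exact β.contDiff.contDiffAt.mul (hΦ.contDiffAt (hO.mem_nhds hv))
    · have : (fun v => β v * Φ v) =ᶠ[𝓝 v] fun _ => 0 := by
        have hv' : v ∉ tsupport β := fun h => hv (hβs h)
        filter_upwards [(isClosed_tsupport β).isOpen_compl.mem_nhds hv'] with w hw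
        simp [image_eq_zero_of_notMem_tsupport hw]
      exact contDiffAt_const.congr_of_eventuallyEq this
  have h2c : HasCompactSupport (fun v => β v * Φ v) := β.hasCompactSupport.mul_right
  have h1s : ContDiff ℝ 1 (fun v : V × ℝ => β v.1 * (τ v.2 * v.2)) :=
    (β.contDiff.comp contDiff_fst).mul ((τ.contDiff.comp contDiff_snd).mul contDiff_snd)
  have h1c : HasCompactSupport (fun v : V × ℝ => β v.1 * (τ v.2 * v.2)) := by
    refine HasCompactSupport.of_support_subset_isCompact
      (β.hasCompactSupport.isCompact.prod τ.hasCompactSupport.isCompact) ?_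
    intro v hv
    constructor
    · refine subset_tsupport _ fun h => hv ?_
      simp [h]
    · refine subset_tsupport _ fun h => hv ?_
      simp [h]
  have hzM : ∀ v ∈ Metric.closedBall p r, τ (Φ v) = 1 := by
    intro v hv
    apply τ.one_of_mem_closedBall
    rw [mem_closedBall_zero_iff]
    exact (hM v hv).trans (by change M ≤ M + 1; linarith)
  have key := (((hU.prodMk hz).comp hΩ h1s h1c)).ae_eq hΩ (hU.comp hΩ h2s h2c) (by
    filter_upwards [heq] with x hx
    by_cases hb : U x ∈ Metric.ball p r
    · have hb' := Metric.ball_subset_closedBall hb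
      rw [hx (hp hb'), hzM _ hb', one_mul]
    · have : β (U x) = 0 := by
        rw [← Function.notMem_support, β.support_eq]; exact hb
      simp [this])
  filter_upwards [key, heq] with x hx hzx hxb
  have hxc : U x ∈ Metric.closedBall p r :=
    Metric.ball_subset_closedBall (Metric.ball_subset_ball (by linarith) hxb)
  have hβ1 : ∀ᶠ v in 𝓝 (U x), β v = 1 := by
    filter_upwards [Metric.isOpen_ball.mem_nhds hxb] with v hv
    exact β.one_of_mem_closedBall (Metric.ball_subset_closedBall hv)
  have hτ1 : ∀ᶠ s in 𝓝 (z x), τ s = 1 := by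
    have : z x ∈ Metric.ball (0 : ℝ) (M + 1) := by
      rw [mem_ball_zero_iff, hzx (hp hxc)]
      linarith [hM _ hxc]
    filter_upwards [Metric.isOpen_ball.mem_nhds this] with s hs
    exact τ.one_of_mem_closedBall (Metric.ball_subset_closedBall hs)
  have E1 : (fun v : V × ℝ => β v.1 * (τ v.2 * v.2)) =ᶠ[𝓝 (U x, z x)] fun v => v.2 := by
    have a1 : ∀ᶠ v : V × ℝ in 𝓝 (U x, z x), β v.1 = 1 := 
      (continuous_fst.tendsto (U x, z x)).eventually hβ1
    have a2 : ∀ᶠ v : V × ℝ in 𝓝 (U x, z x), τ v.2 = 1 := 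
      (continuous_snd.tendsto (U x, z x)).eventually hτ1
    filter_upwards [a1, a2] with v hv1 hv2
    simp [hv1, hv2]
  have E2 : (fun v => β v * Φ v) =ᶠ[𝓝 (U x)] Φ := by
    filter_upwards [hβ1] with v hv
    simp [hv]
  rw [E1.fderiv_eq, E2.fderiv_eq, fderiv_snd] at hx
  exact hx

/-- The local chain rule: if `z = Φ ∘ U` where `U` takes values in the open set `O`, then the weak
derivative of `z` is given there by the classical chain rule. -/
lemma HasWeakDir.ae_eq_fderiv_of_mem {U G : Eu n → V} {z gz : Eu n → ℝ}
    (hΩ : IsOpen Ω) (hU : HasWeakDir Ω e U G) (hz : HasWeakDir Ω e z gz)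
    {O : Set V} (hO : IsOpen O) {Φ : V → ℝ} (hΦ : ContDiffOn ℝ 1 Φ O)
    (heq : ∀ᵐ x ∂(volume.restrict Ω), U x ∈ O → z x = Φ (U x)) :
    ∀ᵐ x ∂(volume.restrict Ω), U x ∈ O → gz x = fderiv ℝ Φ (U x) (G x) := by
  have hr : ∀ p : O, ∃ r > 0, Metric.closedBall (p : V) r ⊆ O := fun p =>
    Metric.nhds_basis_closedBall.mem_iff.1 (hO.mem_nhds p.2)
  choose r hr0 hrO using hr
  have : ProperSpace V := FiniteDimensional.proper ℝ V
  -- Lindelöf: countably many half balls cover `O`, so the exceptional null sets can be united.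
  obtain ⟨T, hT, hTU⟩ := TopologicalSpace.isOpen_iUnion_countable
    (fun p : O => Metric.ball (p : V) (r p / 2)) fun p => Metric.isOpen_ball
  have : ∀ᵐ x ∂(volume.restrict Ω), ∀ p ∈ T, U x ∈ Metric.ball (p : V) (r p / 2) →
      gz x = fderiv ℝ Φ (U x) (G x) :=
    (ae_ball_iff hT).2 fun p _ => hU.ae_eq_fderiv_of_mem_ball hΩ hz hO hΦ heq (hr0 p) (hrO p)
  filter_upwards [this] with x hx hxO
  have : U x ∈ ⋃ p ∈ T, Metric.ball (p : V) (r p / 2) := by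
    rw [hTU]
    exact mem_iUnion.2 ⟨⟨U x, hxO⟩, Metric.mem_ball_self (by have := hr0 ⟨U x, hxO⟩; positivity)⟩
  obtain ⟨p, hp, hxp⟩ := mem_iUnion₂.1 this
  exact hx p hp hxp

end

end

/-! ### Lipschitz test functions and directional derivatives. -/

noncomputable section

section

variable {n : ℕ} {V : Type*} [NormedAddCommGroup V] [NormedSpace ℝ V]
  {Ω : Set (Eu n)} {e : Eu n}

/-- Integration by parts of the line derivative of `ψ` against the mollifier. It bounds the
derivatives of all mollifications by the Lipschitz constant and reduces their a.e. convergence to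
that of mollified line derivatives. -/
lemma LipschitzWith.fderiv_moll_apply {K : ℝ≥0} {ψ : Eu n → ℝ} (hψ : LipschitzWith K ψ)
    (k : ℕ) (x e : Eu n) :
    fderiv ℝ (moll k ψ) x e = moll k (fun y => lineDeriv ℝ ψ y e) x := by
  set ρ := (mollBump n k).normed (volume : Measure (Eu n)) with hρ
  have hρs : ContDiff ℝ ∞ ρ := (mollBump n k).contDiff_normed
  have hρc : HasCompactSupport ρ := (mollBump n k).hasCompactSupport_normed
  have hφs : ContDiff ℝ ∞ (fun y => ρ (x - y)) := hρs.comp (contDiff_const.sub contDiff_id)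
  have hφc : HasCompactSupport (fun y => ρ (x - y)) := by
    have := hρc.comp_homeomorph (Homeomorph.subLeft x)
    exact this
  obtain ⟨D, hD⟩ := (hφs.of_le (m := 1) (by simp)).lipschitzWith_of_hasCompactSupport hφc one_ne_zero
  have key := hψ.integral_lineDeriv_mul_eq (μ := volume) hD hφc e
  rw [_root_.fderiv_moll_apply k hψ.continuous.locallyIntegrable, moll_apply_swap]
  have hcomm : ∫ t, ρ (x - t) • lineDeriv ℝ ψ t e = ∫ t, lineDeriv ℝ ψ t e * ρ (x - t) := by
    congr 1
    ext t
    exact mul_comm _ _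
  rw [← hρ, hcomm, key]
  congr 1
  ext y
  congr 1
  have h1 : HasFDerivAt ρ (fderiv ℝ ρ (x - y)) (x - y) :=
    (hρs.differentiable (by simp) _).hasFDerivAt
  have h2 : HasFDerivAt (fun y => x - y) (-(ContinuousLinearMap.id ℝ (Eu n))) y :=
    (hasFDerivAt_id y).const_sub x
  have h3 : HasFDerivAt (fun y => ρ (x - y)) _ y := h1.comp y h2
  rw [h3.differentiableAt.lineDeriv_eq_fderiv, h3.fderiv]
  simp

/-- Weak derivatives may be tested against Lipschitz functions. -/
lemma HasWeakDir.integral_lipschitz_eq {w G : Eu n → V} (hΩ : IsOpen Ω)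
    (h : HasWeakDir Ω e w G) {K : ℝ≥0} {ψ : Eu n → ℝ} (hψ : LipschitzWith K ψ)
    (hc : HasCompactSupport ψ) (hs : tsupport ψ ⊆ Ω) :
    ∫ x, fderiv ℝ ψ x e • w x = -∫ x, ψ x • G x := by
  obtain ⟨δ, hδ, hδΩ⟩ := hc.isCompact.exists_cthickening_subset_open hΩ hs
  set S := Metric.cthickening δ (tsupport ψ) with hSdef
  have hS : IsCompact S := hc.isCompact.cthickening
  have hiw : Integrable (S.indicator w) :=
    (h.1.integrableOn_compact_subset hδΩ hS).integrable_indicator hS.measurableSet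
  have hiG : Integrable (S.indicator G) :=
    (h.2.integrableOn_compact_subset hδΩ hS).integrable_indicator hS.measurableSet
  obtain ⟨C, hC⟩ := hc.exists_bound_of_continuous hψ.continuous
  have hps : ∀ k, ContDiff ℝ ∞ (moll k ψ) := fun k =>
    contDiff_moll k hψ.continuous.locallyIntegrable
  have hld : LocallyIntegrable (fun y => lineDeriv ℝ ψ y e) := hψ.locallyIntegrable_lineDeriv e
  have hsup : ∀ᶠ k in atTop, tsupport (moll k ψ) ⊆ S := by
    filter_upwards [(tendsto_rOut_mollBump n).eventually_le_const hδ] with k hk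
    refine closure_minimal ?_ Metric.isClosed_cthickening
    intro x hx
    by_contra hxS
    refine hx (moll_eq_zero k fun y hy => ?_)
    by_contra hne
    refine hxS (Metric.mem_cthickening_of_dist_le x y δ _ (subset_tsupport _ hne) ?_)
    rw [dist_comm]
    exact (Metric.mem_ball.1 hy).le.trans hk
  have hind : ∀ {χ : Eu n → ℝ} {f : Eu n → V}, tsupport χ ⊆ S →
      ∫ x, χ x • f x = ∫ x, χ x • S.indicator f x := by
    intro χ f hχ
    congr 1
    ext x
    by_cases hx : x ∈ S
    · rw [indicator_of_mem hx]
    · rw [image_eq_zero_of_notMem_tsupport fun h' => hx (hχ h')]; simp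
  have hKS : tsupport ψ ⊆ S := Metric.self_subset_cthickening _
  rw [hind hKS, hind ((tsupport_fderiv_apply_subset ℝ e).trans hKS)]
  have key : ∀ᶠ k in atTop, ∫ x, fderiv ℝ (moll k ψ) x e • S.indicator w x =
      -∫ x, moll k ψ x • S.indicator G x := by
    filter_upwards [hsup] with k hk
    rw [← hind hk, ← hind ((tsupport_fderiv_apply_subset ℝ e).trans hk)]
    exact h.integral_eq' (hps k) (HasCompactSupport.of_support_subset_isCompact hS
      ((subset_tsupport _).trans hk)) (hk.trans hδΩ)
  have L1 : Tendsto (fun k => ∫ x, fderiv ℝ (moll k ψ) x e • S.indicator w x) atTop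
      (𝓝 (∫ x, fderiv ℝ ψ x e • S.indicator w x)) := by
    refine tendsto_integral_of_dominated_convergence
      (fun x => (K * ‖e‖) * ‖S.indicator w x‖) ?_ ?_ ?_ ?_
    · exact fun k => (continuous_fderiv_apply_of_contDiff (hps k) e).aestronglyMeasurable.smul
        hiw.aestronglyMeasurable
    · exact hiw.norm.const_mul _
    · refine fun k => ae_of_all _ fun x => ?_
      rw [norm_smul, hψ.fderiv_moll_apply]
      refine mul_le_mul_of_nonneg_right ?_ (norm_nonneg _)
      exact norm_moll_le_of_bound k (fun y => norm_lineDeriv_le_of_lipschitz ℝ hψ) x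
    -- The limit is a priori the line derivative of `ψ`; by Rademacher it equals the Fréchet
    -- derivative in direction `e` almost everywhere.
    · filter_upwards [ae_tendsto_moll hld, hψ.ae_differentiableAt] with x hx hxd
      simp only [hψ.fderiv_moll_apply]
      rw [← hxd.lineDeriv_eq_fderiv]
      exact hx.smul_const _
  have L2 : Tendsto (fun k => ∫ x, moll k ψ x • S.indicator G x) atTop
      (𝓝 (∫ x, ψ x • S.indicator G x)) := by
    refine tendsto_integral_of_dominated_convergence
      (fun x => C * ‖S.indicator G x‖) ?_ ?_ ?_ ?_
    · exact fun k => (hps k).continuous.aestronglyMeasurable.smul hiG.aestronglyMeasurable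
    · exact hiG.norm.const_mul _
    · refine fun k => ae_of_all _ fun x => ?_
      rw [norm_smul]
      exact mul_le_mul_of_nonneg_right (norm_moll_le_of_bound k hC x) (norm_nonneg _)
    · filter_upwards [ae_tendsto_moll hψ.continuous.locallyIntegrable] with x hx
      exact hx.smul_const _
  exact tendsto_nhds_unique (L1.congr' key) L2.neg

lemma euclideanSpace_eq_sum_single (v : Eu n) : v = ∑ i, v i • EuclideanSpace.single i (1 : ℝ) := by
  have := (EuclideanSpace.basisFun (Fin n) ℝ).sum_repr v
  simpa using this.symm

/-- Weak partial derivatives combine to weak derivatives in all directions. -/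
lemma hasWeakDir_of_hasWeakPartial {w : Eu n → ℝ} {g : Fin n → Eu n → ℝ}
    (hw : LocallyIntegrableOn w Ω)
    (h : ∀ i, HasWeakPartial Ω i w (g i)) (v : Eu n) :
    HasWeakDir Ω v w (fun x => ∑ i, v i * g i x) := by
  refine ⟨hw, ?_, fun φ h1 h2 h3 => ?_⟩
  · have : ∀ s : Finset (Fin n), LocallyIntegrableOn (fun x => ∑ i ∈ s, v i * g i x) Ω := by
      classical
      intro s
      induction s using Finset.induction_on with
      | empty => simpa using (locallyIntegrable_const (0 : ℝ)).locallyIntegrableOn Ω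
      | insert a s ha ih =>
        simp only [Finset.sum_insert ha]
        exact ((h a).2.smul (v a)).add ih
    exact this Finset.univ
  · rw [setIntegral_smul_eq_integral_of_tsupport_subset h3,
      setIntegral_smul_eq_integral_of_tsupport_subset ((tsupport_fderiv_apply_subset ℝ v).trans h3)]
    have e1 : ∀ x, fderiv ℝ φ x v • w x =
        ∑ i, v i • (fderiv ℝ φ x (EuclideanSpace.single i 1) • w x) := by
      intro x
      conv_lhs => rw [euclideanSpace_eq_sum_single v]
      simp [map_sum, Finset.sum_mul, mul_assoc]
    have e2 : ∀ x, φ x • ∑ i, v i * g i x = ∑ i, v i • (φ x • g i x) := by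
      intro x
      simp only [smul_eq_mul, Finset.mul_sum]
      exact Finset.sum_congr rfl fun i _ => by ring
    simp only [e1, e2]
    have hI1 : ∀ i : Fin n, Integrable
        (fun x => fderiv ℝ φ x (EuclideanSpace.single i 1) • w x) := fun i =>
      LocallyIntegrableOn.integrable_smul_of_tsupport_subset hw
        (continuous_fderiv_apply_of_contDiff h1 _) (hasCompactSupport_fderiv_apply h2 _)
        ((tsupport_fderiv_apply_subset ℝ _).trans h3)
    have hI2 : ∀ i : Fin n, Integrable (fun x => φ x • g i x) := fun i =>
      LocallyIntegrableOn.integrable_smul_of_tsupport_subset (h i).2 h1.continuous h2 h3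
    have hJ1 : ∀ i : Fin n, Integrable
        (fun x => v i • (fderiv ℝ φ x (EuclideanSpace.single i 1) • w x)) :=
      fun i => (hI1 i).smul (v i)
    have hJ2 : ∀ i : Fin n, Integrable (fun x => v i • (φ x • g i x)) := fun i => (hI2 i).smul (v i)
    rw [integral_finsetSum _ fun i _ => hJ1 i, integral_finsetSum _ fun i _ => hJ2 i, ← Finset.sum_neg_distrib]
    refine Finset.sum_congr rfl fun i _ => ?_
    rw [integral_smul, integral_smul, (h i).hasWeakDir.integral_eq' h1 h2 h3, smul_neg]

end

end

noncomputable section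

/-! ### Traces on the boundary of a half-space -/

section

variable {d : ℕ}

/-- The integral of `‖G‖` over the vertical segment of length `r` above `y`. -/
def vertMass (G : Eu d × ℝ → ℝ) (r : ℝ) (y : Eu d) : ℝ≥0∞ := ∫⁻ τ in Ioo 0 r, ‖G (y, τ)‖ₑ

lemma measurable_vertMass {G : Eu d × ℝ → ℝ} (hG : Measurable G) (r : ℝ) :
    Measurable (vertMass G r) :=
  Measurable.lintegral_prod_right' (f := fun p : Eu d × ℝ => ‖G p‖ₑ) hG.enorm

lemma vertMass_mono (G : Eu d × ℝ → ℝ) {r s : ℝ} (h : r ≤ s) (y : Eu d) :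
    vertMass G r y ≤ vertMass G s y :=
  lintegral_mono_set (Ioo_subset_Ioo_right h)

lemma lintegral_vertMass_le {G : Eu d × ℝ → ℝ} (hG : Measurable G) (r : ℝ) :
    ∫⁻ y, vertMass G r y ≤ ∫⁻ p, ‖G p‖ₑ := by
  rw [Measure.volume_eq_prod, lintegral_prod _ hG.enorm.aemeasurable]
  exact lintegral_mono fun y => setLIntegral_le_lintegral _ _

lemma tendsto_vertMass {G : Eu d × ℝ → ℝ} {y : Eu d} (hG : Integrable (fun τ => G (y, τ))) :
    Tendsto (fun r => vertMass G r y) (𝓝[>] 0) (𝓝 0) := by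
  refine tendsto_setLIntegral_zero (μ := volume) hG.2.ne ?_
  have : Tendsto (fun r : ℝ => ENNReal.ofReal (r - 0)) (𝓝[>] 0) (𝓝 0) := by
    have h : Tendsto (fun r : ℝ => ENNReal.ofReal (r - 0)) (𝓝 0) (𝓝 (ENNReal.ofReal (0 - 0))) :=
      ENNReal.tendsto_ofReal (tendsto_id.sub_const 0)
    simpa using h.mono_left nhdsWithin_le_nhds
  refine this.congr fun r => ?_
  simp

lemma tendsto_lintegral_vertMass {G : Eu d × ℝ → ℝ} (hGm : Measurable G) (hG : Integrable G)
    {δ : ℕ → ℝ} (hδ : Tendsto δ atTop (𝓝[>] 0)) :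
    Tendsto (fun k => ∫⁻ y, vertMass G (δ k) y) atTop (𝓝 0) := by
  have hG' := hG
  rw [Measure.volume_eq_prod] at hG'
  have h1 : Tendsto (fun k => ∫⁻ y, vertMass G (δ k) y) atTop (𝓝 (∫⁻ _ : Eu d, 0)) := by
    refine tendsto_lintegral_of_dominated_convergence (fun y => ∫⁻ τ, ‖G (y, τ)‖ₑ)
      (fun k => measurable_vertMass hGm _) (fun k => ae_of_all _ fun y =>
        setLIntegral_le_lintegral _ _) ?_ ?_
    · rw [← lintegral_prod _ hGm.enorm.aemeasurable]
      exact hG'.2.ne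
    · filter_upwards [hG'.prod_right_ae] with y hy
      exact (tendsto_vertMass hy).comp hδ
  simpa using h1

/-- Fubini over `{s < τ}`. Because `c` vanishes for `s ≤ 0`, the inner integral of `c` over `(-∞,
τ)` is the integral from `0` to `τ`, also for negative `τ`. -/
lemma integral_tail_mul_eq {G c : ℝ → ℝ} (hGm : Measurable G) (hG : Integrable G)
    (hc : Continuous c) (hcc : HasCompactSupport c) (hs : tsupport c ⊆ Ioi 0) :
    ∫ s, (∫ τ in Ioi s, G τ) * c s = ∫ τ, G τ * ∫ s in (0)..τ, c s := by
  have hci : Integrable c := hc.integrable_of_hasCompactSupport hcc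
  have hc0 : ∀ s ≤ 0, c s = 0 := fun s h0 =>
    image_eq_zero_of_notMem_tsupport fun h => absurd (hs h) (not_lt.2 h0)
  have hint : Integrable (Function.uncurry fun s τ : ℝ => (Ioi s).indicator G τ * c s)
      (volume.prod volume) := by
    have hb : Integrable (fun p : ℝ × ℝ => c p.1 * G p.2) (volume.prod volume) := hci.mul_prod hG
    refine hb.mono ?_ (ae_of_all _ fun p => ?_)
    · refine Measurable.aestronglyMeasurable ?_
      have : (Function.uncurry fun s τ : ℝ => (Ioi s).indicator G τ * c s) =
          fun p : ℝ × ℝ => {p : ℝ × ℝ | p.1 < p.2}.indicator (fun p => G p.2) p * c p.1 := by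
        ext ⟨s, τ⟩
        simp [Function.uncurry, indicator]
      rw [this]
      exact ((hGm.comp measurable_snd).indicator (measurableSet_lt measurable_fst measurable_snd)).mul
        (hc.measurable.comp measurable_fst)
    · rcases p with ⟨s, τ⟩
      simp only [Function.uncurry, norm_mul, mul_comm ‖c s‖]
      exact mul_le_mul_of_nonneg_right (norm_indicator_le_norm_self _ _) (norm_nonneg _)
  have h1 : ∀ s, (∫ τ in Ioi s, G τ) * c s = ∫ τ, (Ioi s).indicator G τ * c s := by
    intro s
    rw [integral_mul_const, integral_indicator measurableSet_Ioi]
  have h2 : ∀ τ, G τ * ∫ s in (0)..τ, c s = ∫ s, (Ioi s).indicator G τ * c s := by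
    intro τ
    have e1 : ∀ s, (Ioi s).indicator G τ * c s = G τ * (Iio τ).indicator c s := by
      intro s
      by_cases h : s < τ
      · rw [indicator_of_mem (show τ ∈ Ioi s from h), indicator_of_mem (show s ∈ Iio τ from h)]
      · rw [indicator_of_notMem (show τ ∉ Ioi s from h),
          indicator_of_notMem (show s ∉ Iio τ from h)]
        simp
    simp only [e1]
    rw [integral_const_mul, integral_indicator measurableSet_Iio]
    congr 1
    rcases le_or_gt 0 τ with h0 | h0
    · rw [intervalIntegral.integral_of_le h0, integral_Ioc_eq_integral_Ioo]
      refine setIntegral_eq_of_subset_of_forall_sdiff_eq_zero measurableSet_Iio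
        (fun x hx => hx.2) ?_ |>.symm
      intro x hx
      refine hc0 x (not_lt.1 fun h => hx.2 ⟨h, hx.1⟩)
    · rw [intervalIntegral.integral_symm, intervalIntegral.integral_of_le h0.le]
      have hz : ∫ x in Iio τ, c x = 0 :=
        setIntegral_eq_zero_of_forall_eq_zero fun x hx =>
          hc0 x (le_of_lt (lt_trans (mem_Iio.1 hx) h0))
      rw [setIntegral_eq_zero_of_forall_eq_zero fun x hx => hc0 x hx.2, hz, neg_zero]
  simp only [h1, h2]
  exact integral_integral_swap hint

lemma measurable_tail {G : Eu d × ℝ → ℝ} (hGm : Measurable G) :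
    StronglyMeasurable (fun p : Eu d × ℝ => ∫ τ in Ioi p.2, G (p.1, τ)) := by
  have h1 : ∀ p : Eu d × ℝ, ∫ τ in Ioi p.2, G (p.1, τ) =
      ∫ τ, (fun q : (Eu d × ℝ) × ℝ =>
        {q : (Eu d × ℝ) × ℝ | q.1.2 < q.2}.indicator (fun q => G (q.1.1, q.2)) q) (p, τ) := by
    intro p
    rw [← integral_indicator measurableSet_Ioi]
    congr 1
  simp only [h1]
  refine StronglyMeasurable.integral_prod_right' (Measurable.stronglyMeasurable ?_)
  refine Measurable.indicator (by fun_prop) (measurableSet_lt (by fun_prop) (by fun_prop))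

lemma norm_intervalIntegral_le_of_bounded_support {f : ℝ → ℝ} {C R : ℝ} (hR : 0 ≤ R)
    (hC : ∀ τ, ‖f τ‖ ≤ C) (hf : ∀ τ, τ ∉ Icc (-R) R → f τ = 0) (s : ℝ) :
    ‖∫ τ in (0)..s, f τ‖ ≤ C * (2 * R) := by
  rw [intervalIntegral.norm_intervalIntegral_eq]
  have hC0 : 0 ≤ C := (norm_nonneg _).trans (hC 0)
  have hi : Integrable ((Icc (-R) R).indicator fun _ => C) :=
    (integrable_indicator_iff measurableSet_Icc).2 (integrableOn_const measure_Icc_lt_top.ne)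
  refine (norm_integral_le_of_norm_le hi.integrableOn (ae_of_all _ fun τ => ?_)).trans ?_
  · by_cases h : τ ∈ Icc (-R) R
    · rw [indicator_of_mem h]; exact hC τ
    · rw [indicator_of_notMem h, hf τ h, norm_zero]
  · refine (setIntegral_le_integral hi (ae_of_all _ fun τ =>
      indicator_nonneg (fun _ _ => hC0) τ)).trans (le_of_eq ?_)
    rw [integral_indicator measurableSet_Icc, setIntegral_const, Real.volume_real_Icc_of_le
      (by linarith)]
    simp; ring

/-- The primitive of `c` in the vertical variable. -/
def vertPrim (c : Eu d × ℝ → ℝ) (p : Eu d × ℝ) : ℝ := ∫ τ in (0)..p.2, c (p.1, τ)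

lemma exists_height_bound {c : Eu d × ℝ → ℝ} (hcc : HasCompactSupport c) :
    ∃ R : ℝ, 0 ≤ R ∧ ∀ y τ, τ ∉ Icc (-R) R → c (y, τ) = 0 := by
  obtain ⟨R, hR⟩ := hcc.isCompact.isBounded.exists_norm_le
  refine ⟨max R 0, le_max_right _ _, fun y τ hτ => ?_⟩
  by_contra hne
  have h1 := hR _ (subset_tsupport _ hne)
  have h2 : |τ| ≤ R := (norm_snd_le (y, τ)).trans h1
  exact hτ (abs_le.1 (h2.trans (le_max_left _ _)))

lemma exists_bound_vertPrim {c : Eu d × ℝ → ℝ} (hc : Continuous c) (hcc : HasCompactSupport c) :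
    ∃ M : ℝ, ∀ p, ‖vertPrim c p‖ ≤ M := by
  obtain ⟨R, hR, hcR⟩ := exists_height_bound hcc
  obtain ⟨C, hC⟩ := hcc.exists_bound_of_continuous hc
  exact ⟨C * (2 * R), fun p => norm_intervalIntegral_le_of_bounded_support hR (fun τ => hC _)
    (hcR p.1) p.2⟩

lemma continuous_slice {c : Eu d × ℝ → ℝ} (hc : Continuous c) (y : Eu d) :
    Continuous fun τ => c (y, τ) :=
  hc.comp (continuous_const.prodMk continuous_id)

/-- Charts are only Lipschitz, so primitives pulled back through them serve as Lipschitz test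
functions. A vertical displacement costs the bound of `c`; a horizontal one costs its Lipschitz
constant times the height of its support. -/
lemma exists_lipschitzWith_vertPrim {c : Eu d × ℝ → ℝ} (hc : ContDiff ℝ ∞ c)
    (hcc : HasCompactSupport c) : ∃ L : ℝ≥0, LipschitzWith L (vertPrim c) := by
  obtain ⟨R, hR, hcR⟩ := exists_height_bound hcc
  obtain ⟨C, hC⟩ := hcc.exists_bound_of_continuous hc.continuous
  obtain ⟨D, hD⟩ := (hc.of_le (m := 1) (by simp)).lipschitzWith_of_hasCompactSupport hcc one_ne_zero
  have hC0 : 0 ≤ C := (norm_nonneg _).trans (hC 0)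
  refine ⟨⟨C + D * (2 * R), by positivity⟩, LipschitzWith.of_dist_le_mul fun p q => ?_⟩
  have hi : ∀ y a b, IntervalIntegrable (fun τ => c (y, τ)) volume a b := fun y a b =>
    (continuous_slice hc.continuous y).intervalIntegrable a b
  have e : vertPrim c p - vertPrim c q = (∫ τ in q.2..p.2, c (p.1, τ)) +
      ∫ τ in (0)..q.2, (c (p.1, τ) - c (q.1, τ)) := by
    rw [intervalIntegral.integral_sub (hi _ _ _) (hi _ _ _)]
    unfold vertPrim
    rw [← intervalIntegral.integral_add_adjacent_intervals (hi p.1 0 q.2) (hi p.1 q.2 p.2)]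
    ring
  rw [dist_eq_norm, e]
  refine (norm_add_le _ _).trans ?_
  have h1 : ‖∫ τ in q.2..p.2, c (p.1, τ)‖ ≤ C * dist p q := by
    refine (intervalIntegral.norm_integral_le_of_norm_le_const fun τ _ => hC _).trans ?_
    refine mul_le_mul_of_nonneg_left ?_ hC0
    rw [← Real.dist_eq, Prod.dist_eq]
    exact le_max_right _ _
  have h2 : ‖∫ τ in (0)..q.2, (c (p.1, τ) - c (q.1, τ))‖ ≤ (D * dist p q) * (2 * R) := by
    refine norm_intervalIntegral_le_of_bounded_support hR (fun τ => ?_) (fun τ hτ => ?_) _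
    · rw [← dist_eq_norm]
      refine (hD.dist_le_mul _ _).trans (mul_le_mul_of_nonneg_left ?_ D.2)
      rw [Prod.dist_eq, dist_self, max_eq_left dist_nonneg, Prod.dist_eq]
      exact le_max_left _ _
    · rw [hcR _ τ hτ, hcR _ τ hτ, sub_zero]
  change _ ≤ (C + D * (2 * R)) * dist p q
  linarith

/-- A function on the half-space whose weak vertical derivative is `-G` is the tail integral of
`G`. -/
lemma ae_eq_tail_integral {g G : Eu d × ℝ → ℝ} (hg : Integrable g) (hG : Integrable G)
    (hGm : Measurable G)
    (hW : ∀ c : Eu d × ℝ → ℝ, ContDiff ℝ ∞ c → HasCompactSupport c → tsupport c ⊆ {p | 0 < p.2} →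
      ∫ p, g p * c p = ∫ p, G p * vertPrim c p) :
    ∀ᵐ p : Eu d × ℝ, 0 < p.2 → g p = ∫ τ in Ioi p.2, G (p.1, τ) := by
  have hG' := hG
  rw [Measure.volume_eq_prod] at hG'
  set q : Eu d × ℝ → ℝ := fun p => ∫ τ in Ioi p.2, G (p.1, τ) with hq
  have hqm : StronglyMeasurable q := measurable_tail hGm
  set B : Eu d → ℝ := fun y => ∫ τ, ‖G (y, τ)‖ with hB
  have hBi : Integrable B := hG'.norm.integral_prod_left
  have hqB : ∀ᵐ p ∂((volume : Measure (Eu d)).prod (volume : Measure ℝ)), ‖q p‖ ≤ ‖B p.1‖ := by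
    filter_upwards [Measure.quasiMeasurePreserving_fst.ae hG'.prod_right_ae] with p hp
    refine ((norm_integral_le_integral_norm _).trans ?_).trans (le_abs_self _)
    exact setIntegral_le_integral hp.norm (ae_of_all _ fun _ => norm_nonneg _)
  -- The tail is dominated by `B(y)`, which does not decay in `s`; it is therefore integrable only
  -- over strips of finite height.
  have hql : LocallyIntegrable q := by
    intro p
    refine ⟨univ ×ˢ Ioo (p.2 - 1) (p.2 + 1), prod_mem_nhds univ_mem
      (Ioo_mem_nhds (by linarith) (by linarith)), ?_⟩
    have h1 : IntegrableOn (fun p : Eu d × ℝ => B p.1) (univ ×ˢ Ioo (p.2 - 1) (p.2 + 1)) := by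
      unfold IntegrableOn
      rw [Measure.volume_eq_prod, ← Measure.prod_restrict, Measure.restrict_univ]
      have : IsFiniteMeasure ((volume : Measure ℝ).restrict (Ioo (p.2 - 1) (p.2 + 1))) :=
        ⟨by simp⟩
      exact hBi.comp_fst _
    refine Integrable.mono h1 hqm.aestronglyMeasurable ?_
    exact ae_restrict_of_ae (by rw [Measure.volume_eq_prod]; exact hqB)
  have hopen : IsOpen {p : Eu d × ℝ | 0 < p.2} := isOpen_lt continuous_const continuous_snd
  have := hopen.ae_eq_zero_of_integral_contDiff_smul_eq_zero (μ := volume)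
    (f := fun p => g p - q p) ((hg.locallyIntegrable.sub hql).locallyIntegrableOn _) ?_
  · filter_upwards [this] with p hp hp0
    exact sub_eq_zero.1 (hp hp0)
  · intro c hc hcc hcs
    have hI1 : Integrable (fun p => c p • g p) :=
      hg.locallyIntegrable.integrable_smul_left_of_hasCompactSupport hc.continuous hcc
    have hI2 : Integrable (fun p => c p • q p) :=
      hql.integrable_smul_left_of_hasCompactSupport hc.continuous hcc
    simp only [smul_sub]
    rw [integral_sub hI1 hI2, sub_eq_zero]
    simp only [smul_eq_mul, mul_comm (c _)] at hI2 ⊢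
    rw [hW c hc hcc hcs]
    obtain ⟨M, hM⟩ := exists_bound_vertPrim hc.continuous hcc
    obtain ⟨L, hL⟩ := exists_lipschitzWith_vertPrim hc hcc
    have hI3 : Integrable (fun p => G p * vertPrim c p) :=
      hG.mul_bdd (c := M) hL.continuous.aestronglyMeasurable (ae_of_all _ hM)
    rw [Measure.volume_eq_prod] at hI2 hI3 ⊢
    rw [integral_prod _ hI2, integral_prod _ hI3]
    refine integral_congr_ae ?_
    filter_upwards [hG'.prod_right_ae] with y hy
    have hcl : IsClosedEmbedding (fun τ : ℝ => (y, τ)) :=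
      (Isometry.of_dist_eq fun a b => by simp [Prod.dist_eq]).isClosedEmbedding
    refine (integral_tail_mul_eq (hGm.comp measurable_prodMk_left) hy
      (continuous_slice hc.continuous y) (hcc.comp_isClosedEmbedding hcl) ?_).symm
    intro τ hτ
    have := tsupport_comp_subset_preimage c (hcl.continuous) hτ
    exact hcs this

end

end

/-! ### Boundary values of tail integrals. -/

noncomputable section

section

variable {d : ℕ}

/-- The boundary trace of the tail integral of `G`. -/
def halfTrace (G : Eu d × ℝ → ℝ) (y : Eu d) : ℝ := ∫ τ in Ioi 0, G (y, τ)

lemma integrable_halfTrace {G : Eu d × ℝ → ℝ} (hG : Integrable G) : Integrable (halfTrace G) := by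
  have h : Integrable G (volume.prod ((volume : Measure ℝ).restrict (Ioi 0))) := by
    have h1 : IntegrableOn G (univ ×ˢ Ioi 0) := hG.integrableOn
    unfold IntegrableOn at h1
    rwa [Measure.volume_eq_prod, ← Measure.prod_restrict, Measure.restrict_univ] at h1
  exact h.integral_prod_left

/-- The difference is `-∫ G(y, ·)` over `(0, s)`. Quantifying over `r` inside the a.e. statement
keeps the exceptional set independent of `r`. -/
lemma ae_enorm_sub_halfTrace_le {g G : Eu d × ℝ → ℝ} (hG : Integrable G)
    (hgG : ∀ᵐ p : Eu d × ℝ, 0 < p.2 → g p = ∫ τ in Ioi p.2, G (p.1, τ)) :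
    ∀ᵐ y : Eu d, ∀ᵐ s : ℝ, ∀ r, s ∈ Ioo 0 r →
      ‖g (y, s) - halfTrace G y‖ₑ ≤ vertMass G r y := by
  rw [Measure.volume_eq_prod] at hG hgG
  filter_upwards [Measure.ae_ae_of_ae_prod hgG, hG.prod_right_ae] with y hy hyi
  filter_upwards [hy] with s hs r hsr
  rw [hs hsr.1]
  have h1 : halfTrace G y = (∫ τ in Ioc 0 s, G (y, τ)) + ∫ τ in Ioi s, G (y, τ) := by
    rw [halfTrace, ← setIntegral_union (Ioc_disjoint_Ioi le_rfl) measurableSet_Ioi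
      hyi.integrableOn hyi.integrableOn, Ioc_union_Ioi_eq_Ioi hsr.1.le]
  rw [h1, sub_add_cancel_right, enorm_neg]
  refine (enorm_integral_le_lintegral_enorm _).trans ?_
  exact lintegral_mono_set fun τ hτ => ⟨hτ.1, hτ.2.trans_lt hsr.2⟩

/-- The density `c k` has mass one and lives at depths below `δ k`; replacing `g` by its trace there
costs at most `M ∫ vertMass G (δ k)`, which tends to zero. -/
lemma tendsto_integral_mul_halfTrace {g G : Eu d × ℝ → ℝ} (hg : Integrable g) (hG : Integrable G)
    (hGm : Measurable G)
    (hgG : ∀ᵐ p : Eu d × ℝ, 0 < p.2 → g p = ∫ τ in Ioi p.2, G (p.1, τ))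
    {m : Eu d → ℝ} (hm : Measurable m) {M : ℝ} (hM : ∀ y, ‖m y‖ ≤ M)
    {c : ℕ → ℝ → ℝ} (hc : ∀ k, Continuous (c k)) (hc0 : ∀ k s, 0 ≤ c k s)
    {δ : ℕ → ℝ} (hδ : Tendsto δ atTop (𝓝[>] 0)) (hcs : ∀ k s, s ∉ Ioo 0 (δ k) → c k s = 0)
    (hc1 : ∀ k, ∫ s, c k s = 1) :
    Tendsto (fun k => ∫ p, g p * (m p.1 * c k p.2)) atTop (𝓝 (∫ y, halfTrace G y * m y)) := by
  have hci : ∀ k, Integrable (c k) := fun k => integrable_of_integral_eq_one (hc1 k)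
  have ht := integrable_halfTrace hG
  have htm : Integrable (fun y => halfTrace G y * m y) :=
    ht.mul_bdd (c := M) hm.aestronglyMeasurable (ae_of_all _ hM)
  have hcb : ∀ k, ∃ C, ∀ s, ‖c k s‖ ≤ C := fun k =>
    (HasCompactSupport.of_support_subset_isCompact (isCompact_Icc (a := 0) (b := δ k))
      fun s hs => Ioo_subset_Icc_self (by_contra fun h => hs (hcs k s h))).exists_bound_of_continuous
      (hc k)
  have hI1 : ∀ k, Integrable (fun p : Eu d × ℝ => g p * (m p.1 * c k p.2)) := by
    intro k
    obtain ⟨C, hC⟩ := hcb k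
    refine hg.mul_bdd (c := M * C) ?_ (ae_of_all _ fun p => ?_)
    · exact ((hm.comp measurable_fst).mul ((hc k).measurable.comp measurable_snd)).aestronglyMeasurable
    · rw [norm_mul]
      exact mul_le_mul (hM _) (hC _) (norm_nonneg _) ((norm_nonneg _).trans (hM p.1))
  have hI2 : ∀ k, Integrable (fun p : Eu d × ℝ => halfTrace G p.1 * m p.1 * c k p.2) := by
    intro k
    rw [Measure.volume_eq_prod]
    exact htm.mul_prod (hci k)
  have e2 : ∀ k, ∫ p : Eu d × ℝ, halfTrace G p.1 * m p.1 * c k p.2 = ∫ y, halfTrace G y * m y := by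
    intro k
    rw [Measure.volume_eq_prod, integral_prod_mul (fun y => halfTrace G y * m y) (c k), hc1, mul_one]
  rw [tendsto_iff_norm_sub_tendsto_zero]
  have hbound : ∀ k, ‖(∫ p, g p * (m p.1 * c k p.2)) - ∫ y, halfTrace G y * m y‖ₑ ≤
      ENNReal.ofReal M * ∫⁻ y, vertMass G (δ k) y := by
    intro k
    rw [← e2 k, ← integral_sub (hI1 k) (hI2 k)]
    refine (enorm_integral_le_lintegral_enorm _).trans ?_
    rw [Measure.volume_eq_prod, lintegral_prod _ (by
      have := ((hI1 k).sub (hI2 k)).aestronglyMeasurable.enorm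
      rwa [Measure.volume_eq_prod] at this), ← lintegral_const_mul _ (measurable_vertMass hGm _)]
    refine lintegral_mono_ae ?_
    filter_upwards [ae_enorm_sub_halfTrace_le hG hgG] with y hy
    have h3 : ∫⁻ s, ENNReal.ofReal M * vertMass G (δ k) y * ENNReal.ofReal (c k s) =
        ENNReal.ofReal M * vertMass G (δ k) y := by
      rw [lintegral_const_mul _ (by have := (hc k).measurable; fun_prop),
        ← ofReal_integral_eq_lintegral_ofReal (hci k) (ae_of_all _ (hc0 k)), hc1]
      simp
    rw [← h3]
    refine lintegral_mono_ae ?_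
    filter_upwards [hy] with s hs
    by_cases hsm : s ∈ Ioo 0 (δ k)
    · have h4 : g (y, s) * (m y * c k s) - halfTrace G y * m y * c k s =
        m y * (g (y, s) - halfTrace G y) * c k s := by ring
      simp only [h4, enorm_mul]
      refine mul_le_mul' (mul_le_mul' ?_ (hs _ hsm)) ?_
      · rw [← ofReal_norm]; exact ENNReal.ofReal_le_ofReal (hM y)
      · rw [Real.enorm_of_nonneg (hc0 k s)]
    · simp [hcs k s hsm]
  have hlim : Tendsto (fun k => ENNReal.ofReal M * ∫⁻ y, vertMass G (δ k) y) atTop (𝓝 0) := by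
    have := ENNReal.Tendsto.const_mul (tendsto_lintegral_vertMass hGm hG hδ)
      (Or.inr (ENNReal.ofReal_ne_top (r := M)))
    simpa using this
  have h5 := tendsto_of_tendsto_of_tendsto_of_le_of_le tendsto_const_nhds hlim
    (fun k => zero_le) hbound
  have h6 := (ENNReal.tendsto_toReal ENNReal.zero_ne_top).comp h5
  simpa [Function.comp_def] using h6

lemma volume_closedBall_eq (y : Eu d) {r : ℝ} (hr : 0 ≤ r) :
    volume (Metric.closedBall y r) =
      ENNReal.ofReal r ^ d * volume (Metric.ball (0 : Eu d) 1) := by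
  rw [Measure.addHaar_closedBall volume y hr, ENNReal.ofReal_pow hr]
  simp

/-- At almost every boundary point the averages of `|g - t(y)|` over small half-cylinders tend
to zero. -/
lemma ae_tendsto_lintegral_cylinder {g G : Eu d × ℝ → ℝ} (hg : Integrable g) (hG : Integrable G)
    (hGm : Measurable G)
    (hgG : ∀ᵐ p : Eu d × ℝ, 0 < p.2 → g p = ∫ τ in Ioi p.2, G (p.1, τ)) :
    ∀ᵐ y : Eu d, Tendsto (fun r : ℝ => (∫⁻ p in Metric.closedBall y r ×ˢ Ioo 0 r,
      ‖g p - halfTrace G y‖ₑ) / ENNReal.ofReal r ^ (d + 1)) (𝓝[>] 0) (𝓝 0) := by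
  have hG' := hG
  rw [Measure.volume_eq_prod] at hG'
  have ht := integrable_halfTrace hG
  have hfin : ∀ r, ∫⁻ y, vertMass G r y ≠ ⊤ := fun r =>
    ((lintegral_vertMass_le hGm r).trans_lt hG.2).ne
  -- Lebesgue differentiation is applied only to the countably many heights `1 / (k + 1)`, since the
  -- null set may depend on the function; monotonicity of `vertMass` in the height covers the
  -- remaining radii.
  have hL1 : ∀ᵐ y : Eu d, ∀ k : ℕ, Tendsto (fun r : ℝ =>
      (∫⁻ z in Metric.closedBall y r, vertMass G (1 / ((k : ℝ) + 1)) z) /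
        volume (Metric.closedBall y r)) (𝓝[>] 0) (𝓝 (vertMass G (1 / ((k : ℝ) + 1)) y)) := by
    rw [ae_all_iff]
    intro k
    filter_upwards [(Besicovitch.vitaliFamily (volume : Measure (Eu d))).ae_tendsto_lintegral_div
      (measurable_vertMass hGm _).aemeasurable (hfin (1 / ((k : ℝ) + 1)))] with y hy
    exact hy.comp (Besicovitch.tendsto_filterAt volume y)
  filter_upwards [hL1, hG'.prod_right_ae, (Besicovitch.vitaliFamily
    (volume : Measure (Eu d))).ae_tendsto_lintegral_enorm_sub_div ht.locallyIntegrable]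
    with y hy1 hyi hy2
  have hy2' := hy2.comp (Besicovitch.tendsto_filterAt volume y)
  set κ := volume (Metric.ball (0 : Eu d) 1) with hκ
  have hκ0 : κ ≠ 0 := (Metric.measure_ball_pos volume _ one_pos).ne'
  have hκt : κ ≠ ⊤ := measure_ball_lt_top.ne
  -- The deviation splits into a vertical part `g(z, s) - t(z)`, controlled by `vertMass`, and a
  -- horizontal part `t(z) - t(y)`, controlled at Lebesgue points of the trace `t`. The factor `κ`
  -- converts `r ^ d` into the volume of the base ball.
  have hkey : ∀ r, 0 < r → (∫⁻ p in Metric.closedBall y r ×ˢ Ioo 0 r,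
      ‖g p - halfTrace G y‖ₑ) / ENNReal.ofReal r ^ (d + 1) ≤
      κ * ((∫⁻ z in Metric.closedBall y r, vertMass G r z) / volume (Metric.closedBall y r) +
        (∫⁻ z in Metric.closedBall y r, ‖halfTrace G z - halfTrace G y‖ₑ) /
          volume (Metric.closedBall y r)) := by
    intro r hr
    set R := ENNReal.ofReal r with hR
    have hR0 : R ≠ 0 := by simpa [hR] using hr
    have hRt : R ≠ ⊤ := ENNReal.ofReal_ne_top
    have h1 : ∫⁻ p in Metric.closedBall y r ×ˢ Ioo 0 r, ‖g p - halfTrace G y‖ₑ ≤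
        R * ((∫⁻ z in Metric.closedBall y r, vertMass G r z) +
          ∫⁻ z in Metric.closedBall y r, ‖halfTrace G z - halfTrace G y‖ₑ) := by
      rw [Measure.volume_eq_prod, ← Measure.prod_restrict, lintegral_prod]
      · rw [← lintegral_add_left (measurable_vertMass hGm r),
          ← lintegral_const_mul' _ _ hRt]
        refine lintegral_mono_ae (ae_restrict_of_ae ?_)
        filter_upwards [ae_enorm_sub_halfTrace_le hG hgG] with z hz
        have h2 : ∫⁻ _ in Ioo 0 r, (vertMass G r z + ‖halfTrace G z - halfTrace G y‖ₑ) =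
            R * (vertMass G r z + ‖halfTrace G z - halfTrace G y‖ₑ) := by
          rw [setLIntegral_const, Real.volume_Ioo, sub_zero, mul_comm]
        rw [← h2]
        refine setLIntegral_mono_ae' measurableSet_Ioo ?_
        filter_upwards [hz] with s hs hsr
        have h3 : g (z, s) - halfTrace G y =
          (g (z, s) - halfTrace G z) + (halfTrace G z - halfTrace G y) := by ring
        simp only [h3]
        exact (enorm_add_le _ _).trans (add_le_add_left (hs r hsr) _)
      · rw [Measure.prod_restrict]
        have := (hg.aestronglyMeasurable.sub
          (aestronglyMeasurable_const (b := halfTrace G y))).enorm.restrict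
          (s := Metric.closedBall y r ×ˢ Ioo 0 r)
        rwa [Measure.volume_eq_prod] at this
    rw [volume_closedBall_eq y hr.le, ← hR, ← hκ]
    rw [← ENNReal.add_div]
    refine (ENNReal.div_le_div_right h1 _).trans (le_of_eq ?_)
    set S := (∫⁻ z in Metric.closedBall y r, vertMass G r z) +
          ∫⁻ z in Metric.closedBall y r, ‖halfTrace G z - halfTrace G y‖ₑ
    rw [pow_succ, mul_comm R S, ENNReal.mul_div_mul_right _ _ hR0 hRt, mul_comm (R ^ d) κ,
      ← mul_div_assoc, ENNReal.mul_div_mul_left _ _ hκ0 hκt]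
  -- Fix a height whose `vertMass` at `y` is below `ε`. For smaller `r` the average is at most the
  -- average for that height, which converges to its value at `y`.
  have hA : Tendsto (fun r => (∫⁻ z in Metric.closedBall y r, vertMass G r z) /
      volume (Metric.closedBall y r)) (𝓝[>] 0) (𝓝 0) := by
    rw [ENNReal.tendsto_nhds_zero]
    intro ε hε
    have hz : Tendsto (fun k : ℕ => vertMass G (1 / ((k : ℝ) + 1)) y) atTop (𝓝 0) := by
      refine (tendsto_vertMass hyi).comp (tendsto_nhdsWithin_iff.2
        ⟨tendsto_one_div_add_atTop_nhds_zero_nat, Eventually.of_forall fun k => ?_⟩)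
      exact mem_Ioi.2 (by positivity)
    obtain ⟨k, hk⟩ := ((tendsto_order.1 hz).2 ε hε).exists
    have hk0 : (0 : ℝ) < 1 / ((k : ℝ) + 1) := by positivity
    filter_upwards [(tendsto_order.1 (hy1 k)).2 ε hk, Ioo_mem_nhdsGT hk0] with r hr hrk
    refine le_trans (ENNReal.div_le_div_right (lintegral_mono fun z => ?_) _) hr.le
    exact vertMass_mono G hrk.2.le z
  have hB : Tendsto (fun r => κ * ((∫⁻ z in Metric.closedBall y r, vertMass G r z) /
      volume (Metric.closedBall y r) +
        (∫⁻ z in Metric.closedBall y r, ‖halfTrace G z - halfTrace G y‖ₑ) /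
          volume (Metric.closedBall y r))) (𝓝[>] 0) (𝓝 0) := by
    have := ENNReal.Tendsto.const_mul (hA.add hy2') (Or.inr hκt)
    simpa using this
  refine tendsto_of_tendsto_of_tendsto_of_le_of_le' tendsto_const_nhds hB
    (Eventually.of_forall fun r => zero_le) ?_
  filter_upwards [self_mem_nhdsWithin] with r hr
  exact hkey r hr

end

end

noncomputable section

/-! ### Boundary charts -/

section

variable {n d : ℕ}

/-- The chart `(y, s) ↦ T⁻¹ (y, f y - s)` flattening the graph of `f`. -/
def chartHomeo (T : Eu n ≃ₗᵢ[ℝ] WithLp 2 (Eu d × ℝ)) {f : Eu d → ℝ} (hf : Continuous f) :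
    Eu d × ℝ ≃ₜ Eu n where
  toFun p := T.symm (WithLp.toLp 2 (p.1, f p.1 - p.2))
  invFun x := ((T x).fst, f (T x).fst - (T x).snd)
  left_inv p := by simp
  right_inv x := by
    simp only [sub_sub_cancel]
    exact T.symm_apply_apply x
  continuous_toFun := by
    refine T.symm.continuous.comp ((WithLp.prod_continuous_toLp 2 _ _).comp ?_)
    exact continuous_fst.prodMk ((hf.comp continuous_fst).sub continuous_snd)
  continuous_invFun := by
    have h := (WithLp.prod_continuous_ofLp 2 (Eu d) ℝ).comp T.continuous
    have h1 : Continuous fun x => (T x).fst := continuous_fst.comp h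
    have h2 : Continuous fun x => (T x).snd := continuous_snd.comp h
    exact h1.prodMk ((hf.comp h1).sub h2)

variable (T : Eu n ≃ₗᵢ[ℝ] WithLp 2 (Eu d × ℝ)) {f : Eu d → ℝ} {K : ℝ≥0}

lemma chartHomeo_apply (hf : Continuous f) (p : Eu d × ℝ) :
    chartHomeo T hf p = T.symm (WithLp.toLp 2 (p.1, f p.1 - p.2)) := rfl

lemma chartHomeo_symm_apply (hf : Continuous f) (x : Eu n) :
    (chartHomeo T hf).symm x = ((T x).fst, f (T x).fst - (T x).snd) := rfl

/-- On each vertical line the chart is a reflection followed by a translation, and `T` is an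
isometry; no regularity of `f` beyond continuity enters. -/
lemma measurePreserving_chartHomeo (hf : Continuous f) :
    MeasurePreserving (chartHomeo T hf) := by
  have h1 : MeasurePreserving (fun p : Eu d × ℝ => (p.1, f p.1 - p.2)) := by
    rw [Measure.volume_eq_prod]
    refine MeasurePreserving.skew_product (g := fun y s => f y - s) (MeasurePreserving.id _) ?_ ?_
    · exact ((hf.comp continuous_fst).sub continuous_snd).measurable
    · exact ae_of_all _ fun y => (Measure.measurePreserving_sub_left volume (f y)).map_eq
  exact T.symm.measurePreserving.comp ((WithLp.volume_preserving_toLp (Eu d) ℝ).comp h1)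

lemma measurePreserving_chartHomeo_symm (hf : Continuous f) :
    MeasurePreserving (chartHomeo T hf).symm :=
  MeasurePreserving.symm (chartHomeo T hf).toMeasurableEquiv (measurePreserving_chartHomeo T hf)

lemma norm_fst_chart_le (x : Eu n) : ‖(T x).fst‖ ≤ ‖x‖ := by
  simpa using norm_fst_le_withLp (T x)

lemma abs_snd_chart_le (x : Eu n) : |(T x).snd| ≤ ‖x‖ := by
  simpa using abs_snd_le_withLp (T x)

lemma lipschitzWith_chartHomeo_symm (hf : LipschitzWith K f) :
    LipschitzWith (K + 1) (chartHomeo T hf.continuous).symm := by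
  refine LipschitzWith.of_dist_le_mul fun x y => ?_
  rw [chartHomeo_symm_apply, chartHomeo_symm_apply, Prod.dist_eq]
  have h1 : dist (T x).fst (T y).fst ≤ dist x y := by
    rw [dist_eq_norm, dist_eq_norm]
    have := norm_fst_chart_le T (x - y)
    rwa [map_sub] at this
  have h2 : |(T x).snd - (T y).snd| ≤ dist x y := by
    rw [dist_eq_norm]
    have := abs_snd_chart_le T (x - y)
    rwa [map_sub] at this
  have h3 := hf.dist_le_mul (T x).fst (T y).fst
  have h4 : (K : ℝ) * dist (T x).fst (T y).fst ≤ K * dist x y :=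
    mul_le_mul_of_nonneg_left h1 K.2
  push_cast
  have h5 : 0 ≤ (K : ℝ) * dist x y := by positivity
  refine max_le (by linarith) ?_
  rw [Real.dist_eq] at h3 ⊢
  have : f (T x).fst - (T x).snd - (f (T y).fst - (T y).snd) =
    (f (T x).fst - f (T y).fst) - ((T x).snd - (T y).snd) := by ring
  rw [this]
  refine (abs_sub _ _).trans ?_
  linarith

lemma dist_chartHomeo_le (hf : LipschitzWith K f) (y : Eu d) (p : Eu d × ℝ) :
    dist (chartHomeo T hf.continuous p) (chartHomeo T hf.continuous (y, 0)) ≤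
      (1 + K) * dist p.1 y + |p.2| := by
  rw [chartHomeo_apply, chartHomeo_apply, T.symm.dist_map, dist_eq_norm]
  refine (norm_withLp_le_add _).trans ?_
  change ‖p.1 - y‖ + |f p.1 - p.2 - (f y - 0)| ≤ _
  have h3 := hf.dist_le_mul p.1 y
  rw [Real.dist_eq] at h3
  rw [← dist_eq_norm]
  have : f p.1 - p.2 - (f y - 0) = (f p.1 - f y) - p.2 := by ring
  rw [this]
  have := abs_sub (f p.1 - f y) p.2
  linarith

lemma ae_differentiableAt_chart (hf : LipschitzWith K f) :
    ∀ᵐ x : Eu n, DifferentiableAt ℝ f (T x).fst := by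
  have h1 : ∀ᵐ p : Eu d × ℝ, DifferentiableAt ℝ f p.1 := by
    rw [Measure.volume_eq_prod]
    exact Measure.quasiMeasurePreserving_fst.ae hf.ae_differentiableAt
  exact (measurePreserving_chartHomeo_symm T hf.continuous).quasiMeasurePreserving.ae h1

/-- The height of `x` below the graph has the expected line derivatives. -/
lemma hasLineDerivAt_height {x : Eu n} (hx : DifferentiableAt ℝ f (T x).fst) (v : Eu n) :
    HasLineDerivAt ℝ (fun x => f (T x).fst - (T x).snd)
      (fderiv ℝ f (T x).fst (T v).fst - (T v).snd) x v := by
  let P : Eu n →L[ℝ] Eu d × ℝ :=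
    (WithLp.prodContinuousLinearEquiv 2 ℝ (Eu d) ℝ : WithLp 2 (Eu d × ℝ) →L[ℝ] Eu d × ℝ) ∘L
      (T.toContinuousLinearEquiv : Eu n →L[ℝ] WithLp 2 (Eu d × ℝ))
  let P1 : Eu n →L[ℝ] Eu d := (ContinuousLinearMap.fst ℝ (Eu d) ℝ) ∘L P
  let P2 : Eu n →L[ℝ] ℝ := (ContinuousLinearMap.snd ℝ (Eu d) ℝ) ∘L P
  have h1 : HasFDerivAt (fun x => f (T x).fst) ((fderiv ℝ f (T x).fst) ∘L P1) x :=
    HasFDerivAt.comp x (f := P1) hx.hasFDerivAt P1.hasFDerivAt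
  have h2 : HasFDerivAt (fun x => (T x).snd) P2 x := P2.hasFDerivAt
  exact (h1.sub h2).hasLineDerivAt v

lemma LipschitzWith.mul_of_bounded {α : Type*} [PseudoMetricSpace α] {a b : α → ℝ} {L M : ℝ≥0}
    (ha : LipschitzWith L a) (hb : LipschitzWith M b) {A B : ℝ} (hA : ∀ x, ‖a x‖ ≤ A)
    (hB : ∀ x, ‖b x‖ ≤ B) : ∃ N : ℝ≥0, LipschitzWith N (fun x => a x * b x) := by
  rcases isEmpty_or_nonempty α with h | ⟨⟨x₀⟩⟩
  · exact ⟨0, fun x => isEmptyElim x⟩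
  have hA0 : 0 ≤ A := (norm_nonneg _).trans (hA x₀)
  have hB0 : 0 ≤ B := (norm_nonneg _).trans (hB x₀)
  refine ⟨⟨A * M + B * L, by positivity⟩, LipschitzWith.of_dist_le_mul fun x y => ?_⟩
  have h1 := ha.dist_le_mul x y
  have h2 := hb.dist_le_mul x y
  rw [Real.dist_eq, ← Real.norm_eq_abs] at *
  have : a x * b x - a y * b y = a x * (b x - b y) + b y * (a x - a y) := by ring
  rw [this]
  refine (norm_add_le _ _).trans ?_
  rw [norm_mul, norm_mul]
  have h3 := mul_le_mul (hA x) h2 (norm_nonneg _) hA0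
  have h4 := mul_le_mul (hB y) h1 (norm_nonneg _) hB0
  change _ ≤ (A * M + B * L) * dist x y
  linarith

/-- Testing a weak derivative against `φ · β`, where `φ` is a cutoff in a boundary chart and `β`
vanishes near the graph. -/
lemma HasWeakDir.integral_chart_eq {Ω U : Set (Eu n)} (hΩ : IsOpen Ω)
    (hf : LipschitzWith K f)
    (hU : ∀ y ∈ U, y ∈ Ω ↔ (T y).snd < f (T y).fst)
    {w G : Eu n → ℝ} {v : Eu n} (h : HasWeakDir Ω v w G) (hw : IntegrableOn w Ω)
    (hG : IntegrableOn G Ω) {φ : Eu n → ℝ} {L : ℝ≥0} (hφ : LipschitzWith L φ)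
    (hφc : HasCompactSupport φ) (hφU : tsupport φ ⊆ U)
    {β : Eu d × ℝ → ℝ} {M : ℝ≥0} (hβ : LipschitzWith M β) {B : ℝ} (hB : ∀ p, ‖β p‖ ≤ B)
    {ε : ℝ} (hε : 0 < ε) (hβε : ∀ p : Eu d × ℝ, p.2 < ε → β p = 0) {D : Eu n → ℝ}
    (hD : ∀ᵐ x, HasLineDerivAt ℝ (fun x => β ((chartHomeo T hf.continuous).symm x)) (D x) x v) :
    ∫ x in Ω, φ x * w x * D x =
      -∫ x in Ω, (φ x * G x + w x * fderiv ℝ φ x v) * β ((chartHomeo T hf.continuous).symm x) := by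
  set ξ := (chartHomeo T hf.continuous).symm with hξ
  have hξl : LipschitzWith (K + 1) ξ := lipschitzWith_chartHomeo_symm T hf
  have hβξ : LipschitzWith (M * (K + 1)) (fun x => β (ξ x)) := hβ.comp hξl
  obtain ⟨C, hC⟩ := hφc.exists_bound_of_continuous hφ.continuous
  obtain ⟨N, hN⟩ := hφ.mul_of_bounded hβξ hC (fun x => hB (ξ x))
  -- The support lies in the region where the chart describes `Ω`, at depth at least `ε`, hence
  -- inside `Ω`.
  have hsup : tsupport (fun x => φ x * β (ξ x)) ⊆ tsupport φ ∩ {x | ε ≤ (ξ x).2} := by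
    refine closure_minimal ?_ ((isClosed_tsupport φ).inter
      (isClosed_le continuous_const (continuous_snd.comp ξ.continuous)))
    intro x hx
    refine ⟨subset_tsupport _ fun h0 => hx (by simp [h0]), ?_⟩
    by_contra hlt
    exact hx (by simp [hβε (ξ x) (not_le.1 hlt)])
  have hcs : HasCompactSupport (fun x => φ x * β (ξ x)) := hφc.mul_right
  have hsΩ : tsupport (fun x => φ x * β (ξ x)) ⊆ Ω := by
    intro x hx
    obtain ⟨h1, h2⟩ := hsup hx
    rw [hU x (hφU h1)]
    have : ε ≤ f (T x).fst - (T x).snd := h2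
    linarith
  have key := h.integral_lipschitz_eq hΩ hN hcs hsΩ
  rw [← setIntegral_smul_eq_integral_of_tsupport_subset hsΩ,
    ← setIntegral_smul_eq_integral_of_tsupport_subset
      ((tsupport_fderiv_apply_subset ℝ v).trans hsΩ)] at key
  simp only [smul_eq_mul] at key
  -- Only a line derivative of `β ∘ ξ` is known. The product rule is therefore applied to line
  -- derivatives, and the result is the Fréchet derivative wherever the Lipschitz product is
  -- differentiable.
  have hder : ∀ᵐ x, fderiv ℝ (fun x => φ x * β (ξ x)) x v =
      fderiv ℝ φ x v * β (ξ x) + φ x * D x := by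
    filter_upwards [hN.ae_differentiableAt, hφ.ae_differentiableAt, hD] with x h1 h2 h3
    rw [← h1.lineDeriv_eq_fderiv]
    have h4 := (h2.hasFDerivAt.hasLineDerivAt v)
    have h5 : HasLineDerivAt ℝ (fun x => φ x * β (ξ x)) _ x v := HasDerivAt.mul h4 h3
    rw [h5.lineDeriv]
    simp
  have hDm : AEStronglyMeasurable D := by
    have h1 : Measurable (fun x => lineDeriv ℝ (fun x => β (ξ x)) x v) :=
      measurable_lineDeriv hβξ.continuous
    refine h1.aestronglyMeasurable.congr ?_
    filter_upwards [hD] with x hx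
    exact hx.lineDeriv
  have hDb : ∀ᵐ x, ‖D x‖ ≤ (M * (K + 1) : ℝ≥0) * ‖v‖ := by
    filter_upwards [hD] with x hx
    rw [← hx.lineDeriv]
    exact norm_lineDeriv_le_of_lipschitz ℝ hβξ
  have hφm : AEStronglyMeasurable φ (volume.restrict Ω) := hφ.continuous.aestronglyMeasurable
  have hβm : AEStronglyMeasurable (fun x => β (ξ x)) (volume.restrict Ω) :=
    hβξ.continuous.aestronglyMeasurable
  have hdm : AEStronglyMeasurable (fun x => fderiv ℝ φ x v) (volume.restrict Ω) :=
    (measurable_fderiv_apply_const ℝ φ v).aestronglyMeasurable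
  have hdb : ∀ x, ‖fderiv ℝ φ x v‖ ≤ L * ‖v‖ := fun x =>
    ((fderiv ℝ φ x).le_opNorm v).trans (mul_le_mul_of_nonneg_right
      (norm_fderiv_le_of_lipschitz ℝ hφ) (norm_nonneg _))
  have I1 : IntegrableOn (fun x => φ x * w x * D x) Ω := by
    have : IntegrableOn (fun x => φ x * w x) Ω := hw.bdd_mul (c := C) hφm (ae_of_all _ hC)
    exact Integrable.mul_bdd this (hDm.restrict) (ae_restrict_of_ae hDb)
  have I2 : IntegrableOn (fun x => fderiv ℝ φ x v * β (ξ x) * w x) Ω := by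
    have : IntegrableOn (fun x => β (ξ x) * w x) Ω :=
      hw.bdd_mul (c := B) hβm (ae_of_all _ fun x => hB _)
    have := Integrable.bdd_mul this hdm (ae_of_all _ hdb)
    simp only [mul_assoc]
    exact this
  have I3 : IntegrableOn (fun x => φ x * β (ξ x) * G x) Ω := by
    have : IntegrableOn (fun x => β (ξ x) * G x) Ω :=
      hG.bdd_mul (c := B) hβm (ae_of_all _ fun x => hB _)
    have := Integrable.bdd_mul (c := C) this hφm (ae_of_all _ hC)
    simp only [mul_assoc]
    exact this
  have e1 : ∫ x in Ω, fderiv ℝ (fun x => φ x * β (ξ x)) x v * w x =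
      (∫ x in Ω, φ x * w x * D x) + ∫ x in Ω, fderiv ℝ φ x v * β (ξ x) * w x := by
    rw [← integral_add I1 I2]
    refine integral_congr_ae (ae_restrict_of_ae ?_)
    filter_upwards [hder] with x hx
    rw [hx]; ring
  have e2 : ∫ x in Ω, (φ x * G x + w x * fderiv ℝ φ x v) * β (ξ x) =
      (∫ x in Ω, φ x * β (ξ x) * G x) + ∫ x in Ω, fderiv ℝ φ x v * β (ξ x) * w x := by
    rw [← integral_add I3 I2]
    congr 1
    ext x
    ring
  rw [e2]
  rw [e1] at key
  linarith

end

end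

/-! ### Pullback to a chart and test functions of the depth. -/

noncomputable section

section

variable {n d : ℕ} (T : Eu n ≃ₗᵢ[ℝ] WithLp 2 (Eu d × ℝ)) {f : Eu d → ℝ} {K : ℝ≥0}

/-- The extension by zero of `F` from `Ω`, in the coordinates of a chart. -/
def chartPull (hf : Continuous f) (Ω : Set (Eu n)) (F : Eu n → ℝ) (p : Eu d × ℝ) : ℝ :=
  Ω.indicator F (chartHomeo T hf p)

lemma integrable_chartPull (hf : Continuous f) {Ω : Set (Eu n)} (hΩ : IsOpen Ω) {F : Eu n → ℝ}
    (hF : IntegrableOn F Ω) : Integrable (chartPull T hf Ω F) :=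
  (measurePreserving_chartHomeo T hf).integrable_comp_of_integrable
    (hF.integrable_indicator hΩ.measurableSet)

lemma integral_chartPull_mul (hf : Continuous f) {Ω : Set (Eu n)} (hΩ : IsOpen Ω) (F : Eu n → ℝ)
    (b : Eu d × ℝ → ℝ) :
    ∫ p, chartPull T hf Ω F p * b p = ∫ x in Ω, F x * b ((chartHomeo T hf).symm x) := by
  rw [← integral_indicator hΩ.measurableSet,
    ← (measurePreserving_chartHomeo T hf).integral_comp (chartHomeo T hf).measurableEmbedding]
  congr 1
  ext p
  unfold chartPull
  by_cases hp : chartHomeo T hf p ∈ Ω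
  · simp [indicator_of_mem hp]
  · simp [indicator_of_notMem hp]

lemma exists_pos_forall_lt_eq_zero {c : Eu d × ℝ → ℝ} (hcc : HasCompactSupport c)
    (hs : tsupport c ⊆ {p | 0 < p.2}) : ∃ ε > 0, ∀ p : Eu d × ℝ, p.2 < ε → c p = 0 := by
  rcases (tsupport c).eq_empty_or_nonempty with he | hne
  · exact ⟨1, one_pos, fun p _ => image_eq_zero_of_notMem_tsupport (by simp [he])⟩
  · obtain ⟨q, hq, hqm⟩ := hcc.isCompact.exists_isMinOn hne continuous_snd.continuousOn
    refine ⟨q.2, hs hq, fun p hp => image_eq_zero_of_notMem_tsupport fun h => ?_⟩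
    exact absurd (hqm h) (not_le.2 hp)

lemma vertPrim_eq_zero {c : Eu d × ℝ → ℝ} {ε : ℝ} (hε : 0 < ε)
    (hc : ∀ p : Eu d × ℝ, p.2 < ε → c p = 0) (p : Eu d × ℝ) (hp : p.2 < ε) : vertPrim c p = 0 := by
  unfold vertPrim
  refine intervalIntegral.integral_zero_ae (ae_of_all _ fun τ hτ => hc _ ?_)
  exact (hτ.2.trans_lt (max_lt hε hp))

/-- The unit vector pointing across the graph in a chart. -/
def chartVert : Eu n := T.symm (WithLp.toLp 2 ((0 : Eu d), (1 : ℝ)))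

/-- Moving along `chartVert T` leaves the base point fixed and decreases the depth at unit speed;
hence the minus sign. -/
lemma hasLineDerivAt_vertPrim (hf : Continuous f) {c : Eu d × ℝ → ℝ} (hc : Continuous c)
    (x : Eu n) :
    HasLineDerivAt ℝ (fun x => vertPrim c ((chartHomeo T hf).symm x))
      (-c ((chartHomeo T hf).symm x)) x (chartVert T) := by
  unfold HasLineDerivAt
  have h1 : ∀ t : ℝ, (chartHomeo T hf).symm (x + t • chartVert T) =
      (((chartHomeo T hf).symm x).1, ((chartHomeo T hf).symm x).2 - t) := by
    intro t
    rw [chartHomeo_symm_apply, chartHomeo_symm_apply]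
    have : T (x + t • chartVert T) = T x + t • WithLp.toLp 2 ((0 : Eu d), (1 : ℝ)) := by
      rw [map_add, map_smul, chartVert, T.apply_symm_apply]
    rw [this]
    ext1
    · simp
    · simp; ring
  simp only [h1]
  set q := (chartHomeo T hf).symm x
  have h2 : HasDerivAt (fun s => ∫ τ in (0)..s, c (q.1, τ)) (c (q.1, q.2 - 0)) (q.2 - 0) :=
    intervalIntegral.integral_hasDerivAt_right ((continuous_slice hc q.1).intervalIntegrable _ _)
      ((continuous_slice hc q.1).stronglyMeasurableAtFilter _ _)
      (continuous_slice hc q.1).continuousAt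
  have h3 : HasDerivAt (fun t : ℝ => q.2 - t) (-1) 0 := by
    simpa using (hasDerivAt_id (0 : ℝ)).const_sub q.2
  have h4 := HasDerivAt.comp (0 : ℝ) h2 h3
  rw [mul_neg, mul_one, sub_zero] at h4
  exact h4

/-- A smooth probability density concentrated on `(0, 3 / (k + 1))`. -/
def heightBump (k : ℕ) : ContDiffBump (3 / (2 * ((k : ℝ) + 1))) where
  rIn := 1 / (2 * ((k : ℝ) + 1))
  rOut := 1 / ((k : ℝ) + 1)
  rIn_pos := by positivity
  rIn_lt_rOut := by
    rw [one_div_lt_one_div (by positivity) (by positivity)]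
    have : (0 : ℝ) ≤ k := k.cast_nonneg
    linarith

/-- In units of `1 / (k + 1)` the bump has centre `3/2` and radius `1`, so it lives on `(1/2, 5/2)`.
The positive lower end keeps the test functions away from the graph; the upper end is rounded up to
`3`. -/
lemma heightBump_eq_zero (k : ℕ) (s : ℝ)
    (hs : s ∉ Ioo (1 / (2 * ((k : ℝ) + 1))) (3 / ((k : ℝ) + 1))) :
    (heightBump k).normed volume s = 0 := by
  rw [← Function.notMem_support, (heightBump k).support_normed_eq]
  intro h
  apply hs
  rw [Real.ball_eq_Ioo] at h
  have hk : (0 : ℝ) < (k : ℝ) + 1 := by positivity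
  change s ∈ Ioo (3 / (2 * ((k : ℝ) + 1)) - 1 / ((k : ℝ) + 1))
    (3 / (2 * ((k : ℝ) + 1)) + 1 / ((k : ℝ) + 1)) at h
  have e1 : 3 / (2 * ((k : ℝ) + 1)) - 1 / ((k : ℝ) + 1) = 1 / (2 * ((k : ℝ) + 1)) := by
    field_simp; norm_num
  have e2 : 3 / (2 * ((k : ℝ) + 1)) + 1 / ((k : ℝ) + 1) ≤ 3 / ((k : ℝ) + 1) := by
    have : 3 / ((k : ℝ) + 1) - (3 / (2 * ((k : ℝ) + 1)) + 1 / ((k : ℝ) + 1)) =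
      1 / (2 * ((k : ℝ) + 1)) := by field_simp; norm_num
    have h0 : 0 ≤ 1 / (2 * ((k : ℝ) + 1)) := by positivity
    linarith
  rw [e1] at h
  exact ⟨h.1, h.2.trans_le e2⟩

/-- The primitive of the density `heightBump k`. -/
def heightStep (k : ℕ) (s : ℝ) : ℝ := ∫ τ in (0)..s, (heightBump k).normed volume τ

lemma hasDerivAt_heightStep (k : ℕ) (s : ℝ) :
    HasDerivAt (heightStep k) ((heightBump k).normed volume s) s := by
  have hc : Continuous ((heightBump k).normed (volume : Measure ℝ)) :=
    (heightBump k).continuous_normed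
  exact intervalIntegral.integral_hasDerivAt_right (hc.intervalIntegrable _ _)
      (hc.stronglyMeasurableAtFilter _ _) hc.continuousAt

lemma exists_lipschitzWith_heightStep (k : ℕ) : ∃ M : ℝ≥0, LipschitzWith M (heightStep k) := by
  have hc : Continuous ((heightBump k).normed (volume : Measure ℝ)) :=
    (heightBump k).continuous_normed
  obtain ⟨C, hC⟩ := (heightBump k).hasCompactSupport_normed (μ := (volume : Measure ℝ))
    |>.exists_bound_of_continuous hc
  refine ⟨⟨C, (norm_nonneg _).trans (hC 0)⟩,
    lipschitzWith_of_nnnorm_deriv_le (fun s => (hasDerivAt_heightStep k s).differentiableAt)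
      fun s => ?_⟩
  rw [(hasDerivAt_heightStep k s).deriv]
  exact hC s

lemma heightStep_eq_zero (k : ℕ) {s : ℝ} (hs : s < 1 / (2 * ((k : ℝ) + 1))) :
    heightStep k s = 0 := by
  unfold heightStep
  refine intervalIntegral.integral_zero_ae (ae_of_all _ fun τ hτ => heightBump_eq_zero k τ ?_)
  have : (0 : ℝ) < 1 / (2 * ((k : ℝ) + 1)) := by positivity
  exact fun h => absurd (hτ.2.trans_lt (max_lt this hs)) (not_lt.2 h.1.le)

lemma heightStep_eq_one (k : ℕ) {s : ℝ} (hs : 3 / ((k : ℝ) + 1) ≤ s) : heightStep k s = 1 := by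
  have h0 : (0 : ℝ) < 3 / ((k : ℝ) + 1) := by positivity
  have h1 : (0 : ℝ) < 1 / (2 * ((k : ℝ) + 1)) := by positivity
  rw [heightStep, intervalIntegral.integral_of_le (h0.le.trans hs)]
  refine Eq.trans (setIntegral_eq_integral_of_forall_compl_eq_zero fun τ hτ => ?_)
    ((heightBump k).integral_normed (μ := (volume : Measure ℝ)))
  refine heightBump_eq_zero k τ fun h => hτ ⟨h1.trans h.1, h.2.le.trans hs⟩

lemma norm_heightStep_le (k : ℕ) (s : ℝ) : ‖heightStep k s‖ ≤ 1 := by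
  rcases le_or_gt s 0 with hs | hs
  · have h1 : (0 : ℝ) < 1 / (2 * ((k : ℝ) + 1)) := by positivity
    rw [heightStep_eq_zero k (hs.trans_lt h1)]
    simp
  · have hi : Integrable ((heightBump k).normed (volume : Measure ℝ)) :=
      (heightBump k).integrable_normed
    have hn : ∀ᵐ τ, 0 ≤ (heightBump k).normed (volume : Measure ℝ) τ :=
      ae_of_all _ fun τ => (heightBump k).nonneg_normed τ
    rw [heightStep, intervalIntegral.integral_of_le hs.le,
      Real.norm_of_nonneg (integral_nonneg_of_ae (ae_restrict_of_ae hn))]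
    exact (setIntegral_le_integral hi hn).trans_eq
      ((heightBump k).integral_normed (μ := (volume : Measure ℝ)))

lemma tendsto_heightStep {s : ℝ} (hs : 0 < s) :
    Tendsto (fun k => heightStep k s) atTop (𝓝 1) := by
  have h : Tendsto (fun k : ℕ => 3 / ((k : ℝ) + 1)) atTop (𝓝 0) := by
    have := tendsto_one_div_add_atTop_nhds_zero_nat (𝕜 := ℝ) |>.const_mul 3
    simpa [div_eq_mul_inv] using this
  refine tendsto_const_nhds.congr' ?_
  filter_upwards [h.eventually_le_const hs] with k hk
  exact (heightStep_eq_one k hk).symm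

end

end

/-! ### Traces and Gauss–Green in a single chart. -/

noncomputable section

/-- `L` is the trace of `w` at `x`, in the sense of averages of `|w - L|` over `Ω ∩ B(x, r)`. -/
def HasTrace {n : ℕ} (Ω : Set (Eu n)) (w : Eu n → ℝ) (x : Eu n) (L : ℝ) : Prop :=
  Tendsto (fun r : ℝ => (∫⁻ y in Ω ∩ Metric.ball x r, ‖w y - L‖ₑ) / volume (Ω ∩ Metric.ball x r))
    (𝓝[>] 0) (𝓝 0)

section

variable {n d : ℕ} (T : Eu n ≃ₗᵢ[ℝ] WithLp 2 (Eu d × ℝ)) {f : Eu d → ℝ} {K : ℝ≥0}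

lemma volume_cylinder (y : Eu d) {r : ℝ} (hr : 0 < r) :
    volume (Metric.closedBall y r ×ˢ Ioo 0 r) =
      volume (Metric.ball (0 : Eu d) 1) * ENNReal.ofReal r ^ (d + 1) := by
  rw [Measure.volume_eq_prod, Measure.prod_prod, volume_closedBall_eq y hr.le, Real.volume_Ioo,
    sub_zero, pow_succ]
  ring

/-- Balls and half-cylinders are comparable in the chart: the preimage of `Ω ∩ B(x, r)` lies in the
half-cylinder of size `(K + 2) r`, and the half-cylinder of size `r / (K + 3)` maps into `Ω ∩ B(x,
r)`. As the chart preserves volume, the averages differ by at most a fixed factor. -/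
lemma hasTrace_of_tendsto_cylinder {Ω U : Set (Eu n)} (hΩ : IsOpen Ω) (hUo : IsOpen U)
    (hf : LipschitzWith K f) (hU : ∀ y ∈ U, y ∈ Ω ↔ (T y).snd < f (T y).fst)
    {w : Eu n → ℝ} {y : Eu d} (hy : chartHomeo T hf.continuous (y, 0) ∈ U) {t : ℝ}
    (ht : Tendsto (fun r : ℝ => (∫⁻ p in Metric.closedBall y r ×ˢ Ioo 0 r,
      ‖chartPull T hf.continuous Ω w p - t‖ₑ) / ENNReal.ofReal r ^ (d + 1)) (𝓝[>] 0) (𝓝 0)) :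
    HasTrace Ω w (chartHomeo T hf.continuous (y, 0)) t := by
  set Ψ := chartHomeo T hf.continuous with hΨ
  set x := Ψ (y, 0) with hx
  have hmp : MeasurePreserving Ψ := measurePreserving_chartHomeo T hf.continuous
  have hme : MeasurableEmbedding Ψ := Ψ.measurableEmbedding
  obtain ⟨r₀, hr₀, hrU⟩ := Metric.isOpen_iff.1 hUo x hy
  have hK : (0 : ℝ) ≤ K := K.2
  have hmemΩ : ∀ p, Ψ p ∈ U → (Ψ p ∈ Ω ↔ 0 < p.2) := by
    intro p hp
    rw [hU _ hp]
    have : Ψ.symm (Ψ p) = p := Ψ.symm_apply_apply p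
    have h2 : f (T (Ψ p)).fst - (T (Ψ p)).snd = p.2 := congrArg Prod.snd this
    constructor <;> intro h <;> linarith
  set κ := volume (Metric.ball (0 : Eu d) 1) with hκ
  have hκ0 : κ ≠ 0 := (Metric.measure_ball_pos volume _ one_pos).ne'
  have hκt : κ ≠ ⊤ := measure_ball_lt_top.ne
  set I : ℝ → ℝ≥0∞ := fun r => ∫⁻ p in Metric.closedBall y r ×ˢ Ioo 0 r,
      ‖chartPull T hf.continuous Ω w p - t‖ₑ with hI
  set A : ℝ≥0∞ := ENNReal.ofReal (((K : ℝ) + 2) * (K + 3)) with hA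
  have hA0 : A ≠ 0 := by
    rw [hA]; exact (ENNReal.ofReal_pos.2 (by positivity)).ne'
  have hAt : A ≠ ⊤ := ENNReal.ofReal_ne_top
  have hbound : ∀ r, 0 < r → r < r₀ →
      (∫⁻ y in Ω ∩ Metric.ball x r, ‖w y - t‖ₑ) / volume (Ω ∩ Metric.ball x r) ≤
      (A ^ (d + 1) / κ) * (I (((K : ℝ) + 2) * r) / ENNReal.ofReal (((K : ℝ) + 2) * r) ^ (d + 1)) := by
    intro r hr hrr
    have hbU : Metric.ball x r ⊆ U := (Metric.ball_subset_ball hrr.le).trans hrU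
    have hopen : IsOpen (Ω ∩ Metric.ball x r) := hΩ.inter Metric.isOpen_ball
    have h1 : ∫⁻ y in Ω ∩ Metric.ball x r, ‖w y - t‖ₑ ≤ I (((K : ℝ) + 2) * r) := by
      rw [← hmp.setLIntegral_comp_preimage_emb hme]
      have e1 : ∫⁻ p in Ψ ⁻¹' (Ω ∩ Metric.ball x r), ‖w (Ψ p) - t‖ₑ =
          ∫⁻ p in Ψ ⁻¹' (Ω ∩ Metric.ball x r), ‖chartPull T hf.continuous Ω w p - t‖ₑ := by
        refine setLIntegral_congr_fun (hopen.preimage Ψ.continuous).measurableSet fun p hp => ?_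
        simp only [chartPull]
        rw [indicator_of_mem hp.1]
      rw [e1]
      refine lintegral_mono_set fun p hp => ?_
      have h2 : 0 < p.2 := (hmemΩ p (hbU hp.2)).1 hp.1
      have h3 := (lipschitzWith_chartHomeo_symm T hf).dist_le_mul (Ψ p) x
      rw [← hΨ, hx, Ψ.symm_apply_apply, Ψ.symm_apply_apply, ← hx] at h3
      have h4 : dist (Ψ p) x < r := hp.2
      have h5 : dist p (y, 0) < ((K : ℝ) + 2) * r := by
        push_cast at h3
        nlinarith
      rw [Prod.dist_eq, max_lt_iff] at h5
      refine ⟨Metric.mem_closedBall.2 h5.1.le, h2, ?_⟩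
      have h6 := h5.2
      simp only [Real.dist_eq, sub_zero] at h6
      exact (le_abs_self _).trans_lt h6
    have h2 : κ * ENNReal.ofReal (r / ((K : ℝ) + 3)) ^ (d + 1) ≤ volume (Ω ∩ Metric.ball x r) := by
      have hη : 0 < r / ((K : ℝ) + 3) := by positivity
      rw [← volume_cylinder y hη, ← hmp.measure_preimage_emb hme]
      refine measure_mono fun p hp => ?_
      have h3 := dist_chartHomeo_le T hf y p
      rw [← hΨ, ← hx] at h3
      have h4 : dist p.1 y ≤ r / ((K : ℝ) + 3) := hp.1
      have h5 : |p.2| < r / ((K : ℝ) + 3) := by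
        rw [abs_of_pos hp.2.1]; exact hp.2.2
      have h6 : ((K : ℝ) + 3) * (r / ((K : ℝ) + 3)) = r := by field_simp
      have h7 : dist (Ψ p) x < r := by nlinarith
      exact ⟨(hmemΩ p (hbU h7)).2 hp.2.1, h7⟩
    refine (ENNReal.div_le_div h1 h2).trans (le_of_eq ?_)
    have h3 : ENNReal.ofReal (((K : ℝ) + 2) * r) = A * ENNReal.ofReal (r / ((K : ℝ) + 3)) := by
      rw [hA, ← ENNReal.ofReal_mul (by positivity)]
      congr 1
      field_simp
    rw [h3, mul_pow, ENNReal.div_eq_inv_mul, ENNReal.div_eq_inv_mul, ENNReal.div_eq_inv_mul,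
      ENNReal.mul_inv (Or.inl hκ0) (Or.inl hκt),
      ENNReal.mul_inv (Or.inl (pow_ne_zero _ hA0)) (Or.inl (ENNReal.pow_ne_top hAt))]
    have h4 : A ^ (d + 1) * (A ^ (d + 1))⁻¹ = 1 :=
      ENNReal.mul_inv_cancel (pow_ne_zero _ hA0) (ENNReal.pow_ne_top hAt)
    calc κ⁻¹ * (ENNReal.ofReal (r / ((K : ℝ) + 3)) ^ (d + 1))⁻¹ * I (((K : ℝ) + 2) * r)
        = (A ^ (d + 1) * (A ^ (d + 1))⁻¹) * (κ⁻¹ * (ENNReal.ofReal (r / ((K : ℝ) + 3)) ^ (d + 1))⁻¹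
          * I (((K : ℝ) + 2) * r)) := by rw [h4, one_mul]
      _ = _ := by ring
  have hsc : Tendsto (fun r : ℝ => ((K : ℝ) + 2) * r) (𝓝[>] 0) (𝓝[>] 0) := by
    refine tendsto_nhdsWithin_iff.2 ⟨?_, ?_⟩
    · have : Tendsto (fun r : ℝ => ((K : ℝ) + 2) * r) (𝓝 0) (𝓝 (((K : ℝ) + 2) * 0)) :=
        tendsto_id.const_mul _
      rw [mul_zero] at this
      exact this.mono_left nhdsWithin_le_nhds
    · filter_upwards [self_mem_nhdsWithin] with r hr
      have : (0 : ℝ) < r := hr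
      exact mem_Ioi.2 (by positivity)
  have hlim := ENNReal.Tendsto.const_mul (ht.comp hsc)
    (Or.inr (ENNReal.div_ne_top (ENNReal.pow_ne_top (n := d + 1) hAt) hκ0))
  rw [mul_zero] at hlim
  refine tendsto_of_tendsto_of_tendsto_of_le_of_le' tendsto_const_nhds hlim
    (Eventually.of_forall fun r => zero_le) ?_
  filter_upwards [Ioo_mem_nhdsGT hr₀] with r hr
  exact hbound r hr.1 hr.2

/-- If `w` vanishes nearby, the quotient is eventually the constant `‖t‖` times the volume of the
unit ball. This also covers points of the graph outside `U`, which need not belong to `∂Ω`. -/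
lemma eq_zero_of_tendsto_cylinder {Ω : Set (Eu n)} (hf : LipschitzWith K f)
    {w : Eu n → ℝ} {y : Eu d}
    (hy : ∀ᶠ x in 𝓝 (chartHomeo T hf.continuous (y, 0)), w x = 0) {t : ℝ}
    (ht : Tendsto (fun r : ℝ => (∫⁻ p in Metric.closedBall y r ×ˢ Ioo 0 r,
      ‖chartPull T hf.continuous Ω w p - t‖ₑ) / ENNReal.ofReal r ^ (d + 1)) (𝓝[>] 0) (𝓝 0)) :
    t = 0 := by
  obtain ⟨r₀, hr₀, hrw⟩ := Metric.eventually_nhds_iff_ball.1 hy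
  set κ := volume (Metric.ball (0 : Eu d) 1) with hκ
  have hκ0 : κ ≠ 0 := (Metric.measure_ball_pos volume _ one_pos).ne'
  have hK : (0 : ℝ) ≤ K := K.2
  have hc : ∀ᶠ r : ℝ in 𝓝[>] 0, (∫⁻ p in Metric.closedBall y r ×ˢ Ioo 0 r,
      ‖chartPull T hf.continuous Ω w p - t‖ₑ) / ENNReal.ofReal r ^ (d + 1) = ‖t‖ₑ * κ := by
    have h0 : 0 < r₀ / ((K : ℝ) + 3) := by positivity
    filter_upwards [Ioo_mem_nhdsGT h0] with r hr
    have hm : MeasurableSet (Metric.closedBall y r ×ˢ Ioo 0 r) :=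
      Metric.isClosed_closedBall.measurableSet.prod measurableSet_Ioo
    have e1 : ∫⁻ p in Metric.closedBall y r ×ˢ Ioo 0 r,
        ‖chartPull T hf.continuous Ω w p - t‖ₑ =
        ∫⁻ _ in Metric.closedBall y r ×ˢ Ioo 0 r, ‖t‖ₑ := by
      refine setLIntegral_congr_fun hm fun p hp => ?_
      have h3 := dist_chartHomeo_le T hf y p
      have h4 : dist p.1 y ≤ r := hp.1
      have h5 : |p.2| < r := by rw [abs_of_pos hp.2.1]; exact hp.2.2
      have h6 : r * ((K : ℝ) + 3) < r₀ := (lt_div_iff₀ (by positivity)).1 hr.2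
      have hr0 : 0 < r := hr.1
      have h7 : w (chartHomeo T hf.continuous p) = 0 := hrw _ (by
        rw [Metric.mem_ball]; nlinarith)
      have h8 : chartPull T hf.continuous Ω w p = 0 := by
        unfold chartPull
        by_cases hp : chartHomeo T hf.continuous p ∈ Ω
        · rw [indicator_of_mem hp, h7]
        · rw [indicator_of_notMem hp]
      simp [h8]
    have hR0 : ENNReal.ofReal r ^ (d + 1) ≠ 0 := pow_ne_zero _ (ENNReal.ofReal_pos.2 hr.1).ne'
    rw [e1, setLIntegral_const, volume_cylinder y hr.1, ← mul_assoc,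
      ENNReal.mul_div_cancel_right hR0 (ENNReal.pow_ne_top ENNReal.ofReal_ne_top)]
  have := tendsto_nhds_unique (tendsto_const_nhds.congr' (hc.mono fun r h => h.symm)) ht
  rcases mul_eq_zero.1 this with h | h
  · exact enorm_eq_zero.1 h
  · exact absurd h hκ0

/-- Existence of traces and the Gauss–Green formula in a boundary chart. -/
theorem exists_chart_trace {Ω U : Set (Eu n)} (hΩ : IsOpen Ω) (hUo : IsOpen U)
    (hf : LipschitzWith K f) (hU : ∀ y ∈ U, y ∈ Ω ↔ (T y).snd < f (T y).fst)
    {w : Eu n → ℝ} {G : Eu n → Eu n → ℝ} (h : ∀ v, HasWeakDir Ω v w (G v))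
    (hw : IntegrableOn w Ω) (hG : ∀ v, IntegrableOn (G v) Ω)
    {φ : Eu n → ℝ} {L : ℝ≥0} (hφ : LipschitzWith L φ)
    (hφc : HasCompactSupport φ) (hφU : tsupport φ ⊆ U) :
    ∃ t : Eu d → ℝ, Integrable t ∧
      (∀ v, ∫ x in Ω, (φ x * G v x + w x * fderiv ℝ φ x v) =
        ∫ y, t y * ((T v).snd - fderiv ℝ f y (T v).fst)) ∧
      ∀ᵐ y, (chartHomeo T hf.continuous (y, 0) ∈ U →
          HasTrace Ω (fun x => φ x * w x) (chartHomeo T hf.continuous (y, 0)) (t y)) ∧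
        (chartHomeo T hf.continuous (y, 0) ∉ tsupport φ → t y = 0) := by
  set ξ := (chartHomeo T hf.continuous).symm with hξ
  obtain ⟨C, hC⟩ := hφc.exists_bound_of_continuous hφ.continuous
  have hφm : AEStronglyMeasurable φ (volume.restrict Ω) := hφ.continuous.aestronglyMeasurable
  have hφw : IntegrableOn (fun x => φ x * w x) Ω := hw.bdd_mul hφm (ae_of_all _ hC)
  have hFi : ∀ v, IntegrableOn (fun x => φ x * G v x + w x * fderiv ℝ φ x v) Ω := by
    intro v
    refine Integrable.add ((hG v).bdd_mul hφm (ae_of_all _ hC)) ?_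
    refine Integrable.mul_bdd (c := L * ‖v‖) hw
      (measurable_fderiv_apply_const ℝ φ v).aestronglyMeasurable (ae_of_all _ fun x => ?_)
    exact ((fderiv ℝ φ x).le_opNorm v).trans (mul_le_mul_of_nonneg_right
      (norm_fderiv_le_of_lipschitz ℝ hφ) (norm_nonneg _))
  set g := chartPull T hf.continuous Ω (fun x => φ x * w x) with hg
  have hgi : Integrable g := integrable_chartPull T hf.continuous hΩ hφw
  set G₀ := chartPull T hf.continuous Ω
    (fun x => φ x * G (chartVert T) x + w x * fderiv ℝ φ x (chartVert T)) with hG₀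
  have hG₀i : Integrable G₀ := integrable_chartPull T hf.continuous hΩ (hFi _)
  -- The half-space lemmas integrate over individual vertical lines and require a genuinely
  -- measurable representative.
  set G₁ := hG₀i.aestronglyMeasurable.mk G₀ with hG₁
  have hG₁m : Measurable G₁ := hG₀i.aestronglyMeasurable.stronglyMeasurable_mk.measurable
  have hG₁e : G₀ =ᵐ[volume] G₁ := hG₀i.aestronglyMeasurable.ae_eq_mk
  have hG₁i : Integrable G₁ := hG₀i.congr hG₁e
  have hW : ∀ c : Eu d × ℝ → ℝ, ContDiff ℝ ∞ c → HasCompactSupport c →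
      tsupport c ⊆ {p | 0 < p.2} → ∫ p, g p * c p = ∫ p, G₁ p * vertPrim c p := by
    intro c hc hcc hcs
    obtain ⟨M, hM⟩ := exists_bound_vertPrim hc.continuous hcc
    obtain ⟨N, hN⟩ := exists_lipschitzWith_vertPrim hc hcc
    obtain ⟨ε, hε, hcε⟩ := exists_pos_forall_lt_eq_zero hcc hcs
    have key := (h (chartVert T)).integral_chart_eq T hΩ hf hU hw (hG _) hφ hφc hφU hN hM hε
      (vertPrim_eq_zero hε hcε) (ae_of_all _ fun x =>
        hasLineDerivAt_vertPrim T hf.continuous hc.continuous x)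
    have e1 : ∫ p, G₁ p * vertPrim c p = ∫ p, G₀ p * vertPrim c p :=
      integral_congr_ae (hG₁e.mono fun p hp => by simp only [hp])
    rw [e1, hg, hG₀, integral_chartPull_mul T hf.continuous hΩ,
      integral_chartPull_mul T hf.continuous hΩ]
    simp only [mul_neg, integral_neg, neg_inj] at key
    exact key
  have htail := ae_eq_tail_integral hgi hG₁i hG₁m hW
  refine ⟨halfTrace G₁, integrable_halfTrace hG₁i, fun v => ?_, ?_⟩
  -- `m` is the derivative of the depth in direction `v`, so the derivative of `heightStep k` of the
  -- depth is `m` times a density concentrating at the graph.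
  · set m : Eu d → ℝ := fun y => fderiv ℝ f y (T v).fst - (T v).snd with hm
    have hmm : Measurable m := (measurable_fderiv_apply_const ℝ f _).sub_const _
    have hmb : ∀ y, ‖m y‖ ≤ K * ‖(T v).fst‖ + ‖(T v).snd‖ := fun y =>
      (norm_sub_le _ _).trans (add_le_add_left (((fderiv ℝ f y).le_opNorm _).trans
        (mul_le_mul_of_nonneg_right (norm_fderiv_le_of_lipschitz ℝ hf) (norm_nonneg _))) _)
    have hδ : Tendsto (fun k : ℕ => 3 / ((k : ℝ) + 1)) atTop (𝓝[>] 0) := by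
      refine tendsto_nhdsWithin_iff.2 ⟨?_, Eventually.of_forall fun k => ?_⟩
      · have := tendsto_one_div_add_atTop_nhds_zero_nat (𝕜 := ℝ) |>.const_mul 3
        simpa [div_eq_mul_inv] using this
      · exact mem_Ioi.2 (by positivity)
    have L1 := tendsto_integral_mul_halfTrace hgi hG₁i hG₁m htail hmm hmb
      (c := fun k => (heightBump k).normed volume) (fun k => (heightBump k).continuous_normed)
      (fun k s => (heightBump k).nonneg_normed s) hδ (fun k s hs => heightBump_eq_zero k s
        fun h' => hs ⟨lt_trans (by positivity) h'.1, h'.2⟩) (fun k => (heightBump k).integral_normed)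
    have L2 : Tendsto (fun k => ∫ x in Ω, (φ x * G v x + w x * fderiv ℝ φ x v) *
        heightStep k (ξ x).2) atTop (𝓝 (∫ x in Ω, (φ x * G v x + w x * fderiv ℝ φ x v))) := by
      refine tendsto_integral_of_dominated_convergence
        (fun x => ‖φ x * G v x + w x * fderiv ℝ φ x v‖) ?_ (hFi v).norm ?_ ?_
      · intro k
        obtain ⟨M, hM⟩ := exists_lipschitzWith_heightStep k
        exact (hFi v).aestronglyMeasurable.mul (hM.continuous.comp
          (continuous_snd.comp ξ.continuous)).aestronglyMeasurable
      · refine fun k => ae_of_all _ fun x => ?_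
        rw [norm_mul]
        exact mul_le_of_le_one_right (norm_nonneg _) (norm_heightStep_le k _)
      · refine (ae_restrict_mem hΩ.measurableSet).mono fun x hx => ?_
        -- Positive depth is only known in `U`. Outside the support of `φ` the integrand vanishes
        -- together with `φ` and its derivative.
        by_cases hxs : x ∈ tsupport φ
        · have h1 := (hU x (hφU hxs)).1 hx
          have h2 : 0 < (ξ x).2 := sub_pos.2 h1
          simpa using (tendsto_heightStep h2).const_mul (φ x * G v x + w x * fderiv ℝ φ x v)
        · have h1 : fderiv ℝ φ x v = 0 :=
            image_eq_zero_of_notMem_tsupport (f := fun x => fderiv ℝ φ x v)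
              fun h' => hxs (tsupport_fderiv_apply_subset ℝ v h')
          simp [image_eq_zero_of_notMem_tsupport hxs, h1]
    have key : ∀ k : ℕ, ∫ p, g p * (m p.1 * (heightBump k).normed volume p.2) =
        -∫ x in Ω, (φ x * G v x + w x * fderiv ℝ φ x v) * heightStep k (ξ x).2 := by
      intro k
      obtain ⟨M, hM⟩ := exists_lipschitzWith_heightStep k
      have hk : (0 : ℝ) < 1 / (2 * ((k : ℝ) + 1)) := by positivity
      have := (h v).integral_chart_eq T hΩ hf hU hw (hG _) hφ hφc hφU
        (β := fun p => heightStep k p.2) (hM.comp LipschitzWith.prod_snd)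
        (fun p => norm_heightStep_le k p.2) hk (fun p hp => heightStep_eq_zero k hp)
        (D := fun x => m (ξ x).1 * (heightBump k).normed volume (ξ x).2) ?_
      · rw [← this, hg, integral_chartPull_mul T hf.continuous hΩ _
          (fun p => m p.1 * (heightBump k).normed volume p.2)]
      · filter_upwards [ae_differentiableAt_chart T hf] with x hx
        have h1 := hasLineDerivAt_height T hx v
        have h2 := (hasDerivAt_heightStep k (ξ x).2).comp_of_eq (0 : ℝ) h1 (by simp [hξ]; rfl)
        rw [mul_comm] at h2
        exact h2
    simp only [key] at L1
    have := tendsto_nhds_unique L1 L2.neg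
    rw [← neg_inj, ← this, ← integral_neg]
    congr 1
    ext y
    simp only [hm]
    ring
  · filter_upwards [ae_tendsto_lintegral_cylinder hgi hG₁i hG₁m htail] with y hy
    refine ⟨fun hyU => hasTrace_of_tendsto_cylinder T hΩ hUo hf hU hyU hy, fun hyφ => ?_⟩
    refine eq_zero_of_tendsto_cylinder T hf ?_ hy
    filter_upwards [(isClosed_tsupport φ).isOpen_compl.mem_nhds hyφ] with x hx
    rw [image_eq_zero_of_notMem_tsupport hx, zero_mul]

end

end

noncomputable section

/-! ### Properties of traces -/

section

variable {n : ℕ} {Ω : Set (Eu n)} {w : Eu n → ℝ} {x : Eu n} {L : ℝ}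

lemma volume_inter_ball_lt_top (r : ℝ) : volume (Ω ∩ Metric.ball x r) < ⊤ :=
  (measure_mono inter_subset_right).trans_lt measure_ball_lt_top

lemma volume_inter_ball_pos (hΩ : IsOpen Ω) (hx : x ∈ closure Ω) {r : ℝ} (hr : 0 < r) :
    0 < volume (Ω ∩ Metric.ball x r) := by
  refine (hΩ.inter Metric.isOpen_ball).measure_pos volume ?_
  rw [inter_comm]
  exact mem_closure_iff.1 hx _ Metric.isOpen_ball (Metric.mem_ball_self hr)

/-- Convergence of the averages of `|w - L|` makes the upper limit an honest limit; `x ∈ closure Ω`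
guarantees that the averages are over sets of positive volume. -/
lemma HasTrace.pointValue_eq (hΩ : IsOpen Ω) (hx : x ∈ closure Ω) (hw : IntegrableOn w Ω)
    (h : HasTrace Ω w x L) : pointValue Ω w x = L := by
  have key : Tendsto (fun r : ℝ => ⨍ y in Ω ∩ Metric.ball x r, w y) (𝓝[>] 0) (𝓝 L) := by
    rw [tendsto_iff_edist_tendsto_0]
    refine tendsto_of_tendsto_of_tendsto_of_le_of_le' tendsto_const_nhds h
      (Eventually.of_forall fun _ => zero_le) ?_
    filter_upwards [self_mem_nhdsWithin] with r hr
    have h0 := (volume_inter_ball_pos hΩ hx hr).ne'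
    have ht := (volume_inter_ball_lt_top (Ω := Ω) (x := x) r).ne
    have hwi : IntegrableOn w (Ω ∩ Metric.ball x r) := hw.mono_set inter_subset_left
    have e1 : (⨍ y in Ω ∩ Metric.ball x r, w y) - L =
        (volume.real (Ω ∩ Metric.ball x r))⁻¹ * ∫ y in Ω ∩ Metric.ball x r, (w y - L) := by
      have hv : volume.real (Ω ∩ Metric.ball x r) ≠ 0 := (ENNReal.toReal_pos h0 ht).ne'
      rw [integral_sub hwi (integrableOn_const ht), setAverage_eq, setIntegral_const, mul_sub,
        smul_eq_mul, smul_eq_mul, inv_mul_cancel_left₀ hv]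
    rw [edist_eq_enorm_sub, e1, enorm_mul, mul_comm, ENNReal.div_eq_inv_mul, mul_comm]
    have e2 : ‖(volume.real (Ω ∩ Metric.ball x r))⁻¹‖ₑ = (volume (Ω ∩ Metric.ball x r))⁻¹ := by
      have hv : volume.real (Ω ∩ Metric.ball x r) ≠ 0 := (ENNReal.toReal_pos h0 ht).ne'
      rw [enorm_inv hv, Real.enorm_eq_ofReal measureReal_nonneg,
        Measure.real, ENNReal.ofReal_toReal ht]
    rw [e2]
    gcongr
    exact enorm_integral_le_lintegral_enorm _
  have := Tendsto.limsup_eq ((continuous_coe_real_ereal.tendsto L).comp key)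
  rw [Function.comp_def] at this
  rw [pointValue, this, EReal.toReal_coe]

lemma HasTrace.congr {w' : Eu n → ℝ} (h : HasTrace Ω w x L) (hw : w' =ᶠ[𝓝 x] w) :
    HasTrace Ω w' x L := by
  refine Tendsto.congr' ?_ h
  obtain ⟨r₀, hr₀, hb⟩ := Metric.eventually_nhds_iff_ball.1 hw
  filter_upwards [Ioo_mem_nhdsGT hr₀] with r hr
  congr 1
  refine lintegral_congr_ae ?_
  have : ∀ᵐ y ∂(volume.restrict (Ω ∩ Metric.ball x r)), y ∈ Metric.ball x r :=
    ae_restrict_of_ae_restrict_of_subset inter_subset_right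
      (ae_restrict_mem measurableSet_ball)
  filter_upwards [this] with y hy
  rw [hb y (Metric.ball_subset_ball hr.2.le hy)]

/-- From `φ y w y - φ x L = φ y (w y - L) + (φ y - φ x) L`: near `x` the first factor is bounded and
the last term is uniformly small. -/
lemma HasTrace.mul_left (h : HasTrace Ω w x L) {φ : Eu n → ℝ} (hφ : ContinuousAt φ x) :
    HasTrace Ω (fun y => φ y * w y) x (φ x * L) := by
  rw [HasTrace, ENNReal.tendsto_nhds_zero]
  intro ε hε
  obtain ⟨ε', hε', hεε⟩ : ∃ ε' : ℝ≥0, 0 < ε' ∧ (ε' : ℝ≥0∞) < ε := by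
    obtain ⟨q, hq, hq'⟩ := ENNReal.lt_iff_exists_nnreal_btwn.1 hε
    exact ⟨q, by exact_mod_cast hq, hq'⟩
  -- Chosen so that `δ (|L| + 1) = ε' / 2`; the added `1` covers `L = 0`.
  set δ : ℝ := ε' / (2 * (|L| + 1)) with hδ
  have hL : 0 < |L| + 1 := by positivity
  have hδ0 : 0 < δ := by positivity
  obtain ⟨r₀, hr₀, hb⟩ := Metric.continuousAt_iff.1 hφ δ hδ0
  set M : ℝ≥0∞ := ENNReal.ofReal (|φ x| + δ) with hM
  have h1 : Tendsto (fun r : ℝ => M * ((∫⁻ y in Ω ∩ Metric.ball x r, ‖w y - L‖ₑ) /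
      volume (Ω ∩ Metric.ball x r))) (𝓝[>] 0) (𝓝 0) := by
    have := ENNReal.Tendsto.const_mul (a := M) h (Or.inr ENNReal.ofReal_ne_top)
    simpa using this
  have hε2 : (0 : ℝ≥0∞) < (ε' / 2 : ℝ≥0) := by exact_mod_cast half_pos hε'
  filter_upwards [ENNReal.tendsto_nhds_zero.1 h1 _ hε2, Ioo_mem_nhdsGT hr₀] with r hr hrr
  set V := Ω ∩ Metric.ball x r with hV
  have hpt : ∀ᵐ y ∂(volume.restrict V), ‖φ y * w y - φ x * L‖ₑ ≤
      M * ‖w y - L‖ₑ + (ε' / 2 : ℝ≥0) := by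
    have : ∀ᵐ y ∂(volume.restrict V), y ∈ Metric.ball x r :=
      ae_restrict_of_ae_restrict_of_subset inter_subset_right
        (ae_restrict_mem measurableSet_ball)
    filter_upwards [this] with y hy
    have hd : |φ y - φ x| < δ := hb (lt_trans hy hrr.2)
    have e : φ y * w y - φ x * L = φ y * (w y - L) + (φ y - φ x) * L := by ring
    rw [e]
    refine (enorm_add_le _ _).trans ?_
    rw [enorm_mul, enorm_mul]
    refine add_le_add (mul_le_mul' ?_ le_rfl) ?_
    · rw [Real.enorm_eq_ofReal_abs]
      refine ENNReal.ofReal_le_ofReal ?_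
      have := abs_sub_abs_le_abs_sub (φ y) (φ x)
      linarith
    · rw [← enorm_mul, Real.enorm_eq_ofReal_abs, abs_mul, ← ENNReal.ofReal_coe_nnreal]
      refine ENNReal.ofReal_le_ofReal ?_
      have : |φ y - φ x| * |L| ≤ δ * (|L| + 1) :=
        mul_le_mul hd.le (by linarith) (abs_nonneg _) hδ0.le
      refine this.trans_eq ?_
      rw [hδ]
      push_cast
      field_simp
  have hI : ∫⁻ y in V, ‖φ y * w y - φ x * L‖ₑ ≤
      M * (∫⁻ y in V, ‖w y - L‖ₑ) + (ε' / 2 : ℝ≥0) * volume V := by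
    refine (lintegral_mono_ae hpt).trans ?_
    rw [lintegral_add_right _ measurable_const, lintegral_const_mul' _ _ ENNReal.ofReal_ne_top,
      setLIntegral_const]
  calc (∫⁻ y in V, ‖φ y * w y - φ x * L‖ₑ) / volume V
      ≤ (M * (∫⁻ y in V, ‖w y - L‖ₑ) + (ε' / 2 : ℝ≥0) * volume V) / volume V := by gcongr
    _ = M * ((∫⁻ y in V, ‖w y - L‖ₑ) / volume V) + (ε' / 2 : ℝ≥0) * (volume V / volume V) := by
        rw [ENNReal.add_div, mul_div_assoc, mul_div_assoc]
    _ ≤ (ε' / 2 : ℝ≥0) + (ε' / 2 : ℝ≥0) * 1 := by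
        gcongr
        exact ENNReal.div_self_le_one
    _ = ε' := by rw [mul_one, ← ENNReal.coe_add, add_halves]
    _ ≤ ε := hεε.le

end

/-! ### Outer normals and surface measure of Lipschitz graphs -/

section

variable {n d : ℕ}

/-- Along `e = ν - ν'` one has `⟪e, ν⟫ = ‖e‖² / 2` and `⟪e, ν'⟫ = -‖e‖² / 2`. A point `x + t e` with
small `t > 0` can then be neither in `Ω` (by `ν`) nor outside it (by `ν'`), since both contradict
the tolerance `‖e‖ / 4`. -/
lemma IsOuterNormal.unique {Ω : Set (Eu n)} {x ν ν' : Eu n} (h : IsOuterNormal Ω x ν)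
    (h' : IsOuterNormal Ω x ν') : ν = ν' := by
  by_contra hne
  set e := ν - ν' with he
  have he0 : 0 < ‖e‖ := norm_pos_iff.2 (sub_ne_zero.2 hne)
  have h1 : inner ℝ e ν = ‖e‖ ^ 2 / 2 := by
    rw [he, norm_sub_sq_real, inner_sub_left, real_inner_self_eq_norm_sq, h.1, h'.1,
      real_inner_comm]
    ring
  have h2 : inner ℝ e ν' = -(‖e‖ ^ 2 / 2) := by
    rw [he, norm_sub_sq_real, inner_sub_left, real_inner_self_eq_norm_sq, h.1, h'.1]
    ring
  have hev := (h.2 (‖e‖ / 4) (by positivity)).and (h'.2 (‖e‖ / 4) (by positivity))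
  have ht : Tendsto (fun t : ℝ => x + t • e) (𝓝[>] 0) (𝓝 x) := by
    have : Continuous fun t : ℝ => x + t • e := by fun_prop
    simpa using (this.tendsto 0).mono_left nhdsWithin_le_nhds
  obtain ⟨t, ⟨hA, hB⟩, htp⟩ := ((ht.eventually hev).and self_mem_nhdsWithin).exists
  have htp : 0 < t := htp
  have e1 : x + t • e - x = t • e := by abel
  rw [e1, norm_smul, inner_smul_left, Real.norm_of_nonneg htp.le] at hA hB
  simp only [h1, h2, conj_trivial] at hA hB
  have : 0 < t * ‖e‖ ^ 2 := by positivity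
  by_cases hΩ : x + t • e ∈ Ω
  · have := hA.1 hΩ; nlinarith
  · have := hB.2 hΩ; nlinarith

lemma IsOuterNormal.outerNormal_eq {Ω : Set (Eu n)} {x ν : Eu n} (h : IsOuterNormal Ω x ν) :
    outerNormal Ω x = ν := by
  have hex : ∃ ν, IsOuterNormal Ω x ν := ⟨ν, h⟩
  rw [outerNormal, dif_pos hex]
  exact hex.choose_spec.unique h

variable (T : Eu n ≃ₗᵢ[ℝ] WithLp 2 (Eu d × ℝ)) {f : Eu d → ℝ} {K : ℝ≥0}

/-- The outer unit normal to the region below the graph of `f`, in Cartesian coordinates `T`. -/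
def graphNormal (f : Eu d → ℝ) (y : Eu d) : Eu n :=
  (graphJac f y)⁻¹ • T.symm (WithLp.toLp 2 (-(InnerProductSpace.toDual ℝ (Eu d)).symm
    (fderiv ℝ f y), (1 : ℝ)))

lemma inner_graphNormal (f : Eu d → ℝ) (y : Eu d) (v : Eu n) :
    inner ℝ v (graphNormal T f y) =
      (graphJac f y)⁻¹ * ((T v).snd - fderiv ℝ f y (T v).fst) := by
  rw [graphNormal, inner_smul_right]
  congr 1
  rw [← T.inner_map_map, T.apply_symm_apply, WithLp.prod_inner_apply]
  simp only [inner_neg_right]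
  have : inner ℝ (T v).fst ((InnerProductSpace.toDual ℝ (Eu d)).symm (fderiv ℝ f y)) =
      fderiv ℝ f y (T v).fst := by
    rw [real_inner_comm, InnerProductSpace.toDual_symm_apply]
  change -inner ℝ (T v).fst _ + inner ℝ (T v).snd (1 : ℝ) = _
  rw [this, real_inner_eq_re_inner]
  simp
  ring

lemma norm_graphNormal (f : Eu d → ℝ) (y : Eu d) : ‖graphNormal T f y‖ = 1 := by
  have hJ : 0 < graphJac f y := zero_lt_one.trans_le (one_le_graphJac f y)
  rw [graphNormal, norm_smul, LinearIsometryEquiv.norm_map, norm_inv, Real.norm_of_nonneg hJ.le]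
  have : ‖(WithLp.toLp 2 (-(InnerProductSpace.toDual ℝ (Eu d)).symm
    (fderiv ℝ f y), (1 : ℝ)) : WithLp 2 (Eu d × ℝ))‖ = graphJac f y := by
    rw [graphJac, ← Real.sqrt_sq (norm_nonneg _), norm_toLp_prod_sq]
    congr 1
    simp
    ring
  rw [this, inv_mul_cancel₀ hJ.ne']

/-- The inner product of `z - x` with the normal is `1 / graphJac` times the height of `z` above the
tangent plane. Membership in `Ω` compares the height with `f`, differentiability bounds the gap
between `f` and the tangent plane by `ε ‖z - x‖`, and `graphJac ≥ 1`. -/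
lemma isOuterNormal_graphNormal {Ω U : Set (Eu n)} (hUo : IsOpen U) (hf : Continuous f)
    (hU : ∀ y ∈ U, y ∈ Ω ↔ (T y).snd < f (T y).fst) {y : Eu d}
    (hd : DifferentiableAt ℝ f y) (hy : chartHomeo T hf (y, 0) ∈ U) :
    IsOuterNormal Ω (chartHomeo T hf (y, 0)) (graphNormal T f y) := by
  set x := chartHomeo T hf (y, 0) with hx
  have hTx : T x = WithLp.toLp 2 (y, f y) := by
    rw [hx, chartHomeo_apply]; simp
  have hJ : 1 ≤ graphJac f y := one_le_graphJac f y
  have hJ0 : 0 < graphJac f y := by linarith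
  refine ⟨norm_graphNormal T f y, fun ε hε => ?_⟩
  have hlim : Tendsto (fun z => (T z).fst) (𝓝 x) (𝓝 y) := by
    have h1 : Continuous fun z => (T z).fst :=
      continuous_fst.comp ((WithLp.prod_continuous_ofLp 2 (Eu d) ℝ).comp T.continuous)
    have := h1.tendsto x
    rwa [hTx] at this
  have hev := hlim.eventually (hd.hasFDerivAt.isLittleO.def hε)
  filter_upwards [hev, hUo.mem_nhds hy] with z hz hzU
  have hfst : ‖(T z).fst - y‖ ≤ ‖z - x‖ := by
    have := norm_fst_chart_le T (z - x)
    rw [map_sub, hTx] at this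
    exact this
  have hin : inner ℝ (z - x) (graphNormal T f y) = (graphJac f y)⁻¹ *
      ((T z).snd - f y - fderiv ℝ f y ((T z).fst - y)) := by
    rw [inner_graphNormal, map_sub, hTx]
    rfl
  have hinv : (graphJac f y)⁻¹ ≤ 1 := inv_le_one_of_one_le₀ hJ
  have hinv0 : 0 < (graphJac f y)⁻¹ := by positivity
  have hz' := abs_le.1 ((hz.trans (mul_le_mul_of_nonneg_left hfst hε.le)))
  have hn0 : 0 ≤ ε * ‖z - x‖ := by positivity
  rw [hin, hU z hzU]
  constructor
  · intro h
    have h1 : (T z).snd - f y - fderiv ℝ f y ((T z).fst - y) ≤ ε * ‖z - x‖ := by linarith [hz'.2]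
    calc _ ≤ (graphJac f y)⁻¹ * (ε * ‖z - x‖) := mul_le_mul_of_nonneg_left h1 hinv0.le
      _ ≤ _ := mul_le_of_le_one_left hn0 hinv
  · intro h
    have h1 : -(ε * ‖z - x‖) ≤ (T z).snd - f y - fderiv ℝ f y ((T z).fst - y) := by
      linarith [hz'.1, not_lt.1 h]
    calc -(ε * ‖z - x‖) ≤ (graphJac f y)⁻¹ * (-(ε * ‖z - x‖)) := by
          rw [mul_neg, neg_le_neg_iff]
          exact mul_le_of_le_one_left hn0 hinv
      _ ≤ _ := mul_le_mul_of_nonneg_left h1 hinv0.le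

/-- The frontier is determined locally, and the chart is a homeomorphism carrying a half-space to
the region below the graph. -/
lemma frontier_inter_chart {Ω U : Set (Eu n)} (hUo : IsOpen U) (hf : Continuous f)
    (hU : ∀ y ∈ U, y ∈ Ω ↔ (T y).snd < f (T y).fst) :
    frontier Ω ∩ U = range (fun y => chartHomeo T hf (y, 0)) ∩ U := by
  set Ψ := chartHomeo T hf with hΨ
  have h1 : Ω ∩ U = Ψ '' (univ ×ˢ Ioi 0) ∩ U := by
    ext x
    simp only [mem_inter_iff, and_congr_left_iff]
    intro hx
    rw [hU x hx, ← Ψ.preimage_symm, mem_preimage, hΨ, chartHomeo_symm_apply]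
    simp
  rw [← frontier_inter_open_inter hUo, h1, frontier_inter_open_inter hUo, ← Ψ.image_frontier,
    frontier_univ_prod_eq, frontier_Ioi]
  congr 1
  ext x
  simp only [mem_image, mem_prod, mem_univ, true_and, mem_singleton_iff, Prod.exists, mem_range]
  constructor
  · rintro ⟨a, b, rfl, h⟩; exact ⟨a, h⟩
  · rintro ⟨a, h⟩; exact ⟨a, 0, rfl, h⟩

lemma measurableEmbedding_chart_zero (hf : Continuous f) :
    MeasurableEmbedding (fun y => chartHomeo T hf (y, 0)) :=
  (chartHomeo T hf).measurableEmbedding.comp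
    (MeasurableEmbedding.of_measurable_inverse (g := Prod.fst) (by fun_prop)
      (by
        have : range (fun y : Eu d => (y, (0 : ℝ))) = univ ×ˢ {0} := by
          ext ⟨a, b⟩; simp [eq_comm]
        rw [this]
        exact MeasurableSet.univ.prod (measurableSet_singleton 0))
      measurable_fst (fun y => rfl))

/-- The area formula moved to the original coordinates by the isometry `T`, under which Hausdorff
measure is invariant. -/
lemma restrict_range_chart_zero (hf : LipschitzWith K f) :
    (μHE[d] : Measure (Eu n)).restrict (range fun y => chartHomeo T hf.continuous (y, 0)) =
      (volume.withDensity fun y => ENNReal.ofReal (graphJac f y)).map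
        (fun y => chartHomeo T hf.continuous (y, 0)) := by
  rw [← comap_graphMap_euclideanHausdorffMeasure hf]
  have hme := measurableEmbedding_chart_zero T hf.continuous
  rw [← hme.map_comap]
  congr 1
  ext s hs
  rw [hme.comap_apply, (measurableEmbedding_graphMap hf.continuous).comap_apply]
  have : (fun y => chartHomeo T hf.continuous (y, 0)) '' s = T.symm '' (graphMap f '' s) := by
    rw [image_image]
    refine image_congr fun y _ => ?_
    rw [chartHomeo_apply]
    simp [graphMap]
  rw [this, T.symm.isometry.euclideanHausdorffMeasure_image]

end

end

noncomputable section

/-! ### The Gauss–Green formula -/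

section

variable {n d : ℕ}

lemma exists_lipschitz_cutoff {S U : Set (Eu n)} (hS : IsCompact S) (hU : IsOpen U)
    (hSU : S ⊆ U) : ∃ (χ : Eu n → ℝ) (L : ℝ≥0), LipschitzWith L χ ∧ HasCompactSupport χ ∧
      tsupport χ ⊆ U ∧ ∀ x ∈ S, χ =ᶠ[𝓝 x] 1 := by
  obtain ⟨δ, hδ, hδU⟩ := hS.exists_cthickening_subset_open hU hSU
  have hδ2 : 0 < δ / 2 := half_pos hδ
  -- Thickening in two steps of `δ / 2` makes the cutoff equal to `1` on a neighbourhood of `S`, not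
  -- merely on `S`.
  set E := Metric.cthickening (δ / 2) S with hE
  have hlip := lipschitzWith_thickenedIndicator hδ2 E
  have hts : tsupport (fun x => (thickenedIndicator hδ2 E x : ℝ)) ⊆ Metric.cthickening δ S := by
    refine closure_minimal (fun x hx => ?_) Metric.isClosed_cthickening
    by_contra hx'
    refine hx ?_
    have : x ∉ Metric.thickening (δ / 2) E := fun h' => hx' <| by
      have := Metric.cthickening_cthickening_subset hδ2.le hδ2.le S
        (Metric.thickening_subset_cthickening _ _ h')
      rwa [add_halves] at this
    simp [thickenedIndicator_zero hδ2 E this]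
  refine ⟨fun x => (thickenedIndicator hδ2 E x : ℝ), _,
    (NNReal.isometry_coe.lipschitz).comp hlip, ?_, hts.trans hδU, fun x hx => ?_⟩
  · exact HasCompactSupport.of_support_subset_isCompact hS.cthickening
      (subset_closure.trans hts)
  · filter_upwards [Metric.isOpen_thickening.mem_nhds (Metric.self_subset_thickening hδ2 S hx)]
      with y hy
    simp [thickenedIndicator_one hδ2 E (Metric.thickening_subset_cthickening _ _ hy)]

/-- The chart argument only yields the trace `t` of `φ w`. A second cutoff, equal to `1` near the
support of `φ`, yields a trace `t'` of `w` itself there, and `t = φ t'`. Under the graph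
parametrisation the surface element `graphJac` cancels the normalising factor of the normal. -/
theorem gaussGreen_chart (T : Eu n ≃ₗᵢ[ℝ] WithLp 2 (Eu d × ℝ)) {f : Eu d → ℝ} {K : ℝ≥0}
    {Ω U : Set (Eu n)} (hΩ : IsOpen Ω) (hUo : IsOpen U)
    (hf : LipschitzWith K f) (hU : ∀ y ∈ U, y ∈ Ω ↔ (T y).snd < f (T y).fst)
    {w : Eu n → ℝ} {G : Eu n → Eu n → ℝ} (h : ∀ v, HasWeakDir Ω v w (G v))
    (hw : IntegrableOn w Ω) (hG : ∀ v, IntegrableOn (G v) Ω)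
    {φ : Eu n → ℝ} {L : ℝ≥0} (hφ : LipschitzWith L φ)
    (hφc : HasCompactSupport φ) (hφU : tsupport φ ⊆ U) (v : Eu n) :
    IntegrableOn (fun x => φ x * pointValue Ω w x * inner ℝ v (outerNormal Ω x)) (frontier Ω)
      μHE[d] ∧
    ∫ x in frontier Ω, φ x * pointValue Ω w x * inner ℝ v (outerNormal Ω x) ∂μHE[d] =
      ∫ x in Ω, (φ x * G v x + w x * fderiv ℝ φ x v) := by
  obtain ⟨t, hti, htG, htr⟩ := exists_chart_trace T hΩ hUo hf hU h hw hG hφ hφc hφU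
  obtain ⟨χ, M, hχ, hχc, hχU, hχ1⟩ := exists_lipschitz_cutoff hφc hUo hφU
  obtain ⟨t', -, -, htr'⟩ := exists_chart_trace T hΩ hUo hf hU h hw hG hχ hχc hχU
  set γ : Eu d → Eu n := fun y => chartHomeo T hf.continuous (y, 0) with hγ
  have hme : MeasurableEmbedding γ := measurableEmbedding_chart_zero T hf.continuous
  set F : Eu n → ℝ := fun x => φ x * pointValue Ω w x * inner ℝ v (outerNormal Ω x) with hF
  have hfr : frontier Ω ∩ U = range γ ∩ U := frontier_inter_chart T hUo hf.continuous hU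
  obtain ⟨C, hC⟩ := hφc.exists_bound_of_continuous hφ.continuous
  have hφw : IntegrableOn (fun x => φ x * w x) Ω :=
    hw.bdd_mul hφ.continuous.aestronglyMeasurable (ae_of_all _ hC)
  have hFγ : ∀ᵐ y, graphJac f y * F (γ y) = t y * ((T v).snd - fderiv ℝ f y (T v).fst) := by
    filter_upwards [htr, htr', hf.ae_differentiableAt] with y hy hy' hd
    by_cases hys : γ y ∈ tsupport φ
    · have hyU : γ y ∈ U := hφU hys
      have hcl : γ y ∈ closure Ω := by
        have : γ y ∈ frontier Ω ∩ U := by rw [hfr]; exact ⟨mem_range_self y, hyU⟩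
        exact this.1.1
      have h1 : HasTrace Ω w (γ y) (t' y) := (hy'.1 hyU).congr <| by
        filter_upwards [hχ1 _ hys] with x hx
        simp [hx]
      have h2 := h1.mul_left hφ.continuous.continuousAt
      have h3 : t y = φ (γ y) * t' y := by
        rw [← (hy.1 hyU).pointValue_eq hΩ hcl hφw, h2.pointValue_eq hΩ hcl hφw]
      have hJ : graphJac f y ≠ 0 := (zero_lt_one.trans_le (one_le_graphJac f y)).ne'
      simp only [hF]
      rw [(isOuterNormal_graphNormal T hUo hf.continuous hU hd hyU).outerNormal_eq,
        inner_graphNormal, h1.pointValue_eq hΩ hcl hw, h3]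
      field_simp
    · rw [hy.2 hys]
      simp [hF, image_eq_zero_of_notMem_tsupport hys]
  have hF0 : ∀ x, x ∉ U → F x = 0 := fun x hx => by
    simp [hF, image_eq_zero_of_notMem_tsupport fun h' => hx (hφU h')]
  have hind : U.indicator F = F := by
    ext x
    by_cases hx : x ∈ U
    · rw [indicator_of_mem hx]
    · rw [indicator_of_notMem hx, hF0 x hx]
  have hUm := hUo.measurableSet
  have hmJ : Measurable fun y => ENNReal.ofReal (graphJac f y) :=
    (measurable_graphJac f).ennreal_ofReal
  have hlt : ∀ᵐ y : Eu d, ENNReal.ofReal (graphJac f y) < ⊤ :=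
    ae_of_all _ fun _ => ENNReal.ofReal_lt_top
  have hJr : ∀ y, (ENNReal.ofReal (graphJac f y)).toReal = graphJac f y := fun y =>
    ENNReal.toReal_ofReal (zero_le_one.trans (one_le_graphJac f y))
  have hint : Integrable fun y => t y * ((T v).snd - fderiv ℝ f y (T v).fst) := by
    refine hti.mul_bdd (c := ‖(T v).snd‖ + K * ‖(T v).fst‖)
      ((measurable_fderiv_apply_const ℝ f _).const_sub _).aestronglyMeasurable
      (ae_of_all _ fun y => ?_)
    exact (norm_sub_le _ _).trans (add_le_add_right (((fderiv ℝ f y).le_opNorm _).trans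
        (mul_le_mul_of_nonneg_right (norm_fderiv_le_of_lipschitz ℝ hf) (norm_nonneg _))) _)
  have hrestr : ((μHE[d] : Measure (Eu n)).restrict (frontier Ω)).restrict U =
      ((μHE[d] : Measure (Eu n)).restrict (range γ)).restrict U := by
    rw [Measure.restrict_restrict hUm, Measure.restrict_restrict hUm, inter_comm, hfr, inter_comm]
  have hrange := restrict_range_chart_zero T hf (n := n)
  constructor
  · rw [IntegrableOn, ← hind, integrable_indicator_iff hUm, IntegrableOn, hrestr, ← IntegrableOn,
      ← integrable_indicator_iff hUm, hind, hrange, hme.integrable_map_iff,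
      integrable_withDensity_iff_integrable_smul' hmJ hlt]
    refine hint.congr (hFγ.mono fun y hy => ?_)
    simp only [hJr, smul_eq_mul, Function.comp_apply]
    exact hy.symm
  · calc ∫ x in frontier Ω, F x ∂μHE[d]
        = ∫ x in range γ, F x ∂μHE[d] := by
          rw [← hind, integral_indicator hUm, integral_indicator hUm, hrestr]
      _ = ∫ y, F (γ y) ∂(volume.withDensity fun y => ENNReal.ofReal (graphJac f y)) := by
          rw [hrange, hme.integral_map]
      _ = ∫ y, t y * ((T v).snd - fderiv ℝ f y (T v).fst) := by
          rw [integral_withDensity_eq_integral_toReal_smul hmJ hlt]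
          refine integral_congr_ae (hFγ.mono fun y hy => ?_)
          simp only [hJr, smul_eq_mul]
          exact hy
      _ = _ := (htG v).symm

end

end

/-! ### Gluing the local Gauss–Green formulas. -/

noncomputable section

section

variable {n : ℕ} {Ω : Set (Eu n)}

lemma gaussGreen_interior (hΩ : IsOpen Ω) {w G : Eu n → ℝ} {v : Eu n} (h : HasWeakDir Ω v w G)
    (hw : IntegrableOn w Ω) (hG : IntegrableOn G Ω) {φ : Eu n → ℝ} {L : ℝ≥0}
    (hφ : LipschitzWith L φ) (hφc : HasCompactSupport φ) (hφΩ : tsupport φ ⊆ Ω) :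
    ∫ x in Ω, (φ x * G x + w x * fderiv ℝ φ x v) = 0 := by
  obtain ⟨C, hC⟩ := hφc.exists_bound_of_continuous hφ.continuous
  have h1 : IntegrableOn (fun x => φ x * G x) Ω :=
    hG.bdd_mul hφ.continuous.aestronglyMeasurable (ae_of_all _ hC)
  have h2 : IntegrableOn (fun x => w x * fderiv ℝ φ x v) Ω := by
    refine Integrable.mul_bdd (c := L * ‖v‖) hw
      (measurable_fderiv_apply_const ℝ φ v).aestronglyMeasurable (ae_of_all _ fun x => ?_)
    exact ((fderiv ℝ φ x).le_opNorm v).trans (mul_le_mul_of_nonneg_right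
      (norm_fderiv_le_of_lipschitz ℝ hφ) (norm_nonneg _))
  have key := h.integral_lipschitz_eq hΩ hφ hφc hφΩ
  have e1 : ∫ x in Ω, φ x * G x = ∫ x, φ x • G x :=
    setIntegral_eq_integral_of_forall_compl_eq_zero fun x hx => by
      simp [image_eq_zero_of_notMem_tsupport fun h' => hx (hφΩ h')]
  have e2 : ∫ x in Ω, w x * fderiv ℝ φ x v = ∫ x, fderiv ℝ φ x v • w x := by
    simp only [smul_eq_mul, mul_comm (w _)]
    refine setIntegral_eq_integral_of_forall_compl_eq_zero fun x hx => ?_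
    have : fderiv ℝ φ x v = 0 :=
      image_eq_zero_of_notMem_tsupport (f := fun x => fderiv ℝ φ x v)
        fun h' => hx (hφΩ (tsupport_fderiv_apply_subset ℝ v h'))
    simp [this]
  rw [integral_add h1 h2, e1, e2, key, add_neg_cancel]

/-- Gives interior and boundary points the same local statement, ready for a partition of unity;
near interior points both sides are zero. -/
lemma exists_nhds_gaussGreen (hΩ : IsLipschitzDomain Ω) {w : Eu n → ℝ} {G : Eu n → Eu n → ℝ}
    (h : ∀ v, HasWeakDir Ω v w (G v)) (hw : IntegrableOn w Ω) (hG : ∀ v, IntegrableOn (G v) Ω)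
    {x : Eu n} (hx : x ∈ closure Ω) :
    ∃ V, IsOpen V ∧ x ∈ V ∧ ∀ (φ : Eu n → ℝ) (L : ℝ≥0), LipschitzWith L φ →
      HasCompactSupport φ → tsupport φ ⊆ V → ∀ v,
      IntegrableOn (fun x => φ x * pointValue Ω w x * inner ℝ v (outerNormal Ω x)) (frontier Ω)
        (surfaceMeasure n) ∧
      ∫ x in frontier Ω, φ x * pointValue Ω w x * inner ℝ v (outerNormal Ω x)
          ∂(surfaceMeasure n) =
        ∫ x in Ω, (φ x * G v x + w x * fderiv ℝ φ x v) := by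
  by_cases hxΩ : x ∈ Ω
  · refine ⟨Ω, hΩ.isOpen, hxΩ, fun φ L hφ hφc hφΩ v => ?_⟩
    have hzero : EqOn (fun x => φ x * pointValue Ω w x * inner ℝ v (outerNormal Ω x)) 0
        (frontier Ω) := fun y hy => by
      have hyΩ : y ∉ Ω := by
        rw [hΩ.isOpen.frontier_eq] at hy
        exact hy.2
      simp [image_eq_zero_of_notMem_tsupport fun h' => hyΩ (hφΩ h')]
    refine ⟨IntegrableOn.congr_fun integrableOn_zero (fun y hy => (hzero hy).symm)
      isClosed_frontier.measurableSet, ?_⟩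
    rw [gaussGreen_interior hΩ.isOpen (h v) hw (hG v) hφ hφc hφΩ,
      setIntegral_congr_fun isClosed_frontier.measurableSet hzero]
    simp
  · have hxf : x ∈ frontier Ω := by
      rw [hΩ.isOpen.frontier_eq]
      exact ⟨hx, hxΩ⟩
    obtain ⟨U, hUo, hxU, T, f, K, hf, hU⟩ := hΩ.lipschitz_boundary x hxf
    exact ⟨U, hUo, hxU, fun φ L hφ hφc hφU v =>
      gaussGreen_chart T hΩ.isOpen hUo hf hU h hw hG hφ hφc hφU v⟩

/-- The Gauss–Green formula for a `W^{1,1}` function on a bounded Lipschitz domain. -/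
theorem gaussGreen (hΩ : IsLipschitzDomain Ω) {w : Eu n → ℝ} {G : Eu n → Eu n → ℝ}
    (h : ∀ v, HasWeakDir Ω v w (G v)) (hw : IntegrableOn w Ω) (hG : ∀ v, IntegrableOn (G v) Ω)
    {a : Eu n → ℝ} {U : Set (Eu n)} (hU : IsOpen U) (hΩU : closure Ω ⊆ U)
    (ha : ContDiffOn ℝ 1 a U) (v : Eu n) :
    IntegrableOn (fun x => a x * pointValue Ω w x * inner ℝ v (outerNormal Ω x)) (frontier Ω)
        (surfaceMeasure n) ∧
      ∫ x in frontier Ω, a x * pointValue Ω w x * inner ℝ v (outerNormal Ω x)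
          ∂(surfaceMeasure n) =
        ∫ x in Ω, (a x * G v x + w x * fderiv ℝ a x v) := by
  have hcpt : IsCompact (closure Ω) := hΩ.isBounded.isCompact_closure
  have hex := fun x : closure Ω => exists_nhds_gaussGreen hΩ h hw hG x.2
  choose V hVo hxV hV using hex
  -- Intersecting with unit balls makes the supports of the partition compact.
  obtain ⟨t, ht⟩ := hcpt.elim_finite_subcover
    (fun x : closure Ω => V x ∩ U ∩ Metric.ball (x : Eu n) 1)
    (fun x => ((hVo x).inter hU).inter Metric.isOpen_ball)
    (fun x hx => mem_iUnion.2 ⟨⟨x, hx⟩, ⟨hxV _, hΩU hx⟩, Metric.mem_ball_self one_pos⟩)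
  obtain ⟨ρ, hρ⟩ := SmoothPartitionOfUnity.exists_isSubordinate (modelWithCornersSelf ℝ (Eu n))
    isClosed_closure (fun x : t => V x ∩ U ∩ Metric.ball ((x : closure Ω) : Eu n) 1)
    (fun x => ((hVo x).inter hU).inter Metric.isOpen_ball)
    (by
      intro x hx
      obtain ⟨k, hk, hxk⟩ := mem_iUnion₂.1 (ht hx)
      exact mem_iUnion.2 ⟨⟨k, hk⟩, hxk⟩)
  have hsum : ∀ x ∈ closure Ω, ∑ k, ρ k x = 1 := fun x hx => by
    have := ρ.sum_eq_one hx
    rwa [finsum_eq_sum_of_fintype] at this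
  set φ : t → Eu n → ℝ := fun k x => ρ k x * a x with hφdef
  have htsφ : ∀ k, tsupport (φ k) ⊆ tsupport (ρ k) := fun k =>
    tsupport_mul_subset_left (f := ρ k) (g := a)
  -- `a` is regular only on `U`, but the support of `ρ k` lies in `U`, so the product is `C¹` on the
  -- whole space.
  have hφC : ∀ k, ContDiff ℝ 1 (φ k) := fun k => by
    refine contDiff_iff_contDiffAt.2 fun x => ?_
    by_cases hx : x ∉ tsupport (φ k)
    · exact contDiffAt_const.congr_of_eventuallyEq (notMem_tsupport_iff_eventuallyEq.1 hx)
    rw [not_not] at hx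
    have h1 : ContDiff ℝ ∞ (ρ k) := (ρ k).contMDiff.contDiff
    exact (h1.of_le (by exact_mod_cast le_top)).contDiffAt.mul
      (ha.contDiffAt (hU.mem_nhds (hρ k (htsφ k hx)).1.2))
  have hφc : ∀ k, HasCompactSupport (φ k) := fun k =>
    (isCompact_closedBall ((k : closure Ω) : Eu n) 1).of_isClosed_subset (isClosed_tsupport _)
      fun x hx => Metric.ball_subset_closedBall (hρ k (htsφ k hx)).2
  have hφL : ∀ k, ∃ L, LipschitzWith L (φ k) := fun k =>
    (hφC k).lipschitzWith_of_hasCompactSupport (hφc k) one_ne_zero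
  choose L hL using hφL
  have key := fun k : t => hV k (φ k) (L k) (hL k) (hφc k) (fun x hx => (hρ k (htsφ k hx)).1.1) v
  have hF : ∀ x ∈ closure Ω, ∑ k, φ k x = a x := fun x hx => by
    rw [← Finset.sum_mul, hsum x hx, one_mul]
  have hFf : EqOn (fun x => ∑ k, φ k x * pointValue Ω w x * inner ℝ v (outerNormal Ω x))
      (fun x => a x * pointValue Ω w x * inner ℝ v (outerNormal Ω x)) (frontier Ω) :=
    fun x hx => by
      simp only [← Finset.sum_mul, ← hF x hx.1]
  have hfd : ∀ x ∈ Ω, ∑ k, fderiv ℝ (φ k) x v = fderiv ℝ a x v := fun x hx => by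
    have h1 : fderiv ℝ (fun y => ∑ k, φ k y) x = ∑ k, fderiv ℝ (φ k) x :=
      fderiv_fun_sum fun k _ => ((hφC k).differentiable one_ne_zero) x
    have h2 : (fun y => ∑ k, φ k y) =ᶠ[𝓝 x] a := by
      filter_upwards [hΩ.isOpen.mem_nhds hx] with y hy using hF y (subset_closure hy)
    rw [← h2.fderiv_eq, h1, _root_.sum_apply]
  have hi : ∀ k ∈ (Finset.univ : Finset t),
      IntegrableOn (fun x => φ k x * G v x + w x * fderiv ℝ (φ k) x v) Ω := fun k _ => by
    obtain ⟨C, hC⟩ := (hφc k).exists_bound_of_continuous (hL k).continuous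
    refine Integrable.add ((hG v).bdd_mul (hL k).continuous.aestronglyMeasurable
      (ae_of_all _ hC)) ?_
    refine Integrable.mul_bdd (c := L k * ‖v‖) hw
      (measurable_fderiv_apply_const ℝ (φ k) v).aestronglyMeasurable (ae_of_all _ fun x => ?_)
    exact ((fderiv ℝ (φ k) x).le_opNorm v).trans (mul_le_mul_of_nonneg_right
      (norm_fderiv_le_of_lipschitz ℝ (hL k)) (norm_nonneg _))
  have hfm : MeasurableSet (frontier Ω) := isClosed_frontier.measurableSet
  refine ⟨IntegrableOn.congr_fun (integrable_finsetSum _ fun k _ => (key k).1) hFf hfm, ?_⟩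
  rw [← setIntegral_congr_fun hfm hFf, integral_finsetSum _ fun k _ => (key k).1]
  simp only [fun k => (key k).2]
  rw [← integral_finsetSum _ hi]
  refine setIntegral_congr_fun hΩ.isOpen.measurableSet fun x hx => ?_
  simp only [Finset.sum_add_distrib, ← Finset.sum_mul, ← Finset.mul_sum, hfd x hx,
    hF x (subset_closure hx)]

end

end

noncomputable section

/-! ### Weak derivatives of the composition -/

section

variable {n : ℕ} {Ω : Set (Eu n)} {i j : Fin n} {w g : Eu n → ℝ}

lemma HasWeakPartial.weakPartial (h : HasWeakPartial Ω i w g) :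
    HasWeakPartial Ω i w (weakPartial Ω i w) := by
  have hex : ∃ g, HasWeakPartial Ω i w g := ⟨g, h⟩
  rw [_root_.weakPartial, dif_pos hex]
  exact hex.choose_spec

lemma HasWeakPartial.weakPartial_ae_eq (hΩ : IsOpen Ω) (h : HasWeakPartial Ω i w g) :
    ∀ᵐ x ∂(volume.restrict Ω), g x = _root_.weakPartial Ω i w x :=
  h.hasWeakDir.ae_eq hΩ h.weakPartial.hasWeakDir (ae_of_all _ fun _ => rfl)

/-- `weakPartial` selects its own representative, so iterated derivatives have to be transferred
from `g` to the selected function. -/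
lemma HasWeakPartial.weakPartial_weakPartial {g' : Eu n → ℝ} (hΩ : IsOpen Ω)
    (h : HasWeakPartial Ω j w g) (h' : HasWeakPartial Ω i g g') :
    HasWeakPartial Ω i (_root_.weakPartial Ω j w) g' :=
  (h'.hasWeakDir.congr_ae (h.weakPartial_ae_eq hΩ) (ae_of_all _ fun _ => rfl)).hasWeakPartial

lemma MemW1loc.hasWeakPartial (h : MemW1loc Ω 2 w) (i : Fin n) :
    HasWeakPartial Ω i w (weakPartial Ω i w) := by
  obtain ⟨g, hg, -⟩ := h.2 i
  exact hg.weakPartial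

lemma MemW1loc.hasWeakPartial_weakPartial (hΩ : IsOpen Ω) (h : MemW1loc Ω 2 w) (i j : Fin n) :
    HasWeakPartial Ω i (weakPartial Ω j w) (weakPartial Ω i (weakPartial Ω j w)) := by
  obtain ⟨g, hg, -, hg'⟩ := h.2 j
  obtain ⟨g', hg', -⟩ := hg' i
  exact (hg.weakPartial_weakPartial hΩ hg').weakPartial

lemma MemW1.memW1loc : ∀ {m : ℕ} {w : Eu n → ℝ}, MemW1 Ω m w → MemW1loc Ω m w
  | 0, _, h => IntegrableOn.locallyIntegrableOn h
  | _ + 1, _, h => ⟨h.1.locallyIntegrableOn, fun i =>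
      let ⟨g, hg, hm⟩ := h.2 i
      ⟨g, hg, MemW1.memW1loc hm⟩⟩

lemma MemW1.integrableOn_weakPartial (hΩ : IsOpen Ω) (h : MemW1 Ω 2 w) (i : Fin n) :
    IntegrableOn (weakPartial Ω i w) Ω := by
  obtain ⟨g, hg, hgi, -⟩ := h.2 i
  exact Integrable.congr hgi (hg.weakPartial_ae_eq hΩ)

lemma MemW1.integrableOn_weakPartial_weakPartial (hΩ : IsOpen Ω) (h : MemW1 Ω 2 w)
    (i j : Fin n) : IntegrableOn (weakPartial Ω i (weakPartial Ω j w)) Ω := by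
  obtain ⟨g, hg, -, hg'⟩ := h.2 j
  obtain ⟨g', hg', hi⟩ := hg' i
  exact Integrable.congr hi ((hg.weakPartial_weakPartial hΩ hg').weakPartial_ae_eq hΩ)

end

lemma isOpen_openInt (B : EReal) : IsOpen (openInt B) :=
  (isOpen_lt continuous_const continuous_id).inter
    (isOpen_lt continuous_coe_real_ereal continuous_const)

lemma contDiffOn_one_of_hasDerivAt {O : Set ℝ} (hO : IsOpen O) {F F' : ℝ → ℝ}
    (h : ∀ s ∈ O, HasDerivAt F (F' s) s) (hF' : ContinuousOn F' O) : ContDiffOn ℝ 1 F O := by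
  rw [contDiffOn_one_iff_derivWithin hO.uniqueDiffOn]
  refine ⟨fun s hs => (h s hs).differentiableAt.differentiableWithinAt, hF'.congr fun s hs => ?_⟩
  rw [derivWithin_of_isOpen hO hs, (h s hs).deriv]

section

variable {n : ℕ} {Ω : Set (Eu n)} {B : EReal} {h H Ht : ℝ → ℝ} {u : Eu n → ℝ}

lemma IsWeight.contDiffOn_H (hh : IsWeight B h H Ht) : ContDiffOn ℝ 1 H (openInt B) :=
  contDiffOn_one_of_hasDerivAt (isOpen_openInt B) hh.deriv_H hh.continuousOn

lemma IsWeight.contDiffOn_Ht (hh : IsWeight B h H Ht) : ContDiffOn ℝ 1 Ht (openInt B) :=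
  contDiffOn_one_of_hasDerivAt (isOpen_openInt B) hh.deriv_Ht hh.contDiffOn_H.continuousOn

lemma IsWeight.weakPartial_comp (hΩ : IsOpen Ω) (hh : IsWeight B h H Ht) (hu : MemW1loc Ω 2 u)
    (hv : MemW1loc Ω 2 fun x => Ht (u x)) (i : Fin n) :
    ∀ᵐ x ∂(volume.restrict Ω), u x ∈ openInt B →
      weakPartial Ω i (fun x => Ht (u x)) x = H (u x) * weakPartial Ω i u x := by
  filter_upwards [(hu.hasWeakPartial i).hasWeakDir.ae_eq_fderiv_of_mem hΩ
    (hv.hasWeakPartial i).hasWeakDir (isOpen_openInt B) hh.contDiffOn_Ht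
    (ae_of_all _ fun x _ => rfl)] with x hx hxB
  rw [hx hxB, (hh.deriv_Ht _ hxB).hasFDerivAt.fderiv]
  simp [mul_comm]

/-- The first-order rule writes `∂ⱼ(Ht ∘ u)` as the function `(s, t) ↦ H(s) t` of the pair `(u,
∂ⱼu)`. It is `C¹` because `H' = h` is continuous, so the local chain rule applies again. -/
lemma IsWeight.weakPartial_weakPartial_comp (hΩ : IsOpen Ω) (hh : IsWeight B h H Ht)
    (hu : MemW1loc Ω 2 u) (hv : MemW1loc Ω 2 fun x => Ht (u x)) (i j : Fin n) :
    ∀ᵐ x ∂(volume.restrict Ω), u x ∈ openInt B →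
      weakPartial Ω i (weakPartial Ω j fun x => Ht (u x)) x =
        h (u x) * weakPartial Ω i u x * weakPartial Ω j u x +
          H (u x) * weakPartial Ω i (weakPartial Ω j u) x := by
  have hU := (hu.hasWeakPartial i).hasWeakDir.prodMk
    (hu.hasWeakPartial_weakPartial hΩ i j).hasWeakDir
  have hΦ : ContDiffOn ℝ 1 (fun p : ℝ × ℝ => H p.1 * p.2) (openInt B ×ˢ univ) :=
    (hh.contDiffOn_H.comp contDiff_fst.contDiffOn fun p hp => hp.1).mul contDiff_snd.contDiffOn
  have heq : ∀ᵐ x ∂(volume.restrict Ω), (u x, weakPartial Ω j u x) ∈ openInt B ×ˢ (univ : Set ℝ) →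
      weakPartial Ω j (fun x => Ht (u x)) x = H (u x) * weakPartial Ω j u x := by
    filter_upwards [hh.weakPartial_comp hΩ hu hv j] with x hx hxB using hx hxB.1
  filter_upwards [hU.ae_eq_fderiv_of_mem hΩ (hv.hasWeakPartial_weakPartial hΩ i j).hasWeakDir
    ((isOpen_openInt B).prod isOpen_univ) hΦ heq] with x hx hxB
  rw [hx ⟨hxB, mem_univ _⟩]
  have hd : HasFDerivAt (fun p : ℝ × ℝ => H p.1 * p.2) _ (u x, weakPartial Ω j u x) :=
    ((hh.deriv_H _ hxB).comp_hasFDerivAt (u x, weakPartial Ω j u x)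
      (hasFDerivAt_fst (𝕜 := ℝ))).mul (hasFDerivAt_snd (𝕜 := ℝ))
  rw [hd.fderiv]
  simp
  ring

lemma IsEndpointExtension.eq_of_notMem {B : EReal} {I : Set ℝ} (hI : IsEndpointExtension B I)
    {s : ℝ} (hs : s ∈ I) (hsB : s ∉ openInt B) : s = 0 ∨ s = B.toReal := by
  -- For `B = ⊤` the junk value of `B.toReal` is harmless: a real `s` cannot equal `⊤`.
  have key : 0 ≤ s → (s : EReal) ≤ B → s = 0 ∨ s = B.toReal := fun h0 h1 => by
    rcases h0.eq_or_lt with h0 | h0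
    · exact Or.inl h0.symm
    · rcases h1.eq_or_lt with h1 | h1
      · right
        rw [← h1, EReal.toReal_coe]
      · exact absurd ⟨h0, h1⟩ hsB
  rcases hI with rfl | rfl | ⟨-, rfl | rfl⟩
  · exact absurd hs hsB
  · exact key hs.1 hs.2.le
  · exact key hs.1.le hs.2
  · exact key hs.1 hs.2

/-- Where `u` leaves `(0,B)` it is an endpoint, so `Ht ∘ u` equals one of two constants there, and
its derivatives vanish a.e. on the corresponding level sets. No chain rule for `u` is involved. -/
lemma weakPartial_comp_eq_zero (hΩ : IsOpen Ω) {I : Set ℝ} (hI : IsEndpointExtension B I)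
    (huI : ∀ᵐ x ∂(volume.restrict Ω), u x ∈ I) (hv : MemW1loc Ω 2 fun x => Ht (u x))
    (i : Fin n) : ∀ᵐ x ∂(volume.restrict Ω), u x ∉ openInt B →
      weakPartial Ω i (fun x => Ht (u x)) x = 0 := by
  have hd := (hv.hasWeakPartial i).hasWeakDir
  filter_upwards [huI, hd.ae_eq_zero_of_eq_const hΩ (Ht 0),
    hd.ae_eq_zero_of_eq_const hΩ (Ht B.toReal)] with x hx h1 h2 hxB
  rcases hI.eq_of_notMem hx hxB with h | h
  · exact h1 (congrArg Ht h)
  · exact h2 (congrArg Ht h)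

/-- The set in question lies, up to a null set, in the zero level set of `∂ⱼ(Ht ∘ u)`. -/
lemma weakPartial_weakPartial_comp_eq_zero (hΩ : IsOpen Ω) {I : Set ℝ}
    (hI : IsEndpointExtension B I) (huI : ∀ᵐ x ∂(volume.restrict Ω), u x ∈ I)
    (hv : MemW1loc Ω 2 fun x => Ht (u x)) (i j : Fin n) :
    ∀ᵐ x ∂(volume.restrict Ω), u x ∉ openInt B →
      weakPartial Ω i (weakPartial Ω j fun x => Ht (u x)) x = 0 := by
  filter_upwards [weakPartial_comp_eq_zero hΩ hI huI hv j,
    (hv.hasWeakPartial_weakPartial hΩ i j).hasWeakDir.ae_eq_zero_of_eq_const hΩ 0] with x h1 h2 hxB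
  exact h2 (h1 hxB)

end

end

noncomputable section

/-! ### The divergence theorem for `A ∇v` -/

section

variable {n : ℕ} {Ω : Set (Eu n)} {A : Eu n → Matrix (Fin n) (Fin n) ℝ} {c C : ℝ}

/-- Only the `C¹` extension `a` is controlled on the compact closure; values and derivatives of `A`
agree with those of `a` in the open set `Ω`. -/
lemma IsUniformlyElliptic.exists_bound (hΩ : IsLipschitzDomain Ω)
    (hA : IsUniformlyElliptic Ω A c C) (i j : Fin n) :
    ∃ M, ∀ x ∈ Ω, |A x i j| ≤ M ∧ ‖fderiv ℝ (fun y => A y i j) x‖ ≤ M := by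
  obtain ⟨U, a, hU, hΩU, ha, haA⟩ := hA.contDiff i j
  have hcpt : IsCompact (closure Ω) := hΩ.isBounded.isCompact_closure
  obtain ⟨M₁, hM₁⟩ := hcpt.exists_bound_of_continuousOn (ha.continuousOn.mono hΩU)
  obtain ⟨M₂, hM₂⟩ := hcpt.exists_bound_of_continuousOn
    ((ha.continuousOn_fderiv_of_isOpen hU le_rfl).mono hΩU)
  refine ⟨max M₁ M₂, fun x hx => ⟨?_, ?_⟩⟩
  · rw [← haA x (subset_closure hx)]
    exact (hM₁ x (subset_closure hx)).trans (le_max_left _ _)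
  · have : (fun y => A y i j) =ᶠ[𝓝 x] a := by
      filter_upwards [hΩ.isOpen.mem_nhds hx] with y hy using (haA y (subset_closure hy)).symm
    rw [this.fderiv_eq]
    exact (hM₂ x (subset_closure hx)).trans (le_max_right _ _)

lemma IsUniformlyElliptic.aestronglyMeasurable (hΩ : IsLipschitzDomain Ω)
    (hA : IsUniformlyElliptic Ω A c C) (i j : Fin n) :
    AEStronglyMeasurable (fun x => A x i j) (volume.restrict Ω) := by
  obtain ⟨U, a, hU, hΩU, ha, haA⟩ := hA.contDiff i j
  refine ContinuousOn.aestronglyMeasurable ?_ hΩ.isOpen.measurableSet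
  exact ((ha.continuousOn.mono hΩU).mono subset_closure).congr
    fun x hx => (haA x (subset_closure hx)).symm

lemma IsUniformlyElliptic.integrableOn_coeff_mul (hΩ : IsLipschitzDomain Ω)
    (hA : IsUniformlyElliptic Ω A c C) (i j : Fin n) {w : Eu n → ℝ} (hw : IntegrableOn w Ω) :
    IntegrableOn (fun x => A x i j * w x) Ω := by
  obtain ⟨M, hM⟩ := hA.exists_bound hΩ i j
  refine hw.bdd_mul (c := M) (hA.aestronglyMeasurable hΩ i j) ?_
  filter_upwards [ae_restrict_mem hΩ.isOpen.measurableSet] with x hx using (hM x hx).1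

lemma IsUniformlyElliptic.integrableOn_mul_fderiv_coeff (hΩ : IsLipschitzDomain Ω)
    (hA : IsUniformlyElliptic Ω A c C) (i j : Fin n) (e : Eu n) {w : Eu n → ℝ}
    (hw : IntegrableOn w Ω) :
    IntegrableOn (fun x => w x * fderiv ℝ (fun y => A y i j) x e) Ω := by
  obtain ⟨M, hM⟩ := hA.exists_bound hΩ i j
  refine hw.mul_bdd (c := M * ‖e‖) (measurable_fderiv_apply_const ℝ _ e).aestronglyMeasurable ?_
  filter_upwards [ae_restrict_mem hΩ.isOpen.measurableSet] with x hx
  exact ((fderiv ℝ _ x).le_opNorm e).trans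
    (mul_le_mul_of_nonneg_right (hM x hx).2 (norm_nonneg _))

lemma IsUniformlyElliptic.gaussGreen (hΩ : IsLipschitzDomain Ω)
    (hA : IsUniformlyElliptic Ω A c C) {w : Eu n → ℝ} {g : Fin n → Eu n → ℝ}
    (hw : IntegrableOn w Ω) (h : ∀ i, HasWeakPartial Ω i w (g i))
    (hg : ∀ i, IntegrableOn (g i) Ω) (i j : Fin n) :
    IntegrableOn (fun x => outerNormal Ω x i * (A x i j * pointValue Ω w x)) (frontier Ω)
        (surfaceMeasure n) ∧
      ∫ x in frontier Ω, outerNormal Ω x i * (A x i j * pointValue Ω w x) ∂(surfaceMeasure n) =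
        (∫ x in Ω, A x i j * g i x) +
        ∫ x in Ω, w x * fderiv ℝ (fun y => A y i j) x (EuclideanSpace.single i 1) := by
  obtain ⟨U, a, hU, hΩU, ha, haA⟩ := hA.contDiff i j
  have key := _root_.gaussGreen hΩ (G := fun v x => ∑ k, v k * g k x)
    (hasWeakDir_of_hasWeakPartial hw.locallyIntegrableOn h) hw
    (fun v => integrable_finsetSum _ fun k _ => (hg k).const_mul (v k)) hU hΩU ha
    (EuclideanSpace.single i 1)
  have hfm : MeasurableSet (frontier Ω) := isClosed_frontier.measurableSet
  have e1 : EqOn (fun x => a x * pointValue Ω w x *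
      inner ℝ (EuclideanSpace.single i 1) (outerNormal Ω x))
      (fun x => outerNormal Ω x i * (A x i j * pointValue Ω w x)) (frontier Ω) := fun x hx => by
    simp only [haA x hx.1, EuclideanSpace.inner_single_left]
    simp [mul_comm]
  refine ⟨key.1.congr_fun e1 hfm, ?_⟩
  rw [← setIntegral_congr_fun hfm e1, key.2,
    ← integral_add (hA.integrableOn_coeff_mul hΩ i j (hg i))
      (hA.integrableOn_mul_fderiv_coeff hΩ i j _ hw)]
  refine setIntegral_congr_fun hΩ.isOpen.measurableSet fun x hx => ?_
  have hev : (fun y => A y i j) =ᶠ[𝓝 x] a := by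
    filter_upwards [hΩ.isOpen.mem_nhds hx] with y hy using (haA y (subset_closure hy)).symm
  simp only [hev.fderiv_eq, haA x (subset_closure hx)]
  congr 2
  rw [Finset.sum_eq_single i (fun k _ hk => by simp [hk]) (by simp)]
  simp

lemma matForm_eq_sum (M : Matrix (Fin n) (Fin n) ℝ) (y z : Eu n) :
    matForm M y z = ∑ i, ∑ j, y i * (M i j * z j) := by
  simp only [matForm, dotProduct, Matrix.mulVec, Finset.mul_sum]

/-- The divergence of `A ∇v` differentiates along the first index of `A`, while `matDiv`
differentiates along the second; symmetry of `A` reconciles the two. -/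
lemma IsUniformlyElliptic.inner_matDiv_weakGrad (hΩ : IsOpen Ω)
    (hA : IsUniformlyElliptic Ω A c C) (v : Eu n → ℝ) {x : Eu n} (hx : x ∈ Ω) :
    inner ℝ (matDiv A x) (weakGrad Ω v x) = ∑ i, ∑ j, weakPartial Ω j v x *
      fderiv ℝ (fun y => A y i j) x (EuclideanSpace.single i 1) := by
  have hsymm : ∀ i j, fderiv ℝ (fun y => A y i j) x = fderiv ℝ (fun y => A y j i) x :=
    fun i j => Filter.EventuallyEq.fderiv_eq <| by
      filter_upwards [hΩ.mem_nhds hx] with y hy using (hA.symm y (subset_closure hy)).apply j i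
  rw [Finset.sum_comm, PiLp.inner_apply]
  refine Finset.sum_congr rfl fun j _ => ?_
  simp only [matDiv, weakGrad, ← Finset.mul_sum]
  rw [real_inner_comm, real_inner_eq_re_inner]
  simp only [RCLike.inner_apply, conj_trivial, RCLike.re_to_real]
  rw [mul_comm]
  congr 1
  exact Finset.sum_congr rfl fun i _ => by rw [hsymm j i]

lemma IsUniformlyElliptic.integrableOn_ellipticOp (hΩ : IsLipschitzDomain Ω)
    (hA : IsUniformlyElliptic Ω A c C) {v : Eu n → ℝ} (hv : MemW1 Ω 2 v) :
    IntegrableOn (ellipticOp Ω A v) Ω :=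
  integrable_finsetSum _ fun i _ => integrable_finsetSum _ fun j _ =>
    hA.integrableOn_coeff_mul hΩ i j (hv.integrableOn_weakPartial_weakPartial hΩ.isOpen i j)

lemma IsUniformlyElliptic.integrableOn_inner_matDiv (hΩ : IsLipschitzDomain Ω)
    (hA : IsUniformlyElliptic Ω A c C) {v : Eu n → ℝ} (hv : MemW1 Ω 2 v) :
    IntegrableOn (fun x => inner ℝ (matDiv A x) (weakGrad Ω v x)) Ω :=
  IntegrableOn.congr_fun (integrable_finsetSum _ fun i _ => integrable_finsetSum _ fun j _ =>
    hA.integrableOn_mul_fderiv_coeff hΩ i j _ (hv.integrableOn_weakPartial hΩ.isOpen j))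
    (fun _ hx => (hA.inner_matDiv_weakGrad hΩ.isOpen v hx).symm) hΩ.isOpen.measurableSet

/-- The divergence theorem for the vector field `A ∇v`. -/
theorem IsUniformlyElliptic.boundaryTerm_eq (hΩ : IsLipschitzDomain Ω)
    (hA : IsUniformlyElliptic Ω A c C) {v : Eu n → ℝ} (hv : MemW1 Ω 2 v) :
    IntegrableOn (conormal Ω A v) (frontier Ω) (surfaceMeasure n) ∧
      boundaryTerm Ω A v = (∫ x in Ω, ellipticOp Ω A v x) +
        ∫ x in Ω, inner ℝ (matDiv A x) (weakGrad Ω v x) := by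
  have h1 := fun j => hv.integrableOn_weakPartial hΩ.isOpen j
  have h2 := fun i j => hv.integrableOn_weakPartial_weakPartial hΩ.isOpen i j
  have key := fun i j => hA.gaussGreen hΩ (h1 j)
    (fun i => hv.memW1loc.hasWeakPartial_weakPartial hΩ.isOpen i j) (fun i => h2 i j) i j
  have hc : conormal Ω A v = fun x => ∑ i, ∑ j, outerNormal Ω x i *
      (A x i j * pointValue Ω (weakPartial Ω j v) x) := by
    ext x
    rw [conormal, matForm_eq_sum]
    rfl
  constructor
  · rw [hc]
    exact integrable_finsetSum _ fun i _ => integrable_finsetSum _ fun j _ => (key i j).1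
  · rw [boundaryTerm, hc, integral_finsetSum _ fun i _ =>
      integrable_finsetSum _ fun j _ => (key i j).1]
    have e1 : ∫ x in Ω, ellipticOp Ω A v x = ∑ i, ∑ j, ∫ x in Ω, A x i j *
        weakPartial Ω i (weakPartial Ω j v) x := by
      simp only [ellipticOp]
      rw [integral_finsetSum _ fun i _ => integrable_finsetSum _ fun j _ =>
        hA.integrableOn_coeff_mul hΩ i j (h2 i j)]
      exact Finset.sum_congr rfl fun i _ => integral_finsetSum _ fun j _ =>
        hA.integrableOn_coeff_mul hΩ i j (h2 i j)
    have e2 : ∫ x in Ω, inner ℝ (matDiv A x) (weakGrad Ω v x) = ∑ i, ∑ j,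
        ∫ x in Ω, weakPartial Ω j v x *
          fderiv ℝ (fun y => A y i j) x (EuclideanSpace.single i 1) := by
      rw [setIntegral_congr_fun hΩ.isOpen.measurableSet
        fun x hx => hA.inner_matDiv_weakGrad hΩ.isOpen v hx,
        integral_finsetSum _ fun i _ => integrable_finsetSum _ fun j _ =>
        hA.integrableOn_mul_fderiv_coeff hΩ i j _ (h1 j)]
      exact Finset.sum_congr rfl fun i _ => integral_finsetSum _ fun j _ =>
        hA.integrableOn_mul_fderiv_coeff hΩ i j _ (h1 j)
    rw [e1, e2, ← Finset.sum_add_distrib]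
    refine Finset.sum_congr rfl fun i _ => ?_
    rw [integral_finsetSum _ fun j _ => (key i j).1, ← Finset.sum_add_distrib]
    exact Finset.sum_congr rfl fun j _ => (key i j).2

end

end

noncomputable section

/-! ### The identity and the inequalities -/

section

variable {n : ℕ} {Ω : Set (Eu n)} {A : Eu n → Matrix (Fin n) (Fin n) ℝ} {c C : ℝ}
  {B : EReal} {h H Ht : ℝ → ℝ} {I : Set ℝ} {u : Eu n → ℝ}

lemma IsUniformlyElliptic.matNorm_sq (hA : IsUniformlyElliptic Ω A c C) {x : Eu n}
    (hx : x ∈ closure Ω) (y : Eu n) : matNorm (A x) y ^ 2 = matForm (A x) y y := by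
  rw [matNorm, Real.sq_sqrt]
  exact (mul_nonneg hA.c_pos.le (sq_nonneg _)).trans (hA.lower x hx y)

/-- `u` is only a.e. strongly measurable on `Ω`, so `{u ∈ (0,B)}` is merely null-measurable, and
restrictions and indicators must be handled in that generality. -/
lemma nullMeasurableSet_preimage_openInt (hu : LocallyIntegrableOn u Ω) :
    NullMeasurableSet {x | u x ∈ openInt B} (volume.restrict Ω) :=
  hu.aestronglyMeasurable.aemeasurable.nullMeasurable (isOpen_openInt B).measurableSet

lemma restrict_interiorSet (hu : LocallyIntegrableOn u Ω) :
    volume.restrict (interiorSet Ω B u) = (volume.restrict Ω).restrict {x | u x ∈ openInt B} := by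
  rw [Measure.restrict_restrict₀ (nullMeasurableSet_preimage_openInt hu), inter_comm]
  rfl

lemma integrableOn_interiorSet_iff (hu : LocallyIntegrableOn u Ω) {F : Eu n → ℝ} :
    IntegrableOn F (interiorSet Ω B u) ↔
      IntegrableOn ({x | u x ∈ openInt B}.indicator F) Ω := by
  rw [IntegrableOn, restrict_interiorSet hu, IntegrableOn]
  simp only [Integrable, hasFiniteIntegral_iff_enorm, enorm_indicator_eq_indicator_enorm,
    lintegral_indicator₀ (nullMeasurableSet_preimage_openInt hu),
    aestronglyMeasurable_indicator_iff₀ (nullMeasurableSet_preimage_openInt hu)]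

lemma setIntegral_interiorSet (hu : LocallyIntegrableOn u Ω) (F : Eu n → ℝ) :
    ∫ x in interiorSet Ω B u, F x = ∫ x in Ω, {x | u x ∈ openInt B}.indicator F x := by
  rw [restrict_interiorSet hu, integral_indicator₀ (nullMeasurableSet_preimage_openInt hu)]

/-- The weak gradient of `Ht ∘ u`. -/
lemma IsWeight.weakGrad_comp (hΩ : IsOpen Ω) (hh : IsWeight B h H Ht)
    (hI : IsEndpointExtension B I) (hu : MemW1loc Ω 2 u)
    (huI : ∀ᵐ x ∂(volume.restrict Ω), u x ∈ I) (hv : MemW1loc Ω 2 fun x => Ht (u x)) :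
    ∀ᵐ x ∂(volume.restrict Ω), weakGrad Ω (fun y => Ht (u y)) x =
      (interiorSet Ω B u).indicator (fun y => H (u y) • weakGrad Ω u y) x := by
  filter_upwards [ae_restrict_mem hΩ.measurableSet, ae_all_iff.2 (hh.weakPartial_comp hΩ hu hv),
    ae_all_iff.2 (weakPartial_comp_eq_zero hΩ hI huI hv)] with x hx h1 h2
  by_cases hxB : u x ∈ openInt B
  · have hx' : x ∈ interiorSet Ω B u := ⟨hx, hxB⟩
    rw [indicator_of_mem hx']
    ext i
    simpa [weakGrad] using h1 i hxB
  · have hx' : x ∉ interiorSet Ω B u := fun h' => hxB h'.2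
    rw [indicator_of_notMem hx']
    ext i
    simpa [weakGrad] using h2 i hxB

/-- The operator `P` applied to `Ht ∘ u`. -/
lemma IsWeight.ellipticOp_comp (hΩ : IsOpen Ω) (hA : IsUniformlyElliptic Ω A c C)
    (hh : IsWeight B h H Ht) (hI : IsEndpointExtension B I) (hu : MemW1loc Ω 2 u)
    (huI : ∀ᵐ x ∂(volume.restrict Ω), u x ∈ I) (hv : MemW1loc Ω 2 fun x => Ht (u x)) :
    ∀ᵐ x ∂(volume.restrict Ω), ellipticOp Ω A (fun y => Ht (u y)) x =
      {x | u x ∈ openInt B}.indicator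
        (fun y => matNorm (A y) (weakGrad Ω u y) ^ 2 * h (u y)) x +
      {x | u x ∈ openInt B}.indicator (fun y => ellipticOp Ω A u y * H (u y)) x := by
  filter_upwards [ae_restrict_mem hΩ.measurableSet,
    ae_all_iff.2 fun i => ae_all_iff.2 (hh.weakPartial_weakPartial_comp hΩ hu hv i),
    ae_all_iff.2 fun i => ae_all_iff.2 (weakPartial_weakPartial_comp_eq_zero hΩ hI huI hv i)]
    with x hx h1 h2
  by_cases hxB : u x ∈ openInt B
  · have hx' : x ∈ {x | u x ∈ openInt B} := hxB
    rw [indicator_of_mem hx', indicator_of_mem hx', hA.matNorm_sq (subset_closure hx),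
      matForm_eq_sum, ellipticOp, ellipticOp, Finset.sum_mul, Finset.sum_mul,
      ← Finset.sum_add_distrib]
    refine Finset.sum_congr rfl fun i _ => ?_
    rw [Finset.sum_mul, Finset.sum_mul, ← Finset.sum_add_distrib]
    refine Finset.sum_congr rfl fun j _ => ?_
    rw [h1 i j hxB]
    simp only [weakGrad]
    ring
  · have hx' : x ∉ {x | u x ∈ openInt B} := hxB
    rw [indicator_of_notMem hx', indicator_of_notMem hx', ellipticOp, add_zero]
    exact Finset.sum_eq_zero fun i _ => Finset.sum_eq_zero fun j _ => by rw [h2 i j hxB, mul_zero]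

lemma IsWeight.inner_matDiv_comp (hΩ : IsOpen Ω) (hh : IsWeight B h H Ht)
    (hI : IsEndpointExtension B I) (hu : MemW1loc Ω 2 u)
    (huI : ∀ᵐ x ∂(volume.restrict Ω), u x ∈ I) (hv : MemW1loc Ω 2 fun x => Ht (u x)) :
    ∀ᵐ x ∂(volume.restrict Ω), inner ℝ (matDiv A x) (weakGrad Ω (fun y => Ht (u y)) x) =
      {x | u x ∈ openInt B}.indicator
        (fun y => inner ℝ (matDiv A y) (weakGrad Ω u y) * H (u y)) x := by
  filter_upwards [ae_restrict_mem hΩ.measurableSet, hh.weakGrad_comp hΩ hI hu huI hv]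
    with x hx h1
  rw [h1]
  by_cases hxB : u x ∈ openInt B
  · have hx' : x ∈ interiorSet Ω B u := ⟨hx, hxB⟩
    have hx'' : x ∈ {x | u x ∈ openInt B} := hxB
    rw [indicator_of_mem hx', indicator_of_mem hx'', inner_smul_right, mul_comm]
  · have hx' : x ∉ interiorSet Ω B u := fun h' => hxB h'.2
    have hx'' : x ∉ {x | u x ∈ openInt B} := hxB
    rw [indicator_of_notMem hx', indicator_of_notMem hx'', inner_zero_right]

lemma IsUniformlyElliptic.eLpNorm_matDiv_lt_top (hΩ : IsLipschitzDomain Ω)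
    (hA : IsUniformlyElliptic Ω A c C) :
    eLpNorm (matDiv A) ∞ (volume.restrict Ω) < ⊤ := by
  choose M hM using hA.exists_bound hΩ
  rw [eLpNorm_exponent_top]
  refine eLpNormEssSup_lt_top_of_ae_bound (C := ∑ i, ∑ j, M i j) ?_
  filter_upwards [ae_restrict_mem hΩ.isOpen.measurableSet] with x hx
  have h1 : matDiv A x = ∑ i, EuclideanSpace.single i (matDiv A x i) := by
    ext k
    simp
  rw [h1]
  refine (norm_sum_le _ _).trans (Finset.sum_le_sum fun i _ => ?_)
  have h2 : ‖EuclideanSpace.single i (matDiv A x i)‖ = ‖∑ j, fderiv ℝ (fun y => A y i j) x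
      (EuclideanSpace.single j 1)‖ := PiLp.norm_single 2 (fun _ : Fin n => ℝ) i _
  rw [h2]
  refine (norm_sum_le _ _).trans (Finset.sum_le_sum fun j _ => ?_)
  refine ((fderiv ℝ _ x).le_opNorm _).trans ?_
  simpa using (hM i j x hx).2

/-- Young's inequality for the first order term. -/
lemma IsUniformlyElliptic.abs_inner_matDiv_le (hΩ : IsLipschitzDomain Ω)
    (hA : IsUniformlyElliptic Ω A c C) :
    ∀ᵐ x ∂(volume.restrict Ω), ∀ (ξ : Eu n) (p q : ℝ), 0 < q →
      |inner ℝ (matDiv A x) ξ * p| ≤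
        1 / 2 * (matNorm (A x) ξ ^ 2 * q) + (dConst Ω A c).toReal / 2 * (p ^ 2 / q) := by
  set D := eLpNorm (matDiv A) ∞ (volume.restrict Ω) with hD
  have hDt : D ≠ ⊤ := (hA.eLpNorm_matDiv_lt_top hΩ).ne
  have hd : (dConst Ω A c).toReal = D.toReal ^ 2 / c := by
    rw [dConst, ENNReal.toReal_div, ENNReal.toReal_pow, ENNReal.toReal_ofReal hA.c_pos.le]
  have hae : ∀ᵐ x ∂(volume.restrict Ω), ‖matDiv A x‖ₑ ≤ D := by
    rw [hD, eLpNorm_exponent_top]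
    exact ae_le_eLpNormEssSup
  filter_upwards [hae, ae_restrict_mem hΩ.isOpen.measurableSet] with x hx hxΩ ξ p q hq
  have hx' : ‖matDiv A x‖ ≤ D.toReal := by
    rw [← toReal_enorm]
    exact ENNReal.toReal_mono hDt hx
  have hD0 : 0 ≤ D.toReal := ENNReal.toReal_nonneg
  have hlow := hA.lower x (subset_closure hxΩ) ξ
  rw [hA.matNorm_sq (subset_closure hxΩ), hd]
  have hc := hA.c_pos
  have h1 : |inner ℝ (matDiv A x) ξ * p| ≤ D.toReal * ‖ξ‖ * |p| := by
    rw [abs_mul]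
    refine mul_le_mul_of_nonneg_right ((abs_real_inner_le_norm _ _).trans ?_) (abs_nonneg _)
    exact mul_le_mul_of_nonneg_right hx' (norm_nonneg _)
  have h2 : D.toReal * ‖ξ‖ * |p| ≤
      1 / 2 * (c * ‖ξ‖ ^ 2 * q) + D.toReal ^ 2 / c / 2 * (p ^ 2 / q) := by
    -- Completing the square, with weights chosen so that the gradient term carries exactly the
    -- ellipticity constant `c`.
    have e : 1 / 2 * (c * ‖ξ‖ ^ 2 * q) + D.toReal ^ 2 / c / 2 * (p ^ 2 / q) -
        D.toReal * ‖ξ‖ * |p| = (c * q * ‖ξ‖ - D.toReal * |p|) ^ 2 / (2 * c * q) := by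
      rw [← sq_abs p]
      field_simp
      ring
    have : 0 ≤ (c * q * ‖ξ‖ - D.toReal * |p|) ^ 2 / (2 * c * q) := by positivity
    linarith
  have h3 : c * ‖ξ‖ ^ 2 * q ≤ matForm (A x) ξ ξ * q := mul_le_mul_of_nonneg_right hlow hq.le
  linarith

lemma IsUniformlyElliptic.dConst_ne_top (hΩ : IsLipschitzDomain Ω)
    (hA : IsUniformlyElliptic Ω A c C) : dConst Ω A c ≠ ⊤ :=
  ENNReal.div_ne_top (ENNReal.pow_ne_top (hA.eLpNorm_matDiv_lt_top hΩ).ne)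
    (ENNReal.ofReal_pos.2 hA.c_pos).ne'

/-- Absorption of the first order term. -/
lemma IsUniformlyElliptic.abs_integral_inner_matDiv_le (hΩ : IsLipschitzDomain Ω)
    (hA : IsUniformlyElliptic Ω A c C) (hh : IsWeight B h H Ht) (hu : LocallyIntegrableOn u Ω)
    (hx : IntegrableOn (fun x => matNorm (A x) (weakGrad Ω u x) ^ 2 * h (u x))
      (interiorSet Ω B u))
    (hz : IntegrableOn (fun x => inner ℝ (matDiv A x) (weakGrad Ω u x) * H (u x))
      (interiorSet Ω B u))
    (hfin : dConst Ω A c * ∫⁻ x in interiorSet Ω B u, ENNReal.ofReal (GTransform h H (u x)) ≠ ⊤) :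
    2 * |∫ x in interiorSet Ω B u, inner ℝ (matDiv A x) (weakGrad Ω u x) * H (u x)| ≤
      (∫ x in interiorSet Ω B u, matNorm (A x) (weakGrad Ω u x) ^ 2 * h (u x)) +
      (dConst Ω A c * ∫⁻ x in interiorSet Ω B u, ENNReal.ofReal (GTransform h H (u x))).toReal := by
  set μ := volume.restrict (interiorSet Ω B u) with hμ
  set d := dConst Ω A c with hd
  set X : Eu n → ℝ := fun x => matNorm (A x) (weakGrad Ω u x) ^ 2 * h (u x) with hX
  set Z : Eu n → ℝ := fun x => inner ℝ (matDiv A x) (weakGrad Ω u x) * H (u x) with hZ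
  have hdt : d ≠ ⊤ := hA.dConst_ne_top hΩ
  have hmem : ∀ᵐ x ∂μ, u x ∈ openInt B := by
    rw [hμ, restrict_interiorSet hu]
    exact ae_restrict_mem₀ (nullMeasurableSet_preimage_openInt hu)
  have hYoung : ∀ᵐ x ∂μ, |Z x| ≤ 1 / 2 * X x + d.toReal / 2 * GTransform h H (u x) := by
    filter_upwards [hmem, ae_restrict_of_ae_restrict_of_subset inter_subset_left
      (hA.abs_inner_matDiv_le hΩ)] with x hxB hxY
    exact hxY _ _ _ (hh.pos _ hxB)
  have hX0 : ∀ᵐ x ∂μ, 0 ≤ X x := by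
    filter_upwards [hmem] with x hxB
    exact mul_nonneg (sq_nonneg _) (hh.pos _ hxB).le
  have hd2 : ENNReal.ofReal (d.toReal / 2) = d / 2 := by
    rw [ENNReal.ofReal_div_of_pos two_pos, ENNReal.ofReal_toReal hdt, ENNReal.ofReal_ofNat]
  -- Working with `ℝ≥0∞` integrals avoids any measurability or integrability requirement on
  -- `GTransform h H (u x)`.
  have key : ENNReal.ofReal (∫ x, |Z x| ∂μ) ≤ ENNReal.ofReal (1 / 2 * ∫ x, X x ∂μ) +
      d * (∫⁻ x, ENNReal.ofReal (GTransform h H (u x)) ∂μ) / 2 := by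
    rw [← integral_const_mul, ofReal_integral_eq_lintegral_ofReal hz.abs
      (ae_of_all _ fun _ => abs_nonneg _),
      ofReal_integral_eq_lintegral_ofReal (hx.const_mul _)
        (hX0.mono fun x h' => mul_nonneg (by norm_num) h')]
    have e1 : d * (∫⁻ x, ENNReal.ofReal (GTransform h H (u x)) ∂μ) / 2 =
        ∫⁻ x, d / 2 * ENNReal.ofReal (GTransform h H (u x)) ∂μ := by
      rw [lintegral_const_mul' _ _ (ENNReal.div_ne_top hdt two_ne_zero), mul_comm d, mul_comm (d / 2),
        mul_div_assoc]
    rw [e1, ← lintegral_add_left' (hx.const_mul _).aestronglyMeasurable.aemeasurable.ennreal_ofReal]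
    refine lintegral_mono_ae (hYoung.mono fun x h' => ?_)
    refine (ENNReal.ofReal_le_ofReal h').trans (ENNReal.ofReal_add_le.trans ?_)
    rw [ENNReal.ofReal_mul (by positivity : 0 ≤ d.toReal / 2), hd2]
  have hXi : 0 ≤ ∫ x, X x ∂μ := integral_nonneg_of_ae hX0
  have hQ2 : d * (∫⁻ x, ENNReal.ofReal (GTransform h H (u x)) ∂μ) / 2 ≠ ⊤ :=
    ENNReal.div_ne_top hfin two_ne_zero
  have := ENNReal.toReal_mono (ENNReal.add_ne_top.2 ⟨ENNReal.ofReal_ne_top, hQ2⟩) key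
  rw [ENNReal.toReal_add ENNReal.ofReal_ne_top hQ2,
    ENNReal.toReal_ofReal (integral_nonneg fun _ => abs_nonneg _),
    ENNReal.toReal_ofReal (by positivity), ENNReal.toReal_div, ENNReal.toReal_ofNat] at this
  have habs : |∫ x, Z x ∂μ| ≤ ∫ x, |Z x| ∂μ := abs_integral_le_integral_abs
  linarith

end

end

theorem theorem3p2 {n : ℕ} (hn : 2 ≤ n) (Ω : Set (Eu n)) (hΩ : IsLipschitzDomain Ω)
    (A : Eu n → Matrix (Fin n) (Fin n) ℝ) (c C : ℝ) (hA : IsUniformlyElliptic Ω A c C)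
    (B : EReal) (h H Ht : ℝ → ℝ) (hh : IsWeight B h H Ht)
    (I : Set ℝ) (hI : IsMaximalInterval B Ht I)
    (u : Eu n → ℝ) (hu : MemW1loc Ω 2 u)
    (huI : ∀ᵐ x ∂(volume.restrict Ω), u x ∈ I)
    (hHu : MemW1 Ω 2 (fun x => Ht (u x)))
    (hPu : IntegrableOn (fun x => ellipticOp Ω A u x * H (u x)) (interiorSet Ω B u)) :
    -- the weak gradient of the composition
    (∀ᵐ x ∂(volume.restrict Ω), weakGrad Ω (fun y => Ht (u y)) x =
      (interiorSet Ω B u).indicator (fun y => H (u y) • weakGrad Ω u y) x) ∧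
    -- integrability of all the integrands
    IntegrableOn (fun x => matNorm (A x) (weakGrad Ω u x) ^ 2 * h (u x)) (interiorSet Ω B u) ∧
    IntegrableOn (fun x => ellipticOp Ω A u x * H (u x)) (interiorSet Ω B u) ∧
    IntegrableOn (fun x => inner ℝ (matDiv A x) (weakGrad Ω u x) * H (u x))
      (interiorSet Ω B u) ∧
    IntegrableOn (conormal Ω A (fun x => Ht (u x))) (frontier Ω) (surfaceMeasure n) ∧
    -- the identity
    (∫ x in interiorSet Ω B u, matNorm (A x) (weakGrad Ω u x) ^ 2 * h (u x) =
      -(∫ x in interiorSet Ω B u, ellipticOp Ω A u x * H (u x))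
      - (∫ x in interiorSet Ω B u, inner ℝ (matDiv A x) (weakGrad Ω u x) * H (u x))
      + boundaryTerm Ω A (fun x => Ht (u x))) ∧
    -- the inequality for `div A ≡ 0`
    ((∀ x ∈ Ω, matDiv A x = 0) →
      ∫ x in interiorSet Ω B u, matNorm (A x) (weakGrad Ω u x) ^ 2 * h (u x) ≤
        (∫ x in interiorSet Ω B u, |ellipticOp Ω A u x| * |H (u x)|)
        + boundaryTerm Ω A (fun x => Ht (u x))) ∧
    -- the inequality otherwise; the integral of `𝒢_H(u)` may be infinite
    (¬ (∀ x ∈ Ω, matDiv A x = 0) →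
      ((∫ x in interiorSet Ω B u, matNorm (A x) (weakGrad Ω u x) ^ 2 * h (u x) : ℝ) : EReal) ≤
        ((2 * (∫ x in interiorSet Ω B u, |ellipticOp Ω A u x| * |H (u x)|)
          + 2 * boundaryTerm Ω A (fun x => Ht (u x)) : ℝ) : EReal)
        + ((dConst Ω A c * ∫⁻ x in interiorSet Ω B u,
            ENNReal.ofReal (GTransform h H (u x)) : ℝ≥0∞) : EReal)) := by
  set Ω' := interiorSet Ω B u with hΩ'
  have hO := hΩ.isOpen
  have hIe := hI.isEndpointExtension
  have hv := hHu.memW1loc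
  have hE := hh.ellipticOp_comp hO hA hIe hu huI hv
  have hD := hh.inner_matDiv_comp (A := A) hO hIe hu huI hv
  obtain ⟨hc, hΘ⟩ := hA.boundaryTerm_eq hΩ hHu
  have hPu' := (integrableOn_interiorSet_iff hu.1).1 hPu
  -- The energy density is `P(Ht ∘ u) - Pu H(u)` on `{u ∈ (0,B)}` and zero elsewhere. The first term
  -- is integrable since `Ht ∘ u ∈ W^{2,1}` and the second by hypothesis.
  have hX' : IntegrableOn ({x | u x ∈ openInt B}.indicator
      fun y => matNorm (A y) (weakGrad Ω u y) ^ 2 * h (u y)) Ω := by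
    refine ((hA.integrableOn_ellipticOp hΩ hHu).sub hPu').congr (hE.mono fun x hx => ?_)
    simp only [Pi.sub_apply, hx, add_sub_cancel_right]
  have hX := (integrableOn_interiorSet_iff (B := B) hu.1).2 hX'
  have hZ : IntegrableOn (fun x => inner ℝ (matDiv A x) (weakGrad Ω u x) * H (u x)) Ω' :=
    (integrableOn_interiorSet_iff hu.1).2 ((hA.integrableOn_inner_matDiv hΩ hHu).congr hD)
  have hid : ∫ x in Ω', matNorm (A x) (weakGrad Ω u x) ^ 2 * h (u x) =
      -(∫ x in Ω', ellipticOp Ω A u x * H (u x))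
      - (∫ x in Ω', inner ℝ (matDiv A x) (weakGrad Ω u x) * H (u x))
      + boundaryTerm Ω A (fun x => Ht (u x)) := by
    rw [hΘ, integral_congr_ae hE, integral_congr_ae hD, integral_add hX' hPu',
      setIntegral_interiorSet hu.1, setIntegral_interiorSet hu.1, setIntegral_interiorSet hu.1]
    ring
  have hP : -(∫ x in Ω', ellipticOp Ω A u x * H (u x)) ≤
      ∫ x in Ω', |ellipticOp Ω A u x| * |H (u x)| := by
    simp only [← abs_mul]
    exact (neg_le_abs _).trans abs_integral_le_integral_abs
  refine ⟨hh.weakGrad_comp hO hIe hu huI hv, hX, hPu, hZ, hc, hid, fun hdiv => ?_, fun _ => ?_⟩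
  · have hZ0 : ∫ x in Ω', inner ℝ (matDiv A x) (weakGrad Ω u x) * H (u x) = 0 := by
      rw [setIntegral_interiorSet hu.1, setIntegral_eq_zero_of_forall_eq_zero fun x hx => ?_]
      by_cases hxB : x ∈ {x | u x ∈ openInt B}
      · rw [indicator_of_mem hxB, hdiv x hx, inner_zero_left, zero_mul]
      · rw [indicator_of_notMem hxB]
    linarith
  · by_cases hfin : dConst Ω A c * ∫⁻ x in Ω', ENNReal.ofReal (GTransform h H (u x)) = ⊤
    · rw [hfin, EReal.coe_ennreal_top, EReal.coe_add_top]
      exact le_top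
    · have hab := hA.abs_integral_inner_matDiv_le hΩ hh hu.1 hX hZ hfin
      rw [← ENNReal.ofReal_toReal hfin, EReal.coe_ennreal_ofReal,
        max_eq_left ENNReal.toReal_nonneg, ← EReal.coe_add, EReal.coe_le_coe_iff]
      have := neg_abs_le (∫ x in Ω', inner ℝ (matDiv A x) (weakGrad Ω u x) * H (u x))
      -- Doubling the identity and using `hab` bounds twice the energy by the right-hand side plus
      -- one copy of the energy, which is finite and can be subtracted.
      linarith
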